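/- **Setting.** Let $n\in\{1,2\}$, $\mathbb T^n=\mathbb R^n/\mathbb Z^n$, let $a,d,T>0$ be constants and let $f\in L^\infty([0,T];L^2(\mathbb T^n;\mathbb R^n))$. The Savage–Hutter system is $$\partial_t h+\operatorname{div}(hu)=0,\qquad \partial_t(hu)+\operatorname{div}(hu\otimes u)+\nabla(ah^2)\in h\,(-d\,B(u)+f)\quad\text{in }[0,T]\times\mathbb T^n,$$ where $B(u)\subset\mathbb R^n$ is the subdifferential of $u\mapsto|u|$, i.e. $B(u)=\{u/|u|\}$ for $u\ne0$ and $B(0)$ is the closed unit ball. For $(t,x)\in[0,T]\times\mathbb T^n$ let $\tilde f=\tilde f_{t,x}$ be the multivalued map $v\mapsto -d\,B(v)+f(t,x)$. The map $R=R_{t,x}:=(-\tilde f+\mathrm{Id})^{-1}:\mathbb R^n\to\mathbb R^n$ is single-valued, and one understands $\tilde f\circ R:=R-\mathrm{Id}$. **Measure-valued solutions.** Let $(h_0,u_0)$ be given with $h_0,\,h_0u_0\in L^1(\mathbb T^n)$. Consider a triple $(\mu,m,\mu^\infty)$ of * a measurable family of probability measures $\mu_{t,x}$ on $\mathbb R^+\times\mathbb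 R^n$ (variables $(\lambda_1,\lambda')$, standing for $(h,\sqrt h\,u)$), defined for a.e. $(t,x)\in[0,T]\times\mathbb T^n$; * a finite nonnegative Borel measure $m$ on $[0,T]\times\mathbb T^n$; * an $m$-measurable family of probability measures $\mu^\infty_{t,x}$ on $\{(\beta_1,\beta')\in\mathbb R\times\mathbb R^n:|\beta_1|^4+|\beta'|^4=1,\ \beta_1\ge0\}$, defined $m$-a.e. Let $\nu_{t,x}$ be the image of $\mu_{t,x}$ under $(\lambda_1,\lambda')\mapsto(\lambda_1,R_{t,x}(\lambda'))$, write $\langle\cdot,\cdot\rangle$ for integration against these measures, set $\nu^\infty=\mu^\infty$, and put $$\bar h=\langle\lambda_1,\nu\rangle,\quad \overline{hu}=\langle\sqrt{\lambda_1}\lambda',\nu\rangle,\quad \overline{h^2}=\langle\lambda_1^2,\nu\rangle+\langle\beta_1^2,\nu^\infty\rangle m,$$ $$\overline{hu\otimes u}=\langle\lambda'\otimes\lambda',\nu\rangle+\langle\beta'\otimes\beta',\nu^\infty\rangle m,\quad \overline{h|u|^2}=\langle|\lambda'|^2,\nu\rangle+\langle|\beta'|^2,\nu^\infty\rangle m,$$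 $$\overline{h(-dB(u)+f)}=\langle\lambda_1\,\tilde f\circ R(\lambda'),\mu\rangle,\qquad \overline{h(-dB(u)+f)\cdot u}=\langle\sqrt{\lambda_1}\,\tilde f\circ R(\lambda')\cdot R(\lambda'),\mu\rangle,$$ where the parts without $m$ are densities with respect to $dt\,dx$. The triple is a *measure-valued solution with initial data $(h_0,u_0)$* if the function $\langle\lambda_1^2+|\lambda'|^2,\nu_{t,x}\rangle$ and the components of $\overline{h(-dB(u)+f)}$ are integrable on $[0,T]\times\mathbb T^n$ and, for all $\psi\in C^1([0,T]\times\mathbb T^n;\mathbb R)$ and $\phi\in C^1([0,T]\times\mathbb T^n;\mathbb R^n)$ and a.e. $\tau\in[0,T]$, $$\int_0^\tau\!\!\int_{\mathbb T^n}\partial_t\psi\,\bar h+\nabla\psi\cdot\overline{hu}\,dx\,dt+\int_{\mathbb T^n}\psi(0,x)h_0-\psi(\tau,x)\bar h(\tau,x)\,dx=0,$$ $$\int_0^\tau\!\!\int_{\mathbb T^n}\partial_t\phi\cdot\overline{hu}+\nabla\phi:\overline{hu\otimes u}+a\operatorname{div}\phi\,\overline{h^2}+\phi\cdot\overline{h(-dB(u)+f)}\,dx\,dt+\int_{\mathbb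 T^n}\phi(0,x)\cdot h_0u_0-\phi(\tau,x)\cdot\overline{hu}(\tau,x)\,dx=0 .$$ It is *admissible* if $m(\{0,T\}\times\mathbb T^n)=0$ (as is the case when $m=m_t\otimes dt$), $\overline{h(-dB(u)+f)\cdot u}$ is integrable on $[0,T]\times\mathbb T^n$, and, in the sense of distributions in $t\in(0,T)$, $$\int_{\mathbb T^n}\tfrac12\overline{h|u|^2}+a\overline{h^2}\,dx\;\le\;\int_{\mathbb T^n}\tfrac12h_0|u_0|^2+a h_0^2\,dx+\int_0^t\!\!\int_{\mathbb T^n}\overline{h(-dB(u)+f)\cdot u}\,dx\,ds .$$ **Theorem (weak–strong uniqueness).** Let $c>0$ and let $(h_0,u_0)$ satisfy $h_0\ge c$ a.e., $h_0\in L^2(\mathbb T^n)$ and $h_0|u_0|^2\in L^1(\mathbb T^n)$. Let $H:[0,T]\times\mathbb T^n\to\mathbb R$ be Lipschitz with $H(t,x)\ge c$ for all $(t,x)$, and let $U\in C^1([0,T]\times\mathbb T^n;\mathbb R^n)$. Suppose that $(H,U)$ satisfies the Savage–Hutter system a.e. in $[0,T]\times\mathbb T^n$ and that $(H,U)(0,\cdot)=(h_0,u_0)$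 a.e. If $(\mu,m,\mu^\infty)$ is an admissible measure-valued solution with the same $a$, $d$, $f$ and the same initial data, then $$\nu_{t,x}=\delta_{(H(t,x),\,\sqrt{H(t,x)}\,U(t,x))}\ \text{ for a.e. }(t,x)\in[0,T]\times\mathbb T^n,\qquad\text{and}\qquad m=0 .$$ -/

import Mathlib

open MeasureTheory ProbabilityTheory Set
open scoped NNReal ENNReal

noncomputable section

namespace SavageHutter

/-- The flat torus `ℝⁿ / ℤⁿ`; its Lebesgue measure `volume` has total mass one. -/
abbrev Torus (n : ℕ) : Type := UnitAddTorus (Fin n)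

/-- `ℝⁿ` with the Euclidean norm. -/
abbrev Vec (n : ℕ) : Type := EuclideanSpace ℝ (Fin n)

/-- Space-time points `(t, x)`. -/
abbrev SpaceTime (n : ℕ) : Type := ℝ × Torus n

/-- The phase space: a point is `(λ₁, λ')`, where `λ₁` stands for `h` and `λ'` for `√h u`. -/
abbrev Phase (n : ℕ) : Type := ℝ × Vec n

variable {n : ℕ}

/-- The covering map `ℝⁿ → ℝⁿ / ℤⁿ`. -/
def toTorus (y : Vec n) : Torus n := fun i => (y i : UnitAddCircle)

/-- Lebesgue measure `dt dx` on `[0, τ] × 𝕋ⁿ`. -/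
def slab (n : ℕ) (τ : ℝ) : Measure (SpaceTime n) :=
  ((volume : Measure ℝ).restrict (Icc 0 τ)).prod (volume : Measure (Torus n))

/-- The time derivative `∂ₜ g`. -/
def dt (g : SpaceTime n → ℝ) (p : SpaceTime n) : ℝ :=
  deriv (fun s : ℝ => g (s, p.2)) p.1

/-- The partial derivative `∂ᵢ g` with respect to the `i`-th variable of the torus. -/
def dx (i : Fin n) (g : SpaceTime n → ℝ) (p : SpaceTime n) : ℝ :=
  deriv (fun s : ℝ => g (p.1, p.2 + Pi.single i (s : UnitAddCircle))) 0

/-- The space `C¹([0, T] × 𝕋ⁿ; F)`: the lift to `[0, T] × ℝⁿ` is continuously differentiable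
up to the boundary `t = 0`, `t = T`. -/
def IsC1 {F : Type*} [NormedAddCommGroup F] [NormedSpace ℝ F] (T : ℝ)
    (g : SpaceTime n → F) : Prop :=
  ContDiffOn ℝ 1 (fun y : ℝ × Vec n => g (y.1, toTorus y.2)) (Icc 0 T ×ˢ univ)

/-- The space `L^∞([0, T]; L²(𝕋ⁿ; ℝⁿ))`. -/
def IsLinftyL2 (T : ℝ) (f : SpaceTime n → Vec n) : Prop :=
  AEStronglyMeasurable f (slab n T) ∧
    ∃ C : ℝ≥0, ∀ᵐ t ∂(volume : Measure ℝ).restrict (Icc 0 T),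
      eLpNorm (fun x : Torus n => f (t, x)) 2 volume ≤ C

/-! ### The Coulomb friction -/

/-- The multivalued map `B`: the subdifferential of `u ↦ |u|`. -/
def B (u : Vec n) : Set (Vec n) :=
  {b | ∀ w : Vec n, ‖u‖ + inner ℝ b (w - u) ≤ ‖w‖}

/-- The map `(-f̃ + Id)⁻¹` for the multivalued map `f̃ = -d B + f` with `d > 0` and `f ∈ ℝⁿ`
(see `eq_frictionResolvent_iff`). -/
def frictionResolvent (d : ℝ) (f w : Vec n) : Vec n :=
  if ‖w + f‖ ≤ d then 0 else (1 - d / ‖w + f‖) • (w + f)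

/-- The single-valued map `f̃ ∘ (-f̃ + Id)⁻¹`, understood as `(-f̃ + Id)⁻¹ - Id`. -/
def force (d : ℝ) (f w : Vec n) : Vec n := frictionResolvent d f w - w

theorem mem_B_iff (u b : Vec n) :
    b ∈ B u ↔ (u ≠ 0 → b = ‖u‖⁻¹ • u) ∧ (u = 0 → ‖b‖ ≤ 1) := by
  have key : b ∈ B u ↔ ‖b‖ ≤ 1 ∧ inner ℝ b u = ‖u‖ := by
    constructor
    · intro h
      have h0 := h 0
      have h2 := h ((2 : ℝ) • u)
      have hb := h (u + b)
      simp only [zero_sub, inner_neg_right, norm_zero] at h0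
      rw [show (2 : ℝ) • u - u = u by rw [two_smul]; abel, norm_smul] at h2
      rw [add_sub_cancel_left, real_inner_self_eq_norm_sq] at hb
      norm_num at h2
      have h3 := norm_add_le u b
      refine ⟨?_, by linarith⟩
      nlinarith [norm_nonneg b]
    · rintro ⟨h1, h2⟩ w
      rw [inner_sub_right, h2]
      have := real_inner_le_norm b w
      nlinarith [norm_nonneg w]
  rw [key]
  constructor
  · rintro ⟨h1, h2⟩
    refine ⟨fun hu => ?_, fun _ => h1⟩
    have hp : 0 < ‖u‖ := norm_pos_iff.mpr hu
    have hz : ‖b - ‖u‖⁻¹ • u‖ ^ 2 ≤ 0 := by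
      rw [norm_sub_sq_real, inner_smul_right, h2, norm_smul, norm_inv, norm_norm,
        inv_mul_cancel₀ hp.ne']
      nlinarith [norm_nonneg b]
    have hz' : ‖b - ‖u‖⁻¹ • u‖ = 0 := by
      have := sq_nonneg ‖b - ‖u‖⁻¹ • u‖
      exact pow_eq_zero_iff (two_ne_zero) |>.mp (le_antisymm hz this)
    exact sub_eq_zero.mp (norm_eq_zero.mp hz')
  · rintro ⟨h1, h2⟩
    by_cases hu : u = 0
    · exact ⟨h2 hu, by simp [hu]⟩
    · have hp : 0 < ‖u‖ := norm_pos_iff.mpr hu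
      rw [h1 hu, norm_smul, norm_inv, norm_norm, inv_mul_cancel₀ hp.ne', real_inner_smul_left,
        real_inner_self_eq_norm_sq]
      exact ⟨le_rfl, by field_simp⟩

/-- `frictionResolvent d f` is the inverse of the multivalued map `-f̃ + Id : v ↦ d B(v) - f + v`. -/
theorem eq_frictionResolvent_iff {d : ℝ} (hd : 0 < d) (f v w : Vec n) :
    v = frictionResolvent d f w ↔ ∃ b ∈ B v, w = d • b - f + v := by
  unfold frictionResolvent
  constructor
  · intro hv
    refine ⟨d⁻¹ • (w + f - v), ?_, ?_⟩
    · rw [mem_B_iff]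
      split_ifs at hv with h
      · subst hv
        refine ⟨fun h0 => absurd rfl h0, fun _ => ?_⟩
        rw [sub_zero, norm_smul, norm_inv, Real.norm_of_nonneg hd.le, inv_mul_le_iff₀ hd]
        simpa using h
      · push Not at h
        have hp : 0 < ‖w + f‖ := hd.trans h
        have hq : 0 < 1 - d / ‖w + f‖ := by
          rw [sub_pos, div_lt_one hp]; exact h
        have hn : ‖v‖ = (1 - d / ‖w + f‖) * ‖w + f‖ := by
          rw [hv, norm_smul, Real.norm_of_nonneg hq.le]
        refine ⟨fun _ => ?_, fun h0 => ?_⟩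
        · rw [hn, hv, smul_smul]
          have : w + f - (1 - d / ‖w + f‖) • (w + f) = (d / ‖w + f‖) • (w + f) := by
            rw [sub_smul, one_smul]; abel
          rw [this, smul_smul]
          congr 1
          field_simp
        · rw [h0, norm_zero] at hn
          exact absurd hn (mul_pos hq hp).ne
    · rw [smul_smul, mul_inv_cancel₀ hd.ne', one_smul]; abel
  · rintro ⟨b, hb, rfl⟩
    rw [mem_B_iff] at hb
    have e : d • b - f + v + f = d • b + v := by abel
    rw [e]
    by_cases hv : v = 0
    · have := hb.2 hv
      rw [if_pos, hv]
      rw [hv, add_zero, norm_smul, Real.norm_of_nonneg hd.le]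
      nlinarith
    · have hp : 0 < ‖v‖ := norm_pos_iff.mpr hv
      have hb' := hb.1 hv
      have e2 : d • b + v = (d / ‖v‖ + 1) • v := by
        rw [hb', smul_smul, add_smul, one_smul, div_eq_mul_inv]
      have hq : 0 < d / ‖v‖ + 1 := by positivity
      have hn : ‖(d / ‖v‖ + 1) • v‖ = d + ‖v‖ := by
        rw [norm_smul, Real.norm_of_nonneg hq.le]; field_simp
      rw [e2, hn, if_neg (by linarith), smul_smul]
      have : (1 - d / (d + ‖v‖)) * (d / ‖v‖ + 1) = 1 := by
        field_simp
        ring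
      rw [this, one_smul]

/-! ### Strong solutions -/

/-- `(H, U)` solves the Savage-Hutter system
`∂ₜH + div (HU) = 0`, `∂ₜ(HU) + div (HU ⊗ U) + ∇(aH²) ∈ H (-d B(U) + f)`
almost everywhere in `[0, T] × 𝕋ⁿ`, with initial data `(h₀, u₀)`. -/
structure IsStrongSolution (a d T : ℝ) (f : SpaceTime n → Vec n)
    (h₀ : Torus n → ℝ) (u₀ : Torus n → Vec n)
    (H : SpaceTime n → ℝ) (U : SpaceTime n → Vec n) : Prop where
  mass : ∀ᵐ p ∂slab n T, dt H p + ∑ i, dx i (fun q => H q * U q i) p = 0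
  momentum : ∀ᵐ p ∂slab n T, ∃ b ∈ B (U p), ∀ i,
    dt (fun q => H q * U q i) p + ∑ j, dx j (fun q => H q * U q i * U q j) p
      + dx i (fun q => a * H q ^ 2) p = H p * (-d * b i + f p i)
  initial_height : ∀ᵐ x : Torus n, H (0, x) = h₀ x
  initial_velocity : ∀ᵐ x : Torus n, U (0, x) = u₀ x

/-! ### Measure-valued solutions -/

/-- The nonhomogeneous half sphere `{(β₁, β') : |β₁|⁴ + |β'|⁴ = 1, β₁ ≥ 0}`. -/
def halfSphere (n : ℕ) : Set (Phase n) := {β | |β.1| ^ 4 + ‖β.2‖ ^ 4 = 1 ∧ 0 ≤ β.1}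

/-- `(μ, m, μ^∞)` is a generalised Young measure on `[0, T] × 𝕋ⁿ`: `μ` is a parametrised
probability measure on `ℝ⁺ × ℝⁿ`, `m` is a finite measure on `[0, T] × 𝕋ⁿ`, and `μ^∞` is a
parametrised probability measure on the half sphere, defined `m`-almost everywhere.
Measurability is part of the notion of a kernel. -/
structure IsGeneralizedYoungMeasure (T : ℝ) (μ : Kernel (SpaceTime n) (Phase n))
    (m : Measure (SpaceTime n)) (μinf : Kernel (SpaceTime n) (Phase n)) : Prop where
  prob : ∀ᵐ p ∂slab n T, IsProbabilityMeasure (μ p)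
  nonneg : ∀ᵐ p ∂slab n T, ∀ᵐ q ∂μ p, 0 ≤ q.1
  finite : m univ < ⊤
  support : m (Icc 0 T ×ˢ univ)ᶜ = 0
  prob_inf : ∀ᵐ p ∂m, IsProbabilityMeasure (μinf p)
  sphere : ∀ᵐ p ∂m, ∀ᵐ β ∂μinf p, β ∈ halfSphere n

/-- The oscillation measure `ν_{t,x}`: the image of `μ_{t,x}` under
`(λ₁, λ') ↦ (λ₁, (-f̃ + Id)⁻¹ λ')`, where `f̃ = -d B + f(t,x)`. -/
def pushed (d : ℝ) (f : SpaceTime n → Vec n) (μ : Kernel (SpaceTime n) (Phase n))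
    (p : SpaceTime n) : Measure (Phase n) :=
  (μ p).map (fun q => (q.1, frictionResolvent d (f p) q.2))

/-- `⟨λ₁, ν⟩`. -/
def avgHeight (ν : Measure (Phase n)) : ℝ := ∫ q, q.1 ∂ν

/-- `⟨λ₁², ν⟩`. -/
def avgHeightSq (ν : Measure (Phase n)) : ℝ := ∫ q, q.1 ^ 2 ∂ν

/-- The `i`-th component of `⟨√λ₁ λ', ν⟩`. -/
def avgMomentum (ν : Measure (Phase n)) (i : Fin n) : ℝ := ∫ q, √q.1 * q.2 i ∂ν

/-- The `(i, j)` entry of `⟨λ' ⊗ λ', ν⟩`. -/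
def avgFlux (ν : Measure (Phase n)) (i j : Fin n) : ℝ := ∫ q, q.2 i * q.2 j ∂ν

/-- The energy `⟨|λ'|² / 2 + a λ₁², ν⟩`. -/
def avgEnergy (a : ℝ) (ν : Measure (Phase n)) : ℝ := ∫ q, (‖q.2‖ ^ 2 / 2 + a * q.1 ^ 2) ∂ν

/-- The `i`-th component of `⟨λ₁ f̃ ∘ (-f̃ + Id)⁻¹(λ'), μ⟩`, which stands for `h (-d B(u) + f)`;
here `f` is the value of the force at the given point. -/
def avgForce (d : ℝ) (f : Vec n) (μ : Measure (Phase n)) (i : Fin n) : ℝ :=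
  ∫ q, q.1 * force d f q.2 i ∂μ

/-- `⟨√λ₁ f̃ ∘ (-f̃ + Id)⁻¹(λ') · (-f̃ + Id)⁻¹(λ'), μ⟩`, which stands for
`h (-d B(u) + f) · u`, because the second factor stands for `√h u`. -/
def avgPower (d : ℝ) (f : Vec n) (μ : Measure (Phase n)) : ℝ :=
  ∫ q, √q.1 * inner ℝ (force d f q.2) (frictionResolvent d f q.2) ∂μ

/-- `(μ, m, μ^∞)` is a measure-valued solution of the Savage-Hutter system on `[0, T] × 𝕋ⁿ`
with initial data `(h₀, u₀)`. The conditions preceding `mass` say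
that the integrals exist. -/
structure IsMeasureValuedSolution (a d T : ℝ) (f : SpaceTime n → Vec n)
    (h₀ : Torus n → ℝ) (u₀ : Torus n → Vec n) (μ : Kernel (SpaceTime n) (Phase n))
    (m : Measure (SpaceTime n)) (μinf : Kernel (SpaceTime n) (Phase n)) : Prop where
  young : IsGeneralizedYoungMeasure T μ m μinf
  initial_height : Integrable h₀
  initial_momentum : Integrable (fun x => h₀ x • u₀ x)
  moments : ∫⁻ p, ∫⁻ q, ENNReal.ofReal (q.1 ^ 2 + ‖q.2‖ ^ 2) ∂pushed d f μ p ∂slab n T < ⊤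
  force_integrable : ∀ i, Integrable (fun p => avgForce d (f p) (μ p) i) (slab n T)
  mass : ∀ ψ : SpaceTime n → ℝ, IsC1 T ψ →
    ∀ᵐ τ ∂(volume : Measure ℝ).restrict (Icc 0 T),
      (∫ p, (dt ψ p * avgHeight (pushed d f μ p)
          + ∑ i, dx i ψ p * avgMomentum (pushed d f μ p) i) ∂slab n τ)
        + (∫ x, (ψ (0, x) * h₀ x - ψ (τ, x) * avgHeight (pushed d f μ (τ, x)))) = 0
  momentum : ∀ φ : SpaceTime n → Vec n, IsC1 T φ →
    ∀ᵐ τ ∂(volume : Measure ℝ).restrict (Icc 0 T),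
      (∫ p, ((∑ i, dt (fun q => φ q i) p * avgMomentum (pushed d f μ p) i)
          + (∑ i, ∑ j, dx j (fun q => φ q i) p * avgFlux (pushed d f μ p) i j)
          + a * (∑ i, dx i (fun q => φ q i) p) * avgHeightSq (pushed d f μ p)
          + ∑ i, φ p i * avgForce d (f p) (μ p) i) ∂slab n τ)
        + (∫ p in Icc 0 τ ×ˢ univ,
            ((∑ i, ∑ j, dx j (fun q => φ q i) p * avgFlux (μinf p) i j)
              + a * (∑ i, dx i (fun q => φ q i) p) * avgHeightSq (μinf p)) ∂m)
        + (∫ x, ∑ i, (φ (0, x) i * (h₀ x * u₀ x i)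
            - φ (τ, x) i * avgMomentum (pushed d f μ (τ, x)) i)) = 0

/-- The initial energy `∫ ½ h₀ |u₀|² + a h₀² dx`. -/
def initialEnergy (a : ℝ) (h₀ : Torus n → ℝ) (u₀ : Torus n → Vec n) : ℝ :=
  ∫ x, (h₀ x * ‖u₀ x‖ ^ 2 / 2 + a * h₀ x ^ 2)

/-- Admissibility: the energy inequality
`E(t) ≤ E₀ - ∫₀ᵗ ∫ \overline{h (d B(u) - f) · u} dx ds` in the sense of distributions on
`(0, T)`, where `E(t) = ∫ ½ \overline{h|u|²} + a \overline{h²} dx` contains the concentration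
part. The concentration measure is meant to have the form `m_t ⊗ dt`; of this only the
consequence at the two end points of the time interval, which the test functions do not see,
is required. -/
structure IsAdmissible (a d T : ℝ) (f : SpaceTime n → Vec n)
    (h₀ : Torus n → ℝ) (u₀ : Torus n → Vec n) (μ : Kernel (SpaceTime n) (Phase n))
    (m : Measure (SpaceTime n)) (μinf : Kernel (SpaceTime n) (Phase n)) : Prop where
  end_points : m ({0, T} ×ˢ univ) = 0
  power_integrable : Integrable (fun p => avgPower d (f p) (μ p)) (slab n T)
  energy : ∀ χ : ℝ → ℝ, ContDiff ℝ (⊤ : ℕ∞) χ → HasCompactSupport χ → tsupport χ ⊆ Ioo 0 T →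
    (∀ t, 0 ≤ χ t) →
    (∫ p, χ p.1 * avgEnergy a (pushed d f μ p) ∂slab n T)
        + (∫ p, χ p.1 * avgEnergy a (μinf p) ∂m)
      ≤ ∫ t in Icc 0 T, χ t *
          (initialEnergy a h₀ u₀ + ∫ p, avgPower d (f p) (μ p) ∂slab n t)

end SavageHutter

end

open SavageHutter

/-! The proof is a relative energy argument. Write `s = √λ₁` and `v = R(λ')`, so that `v` stands for
`√h u`. The quantity to kill is the average over the Young measure of `|v - s U|² / 2 + a (λ₁ -
H)²`, together with the energy of the concentration part. Both are nonnegative. If the first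
vanishes, the oscillation measure is a Dirac mass at `(H, √H U)`; if the second vanishes, `m = 0`,
because the energy density is positive on the sphere carrying `μ^∞`.

Expanding the square gives the energy plus terms that are at most linear in `⟨λ₁⟩` and `⟨√λ₁ λ'⟩`
(`relEnergy`, `crossEnergy`). The energy is bounded by admissibility. The remaining terms have an
exact balance (`cross_balance`), found by testing the momentum equation with `U` and the mass
equation with `|U|²/2` and with `H`. As `H` is only Lipschitz, the last test needs mollification on
the covering space (`exists_C1_approx`, `mass_height`). The initial contributions cancel because the
initial data agree.

What is left is a production term. Since `H ≥ c > 0`, the momentum equation of the strong solution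
may be divided by `H` (`ae_strong`), and pure algebra (`relative_production_eq`) turns the
production into four pieces: a friction term `-d s (b - b')·(v - s U)` with `b ∈ B(v)` and `b' ∈
B(U)`, which has a sign by monotonicity of the subdifferential; two terms quadratic in the relative
quantities with coefficients `∇U`; and `-a div(H² U)`, whose integral over the torus is zero. The
external force cancels. The concentration part of the flux is bounded directly by its energy. Hence
the production is at most a constant times the relative energy.

The measure `m` need not have a density in time, so the inequality compares measures: the time
marginal `θ` of the total relative energy satisfies `θ ≤ C θ([0,t]) dt` against nonnegative test
functions. A Grönwall lemma for measures (`measure_eq_zero_of_gronwall`) gives `θ = 0`. -/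

noncomputable section

namespace SavageHutter

open Filter Topology

variable {n : ℕ}

/-! ### The torus and its universal cover -/

/-- The representative of a point of the torus in the cube `(0, 1]ⁿ`. -/
def cubeRep (x : Torus n) : Vec n :=
  WithLp.toLp 2 (fun i => (AddCircle.measurableEquivIoc 1 0 (x i) : ℝ))

theorem toTorus_cubeRep (x : Torus n) : toTorus (cubeRep x) = x := by
  funext i
  exact (AddCircle.equivIoc 1 0).symm_apply_apply (x i)

theorem cubeRep_mem (x : Torus n) (i : Fin n) : cubeRep x i ∈ Ioc (0 : ℝ) 1 := by
  have := (AddCircle.measurableEquivIoc 1 0 (x i)).2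
  exact ⟨this.1, this.2.trans_eq (zero_add 1)⟩

theorem norm_cubeRep_le (x : Torus n) : ‖cubeRep x‖ ≤ n := by
  calc ‖cubeRep x‖ ≤ ∑ i, ‖cubeRep x i‖ := by
        rw [EuclideanSpace.norm_eq]
        apply Real.sqrt_le_iff.mpr
        exact ⟨Finset.sum_nonneg fun i _ => norm_nonneg _,
          Finset.sum_sq_le_sq_sum_of_nonneg fun i _ => norm_nonneg _⟩
    _ ≤ ∑ i : Fin n, 1 := by
        refine Finset.sum_le_sum fun i _ => ?_
        have := cubeRep_mem x i
        rw [Real.norm_of_nonneg this.1.le]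
        exact this.2
    _ = n := by simp

theorem measurable_cubeRep : Measurable (cubeRep : Torus n → Vec n) := by
  refine (WithLp.measurable_toLp 2 _).comp (measurable_pi_lambda _ fun i => ?_)
  exact measurable_subtype_coe.comp
    ((AddCircle.measurableEquivIoc 1 0).measurable.comp (measurable_pi_apply i))

/-- In each coordinate the representative carries Haar measure on the circle to Lebesgue measure on
`(0, 1]`; taking products, a null set of the cube pulls back to a null set of the torus. -/
theorem ae_cubeRep {P : Vec n → Prop} (h : ∀ᵐ y, P y) : ∀ᵐ x : Torus n, P (cubeRep x) := by
  have h1 := (PiLp.volume_preserving_toLp (Fin n)).quasiMeasurePreserving.ae h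
  have h2 : MeasurePreserving (fun x : UnitAddCircle => (AddCircle.equivIoc 1 0 x : ℝ)) volume
      (volume.restrict (Ioc (0 : ℝ) (0 + 1))) := by
    refine MeasurePreserving.comp (g := Subtype.val) ⟨measurable_subtype_coe, ?_⟩
      (AddCircle.measurePreserving_equivIoc 1)
    exact map_comap_subtype_coe measurableSet_Ioc _
  have h3 := measurePreserving_pi (fun _ : Fin n => (volume : Measure UnitAddCircle)) _
    (fun _ : Fin n => h2)
  have h4 : Measure.pi (fun _ : Fin n => volume.restrict (Ioc (0 : ℝ) (0 + 1))) ≪ volume := by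
    rw [← Measure.restrict_pi_pi]
    exact Measure.restrict_le_self.absolutelyContinuous
  exact h3.quasiMeasurePreserving.ae (h4.ae_le h1)

/-- The covering map `ℝ × ℝⁿ → ℝ × 𝕋ⁿ`. -/
def cover (y : ℝ × Vec n) : SpaceTime n := (y.1, toTorus y.2)

/-- The representative of a space-time point in `ℝ × (0, 1]ⁿ`. -/
def stripRep (p : SpaceTime n) : ℝ × Vec n := (p.1, cubeRep p.2)

theorem cover_stripRep (p : SpaceTime n) : cover (stripRep p) = p :=
  Prod.ext rfl (toTorus_cubeRep p.2)

theorem measurable_stripRep : Measurable (stripRep : SpaceTime n → ℝ × Vec n) :=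
  measurable_fst.prodMk (measurable_cubeRep.comp measurable_snd)

theorem toTorus_add (y z : Vec n) : toTorus (y + z) = toTorus y + toTorus z := rfl

theorem toTorus_sub (y z : Vec n) : toTorus (y - z) = toTorus y - toTorus z := rfl

theorem toTorus_smul_single (i : Fin n) (s : ℝ) :
    toTorus (s • EuclideanSpace.single i (1 : ℝ)) = Pi.single i (s : UnitAddCircle) := by
  funext j
  by_cases h : j = i
  · subst h; simp [toTorus]
  · simp [toTorus, h]

theorem lipschitzWith_toTorus : LipschitzWith 1 (toTorus : Vec n → Torus n) := by
  refine LipschitzWith.of_dist_le_mul fun y z => ?_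
  rw [NNReal.coe_one, one_mul, dist_pi_le_iff dist_nonneg]
  intro i
  calc dist (toTorus y i) (toTorus z i) = ‖((y i - z i : ℝ) : UnitAddCircle)‖ := dist_eq_norm _ _
    _ ≤ ‖y i - z i‖ := QuotientAddGroup.norm_mk_le_norm
    _ ≤ ‖y - z‖ := PiLp.norm_apply_le (y - z) i
    _ = dist y z := (dist_eq_norm _ _).symm

/-! ### The flat strip -/

/-- The closed space-time slab `[0, T] × 𝕋ⁿ`. -/
abbrev slabSet (n : ℕ) (T : ℝ) : Set (SpaceTime n) := Icc 0 T ×ˢ univ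

theorem measurableSet_slabSet (T : ℝ) : MeasurableSet (slabSet n T) :=
  measurableSet_Icc.prod MeasurableSet.univ

theorem slab_eq (τ : ℝ) : slab n τ = (volume : Measure (SpaceTime n)).restrict (slabSet n τ) := by
  rw [Measure.volume_eq_prod, ← Measure.prod_restrict, Measure.restrict_univ]
  rfl

theorem slab_eq_restrict {τ T : ℝ} (h : τ ≤ T) :
    slab n τ = (slab n T).restrict (slabSet n τ) := by
  rw [slab_eq, slab_eq, Measure.restrict_restrict (measurableSet_slabSet τ)]
  congr 1
  rw [eq_comm, inter_eq_left]
  exact prod_mono (Icc_subset_Icc_right h) subset_rfl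

theorem slab_restrict_self (T : ℝ) : (slab n T).restrict (slabSet n T) = slab n T :=
  (slab_eq_restrict le_rfl).symm

theorem slab_le {τ T : ℝ} (h : τ ≤ T) : slab n τ ≤ slab n T := by
  rw [slab_eq_restrict h]; exact Measure.restrict_le_self

instance (T : ℝ) : IsFiniteMeasure (slab n T) := by
  unfold slab; infer_instance

theorem ae_slab_mem (T : ℝ) : ∀ᵐ p ∂slab n T, p ∈ slabSet n T := by
  rw [← slab_restrict_self]
  exact ae_restrict_mem (measurableSet_slabSet T)

theorem ae_slab_mem_Ioo (T : ℝ) : ∀ᵐ p ∂slab n T, p.1 ∈ Ioo 0 T := by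
  have h : ∀ᵐ t ∂(volume : Measure ℝ).restrict (Icc 0 T), t ∈ Ioo 0 T := by
    rw [← Measure.restrict_congr_set (Ioo_ae_eq_Icc (μ := (volume : Measure ℝ)))]
    exact ae_restrict_mem measurableSet_Ioo
  exact Measure.quasiMeasurePreserving_fst.ae h

/-- This carries Rademacher's theorem and Lebesgue differentiation, which hold a.e. on the covering
space, down to the slab. -/
theorem ae_slab_stripRep {T : ℝ} {P : ℝ × Vec n → Prop} (h : ∀ᵐ y, P y) :
    ∀ᵐ p ∂slab n T, P (stripRep p) := by
  have h1 : Measure.QuasiMeasurePreserving (cubeRep : Torus n → Vec n) volume volume :=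
    ⟨measurable_cubeRep, Measure.AbsolutelyContinuous.mk fun s _ hs => by
      rw [Measure.map_apply measurable_cubeRep ‹_›]
      have : ∀ᵐ y : Vec n, y ∉ s := measure_eq_zero_iff_ae_notMem.mp hs
      exact measure_eq_zero_iff_ae_notMem.mpr (ae_cubeRep this)⟩
  have h2 : Measure.QuasiMeasurePreserving (id : ℝ → ℝ) ((volume : Measure ℝ).restrict (Icc 0 T)) volume :=
    ⟨measurable_id, by rw [Measure.map_id]; exact Measure.restrict_le_self.absolutelyContinuous⟩
  exact (MeasureTheory.QuasiMeasurePreserving.prodMap h2 h1).ae h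

/-! ### Partial derivatives in terms of the lift to the universal cover -/

/-- A coordinate line in space keeps the time fixed and so stays in the strip. A derivative within
the strip therefore gives a genuine two-sided derivative, even at `t = 0` and `t = T`. In the time
direction this is only true for interior times. -/
theorem hasDerivAt_space {F : Type*} [NormedAddCommGroup F] [NormedSpace ℝ F]
    {T : ℝ} {g : SpaceTime n → F} {y : ℝ × Vec n} {D : ℝ × Vec n →L[ℝ] F}
    (hy : y.1 ∈ Icc 0 T) (h : HasFDerivWithinAt (g ∘ cover) D (Icc 0 T ×ˢ univ) y) (i : Fin n) :
    HasDerivAt (fun s : ℝ => g ((cover y).1, (cover y).2 + Pi.single i (s : UnitAddCircle)))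
      (D (0, EuclideanSpace.single i 1)) 0 := by
  have hc : HasDerivAt (fun s : ℝ => (y.1, y.2 + s • EuclideanSpace.single i (1 : ℝ)))
      ((0 : ℝ), EuclideanSpace.single i (1 : ℝ)) 0 := by
    refine (hasDerivAt_const _ _).prodMk ?_
    simpa using ((hasDerivAt_id (0 : ℝ)).smul_const
      (EuclideanSpace.single i (1 : ℝ))).const_add y.2
  have h' : HasFDerivWithinAt (g ∘ cover) D (Icc 0 T ×ˢ univ)
      (y.1, y.2 + (0 : ℝ) • EuclideanSpace.single i (1 : ℝ)) := by simpa using h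
  have := HasFDerivWithinAt.comp_hasDerivAt
    (f := fun s : ℝ => (y.1, y.2 + s • EuclideanSpace.single i (1 : ℝ))) (0 : ℝ) h' hc
    (Eventually.of_forall fun s => ⟨hy, mem_univ _⟩)
  refine this.congr_of_eventuallyEq (Eventually.of_forall fun s => ?_)
  simp only [Function.comp_apply, cover, toTorus_add, toTorus_smul_single]

theorem hasDerivAt_time {F : Type*} [NormedAddCommGroup F] [NormedSpace ℝ F]
    {T : ℝ} {g : SpaceTime n → F} {y : ℝ × Vec n} {D : ℝ × Vec n →L[ℝ] F}
    (hy : y.1 ∈ Ioo 0 T) (h : HasFDerivWithinAt (g ∘ cover) D (Icc 0 T ×ˢ univ) y) :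
    HasDerivAt (fun s : ℝ => g (s, (cover y).2)) (D (1, 0)) y.1 := by
  have hc : HasDerivAt (fun s : ℝ => (s, y.2)) ((1 : ℝ), (0 : Vec n)) y.1 :=
    (hasDerivAt_id _).prodMk (hasDerivAt_const _ _)
  refine HasFDerivWithinAt.comp_hasDerivAt (l := g ∘ cover) y.1 h hc ?_
  filter_upwards [isOpen_Ioo.mem_nhds hy] with s hs
  exact ⟨Ioo_subset_Icc_self hs, mem_univ _⟩

/-! ### Lipschitz functions on the slab -/

/-- Lipschitz functions on `[0, T] × 𝕋ⁿ` with a.e. differentiable restrictions to the coordinate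
lines and measurable partial derivatives. -/
structure SlabLipschitz (T : ℝ) (g : SpaceTime n → ℝ) (K : ℝ) : Prop where
  meas : AEStronglyMeasurable g (slab n T)
  bound : ∀ p ∈ slabSet n T, |g p| ≤ K
  lip_time : ∀ x, ∀ s ∈ Icc 0 T, ∀ t ∈ Icc 0 T, |g (s, x) - g (t, x)| ≤ K * |s - t|
  lip_space : ∀ t ∈ Icc 0 T, ∀ x i, ∀ s : ℝ,
    |g (t, x + Pi.single i (s : UnitAddCircle)) - g (t, x)| ≤ K * |s|
  diff_time : ∀ᵐ p ∂slab n T, DifferentiableAt ℝ (fun s : ℝ => g (s, p.2)) p.1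
  diff_space : ∀ᵐ p ∂slab n T, ∀ i, DifferentiableAt ℝ
    (fun s : ℝ => g (p.1, p.2 + Pi.single i (s : UnitAddCircle))) 0
  meas_dt : AEStronglyMeasurable (dt g) (slab n T)
  meas_dx : ∀ i, AEStronglyMeasurable (dx i g) (slab n T)

theorem dt_mul {g k : SpaceTime n → ℝ} {p : SpaceTime n}
    (hg : DifferentiableAt ℝ (fun s : ℝ => g (s, p.2)) p.1)
    (hk : DifferentiableAt ℝ (fun s : ℝ => k (s, p.2)) p.1) :
    dt (fun q => g q * k q) p = dt g p * k p + g p * dt k p :=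
  (hg.hasDerivAt.mul hk.hasDerivAt).deriv

theorem dx_mul {g k : SpaceTime n → ℝ} {p : SpaceTime n} {i : Fin n}
    (hg : DifferentiableAt ℝ (fun s : ℝ => g (p.1, p.2 + Pi.single i (s : UnitAddCircle))) 0)
    (hk : DifferentiableAt ℝ (fun s : ℝ => k (p.1, p.2 + Pi.single i (s : UnitAddCircle))) 0) :
    dx i (fun q => g q * k q) p = dx i g p * k p + g p * dx i k p := by
  have := (hg.hasDerivAt.fun_mul hk.hasDerivAt).deriv
  simpa [dx] using this

theorem mul_sub_mul_abs_le {a b c e K L r : ℝ} (ha : |a| ≤ K)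
    (hca : |c - a| ≤ K * r) (hec : |e| ≤ L) (heb : |e - b| ≤ L * r) :
    |c * e - a * b| ≤ 2 * K * L * r := by
  have h : c * e - a * b = (c - a) * e + a * (e - b) := by ring
  rw [h]
  calc |(c - a) * e + a * (e - b)| ≤ |c - a| * |e| + |a| * |e - b| := by
        rw [← abs_mul, ← abs_mul]; exact abs_add_le _ _
    _ ≤ (K * r) * L + K * (L * r) := by
        have := (abs_nonneg _).trans hca
        have := (abs_nonneg _).trans ha
        gcongr
    _ = _ := by ring

/-- One constant bounds both the values and the Lipschitz quotients; the factor `2` comes from the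
two terms of the product rule and is wasted on the values. -/
theorem SlabLipschitz.mul {T : ℝ} {g k : SpaceTime n → ℝ} {K L : ℝ}
    (hg : SlabLipschitz T g K) (hk : SlabLipschitz T k L) (hK : 0 ≤ K) (hL : 0 ≤ L) :
    SlabLipschitz T (fun p => g p * k p) (2 * K * L) where
  meas := hg.meas.mul hk.meas
  bound p hp := by
    rw [abs_mul]
    have := mul_le_mul (hg.bound p hp) (hk.bound p hp) (abs_nonneg _) hK
    nlinarith [mul_nonneg hK hL]
  lip_time x s hs t ht :=
    mul_sub_mul_abs_le (hg.bound _ ⟨ht, mem_univ _⟩)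
      (hg.lip_time x s hs t ht) (hk.bound _ ⟨hs, mem_univ _⟩) (hk.lip_time x s hs t ht)
  lip_space t ht x i s :=
    mul_sub_mul_abs_le (hg.bound _ ⟨ht, mem_univ _⟩)
      (hg.lip_space t ht x i s) (hk.bound _ ⟨ht, mem_univ _⟩) (hk.lip_space t ht x i s)
  diff_time := by
    filter_upwards [hg.diff_time, hk.diff_time] with p h1 h2 using h1.mul h2
  diff_space := by
    filter_upwards [hg.diff_space, hk.diff_space] with p h1 h2 i using (h1 i).mul (h2 i)
  meas_dt := by
    refine ((hg.meas_dt.mul hk.meas).add (hg.meas.mul hk.meas_dt)).congr ?_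
    filter_upwards [hg.diff_time, hk.diff_time] with p h1 h2 using (dt_mul h1 h2).symm
  meas_dx i := by
    refine (((hg.meas_dx i).mul hk.meas).add (hg.meas.mul (hk.meas_dx i))).congr ?_
    filter_upwards [hg.diff_space, hk.diff_space] with p h1 h2 using (dx_mul (h1 i) (h2 i)).symm

theorem abs_deriv_le_of_lip {g : ℝ → ℝ} {t K : ℝ} (hK : 0 ≤ K)
    (h : ∀ᶠ s in 𝓝 t, |g s - g t| ≤ K * |s - t|) : |deriv g t| ≤ K := by
  have := norm_deriv_le_of_lip' (𝕜 := ℝ) (f := g) (x₀ := t) hK h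
  exact this

theorem SlabLipschitz.abs_dt_le {T : ℝ} {g : SpaceTime n → ℝ} {K : ℝ} (hK : 0 ≤ K)
    (hg : SlabLipschitz T g K) {p : SpaceTime n} (hp : p.1 ∈ Ioo 0 T) : |dt g p| ≤ K := by
  refine abs_deriv_le_of_lip hK ?_
  filter_upwards [isOpen_Ioo.mem_nhds hp] with s hs
  exact hg.lip_time p.2 s (Ioo_subset_Icc_self hs) p.1 (Ioo_subset_Icc_self hp)

theorem SlabLipschitz.abs_dx_le {T : ℝ} {g : SpaceTime n → ℝ} {K : ℝ} (hK : 0 ≤ K)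
    (hg : SlabLipschitz T g K) {p : SpaceTime n} (hp : p ∈ slabSet n T) (i : Fin n) :
    |dx i g p| ≤ K := by
  refine abs_deriv_le_of_lip hK (Eventually.of_forall fun s => ?_)
  simpa using hg.lip_space p.1 hp.1 p.2 i s

theorem SlabLipschitz.integrable_dt {T : ℝ} {g : SpaceTime n → ℝ} {K : ℝ} (hK : 0 ≤ K)
    (hg : SlabLipschitz T g K) : Integrable (dt g) (slab n T) :=
  Integrable.of_bound hg.meas_dt K <| by
    filter_upwards [ae_slab_mem_Ioo T] with p hp using hg.abs_dt_le hK hp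

theorem SlabLipschitz.integrable_dx {T : ℝ} {g : SpaceTime n → ℝ} {K : ℝ} (hK : 0 ≤ K)
    (hg : SlabLipschitz T g K) (i : Fin n) : Integrable (dx i g) (slab n T) :=
  Integrable.of_bound (hg.meas_dx i) K <| by
    filter_upwards [ae_slab_mem T] with p hp using hg.abs_dx_le hK hp i

theorem SlabLipschitz.integral_dt {T : ℝ} {g : SpaceTime n → ℝ} {K : ℝ} (hK : 0 ≤ K)
    (hg : SlabLipschitz T g K) {τ : ℝ} (hτ : τ ∈ Icc 0 T) :
    ∫ p, dt g p ∂slab n τ = ∫ x, (g (τ, x) - g (0, x)) := by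
  have hi : Integrable (dt g) (slab n τ) := (hg.integrable_dt hK).mono_measure (slab_le hτ.2)
  have h := integral_prod_symm (dt g) hi
  rw [slab, h]
  refine integral_congr_ae (Eventually.of_forall fun x => ?_)
  -- On each vertical line the function is Lipschitz, hence absolutely continuous, so the
  -- fundamental theorem of calculus holds although the derivative exists only a.e.
  have hl : LipschitzOnWith ⟨K, hK⟩ (fun s => g (s, x)) (uIcc 0 τ) := by
    refine LipschitzOnWith.of_dist_le_mul fun s hs t ht => ?_
    rw [uIcc_of_le hτ.1] at hs ht
    exact hg.lip_time x s (Icc_subset_Icc_right hτ.2 hs) t (Icc_subset_Icc_right hτ.2 ht)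
  have := hl.absolutelyContinuousOnInterval.integral_deriv_eq_sub
  rw [intervalIntegral.integral_of_le hτ.1, ← integral_Icc_eq_integral_Ioc] at this
  exact this

/-- Translation invariance of the measure on the torus makes every difference quotient integrate to
zero. The Lipschitz bound dominates the quotients, so the limit integrates to zero too. -/
theorem SlabLipschitz.integral_dx {T : ℝ} {g : SpaceTime n → ℝ} {K : ℝ}
    (hg : SlabLipschitz T g K) {τ : ℝ} (hτ : τ ∈ Icc 0 T) (i : Fin n) :
    ∫ p, dx i g p ∂slab n τ = 0 := by
  let e : ℕ → SpaceTime n := fun k =>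
    (0, Pi.single i ((((k : ℝ) + 1)⁻¹ : ℝ) : UnitAddCircle))
  have hmp : ∀ k, MeasurePreserving (fun p => p + e k) (slab n τ) (slab n τ) := by
    intro k
    have h1 : MeasurePreserving (fun t : ℝ => t + (e k).1)
        ((volume : Measure ℝ).restrict (Icc 0 τ)) ((volume : Measure ℝ).restrict (Icc 0 τ)) := by
      simp only [e, add_zero]
      exact MeasurePreserving.id ((volume : Measure ℝ).restrict (Icc 0 τ))
    exact h1.prod (measurePreserving_add_right (volume : Measure (Torus n)) (e k).2)
  have hgm : AEStronglyMeasurable g (slab n τ) := hg.meas.mono_measure (slab_le hτ.2)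
  have hgi : Integrable g (slab n τ) := Integrable.of_bound hgm K <| by
    filter_upwards [ae_slab_mem τ] with p hp
    exact hg.bound p ⟨Icc_subset_Icc_right hτ.2 hp.1, mem_univ _⟩
  have hgi' : ∀ k, Integrable (fun p => g (p + e k)) (slab n τ) := fun k =>
    (hmp k).integrable_comp_of_integrable hgi
  have hzero : ∀ k : ℕ, ∫ p, ((k : ℝ) + 1) * (g (p + e k) - g p) ∂slab n τ = 0 := by
    intro k
    rw [integral_const_mul, integral_sub (hgi' k) hgi]
    have h2 : ∫ p, g (p + e k) ∂slab n τ = ∫ p, g p ∂slab n τ := by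
      have h3 : AEStronglyMeasurable g (Measure.map (fun p => p + e k) (slab n τ)) := by
        rw [(hmp k).map_eq]; exact hgm
      rw [← integral_map (hmp k).measurable.aemeasurable h3, (hmp k).map_eq]
    rw [h2, sub_self, mul_zero]
  have hlim : Tendsto (fun k : ℕ => ∫ p, ((k : ℝ) + 1) * (g (p + e k) - g p) ∂slab n τ) atTop
      (𝓝 (∫ p, dx i g p ∂slab n τ)) := by
    refine tendsto_integral_of_dominated_convergence (fun _ => K) (fun k => ?_)
      (integrable_const _) (fun k => ?_) ?_
    · exact (((hgi' k).sub hgi).const_mul _).aestronglyMeasurable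
    · filter_upwards [ae_slab_mem τ] with p hp
      have h4 := hg.lip_space p.1 (Icc_subset_Icc_right hτ.2 hp.1) p.2 i (((k : ℝ) + 1)⁻¹)
      have h5 : p + e k = (p.1, p.2 + Pi.single i ((((k : ℝ) + 1)⁻¹ : ℝ) : UnitAddCircle)) :=
        Prod.ext (add_zero _) rfl
      have h6 : (0 : ℝ) < (k : ℝ) + 1 := by positivity
      rw [h5, Real.norm_eq_abs, abs_mul, abs_of_pos h6]
      rw [abs_of_pos (inv_pos.mpr h6)] at h4
      calc ((k : ℝ) + 1) * _ ≤ ((k : ℝ) + 1) * (K * ((k : ℝ) + 1)⁻¹) :=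
            mul_le_mul_of_nonneg_left h4 h6.le
        _ = K := by field_simp
    · filter_upwards [ae_mono (slab_le hτ.2) hg.diff_space] with p hp
      have h7 := (hp i).hasDerivAt.tendsto_slope_zero
      have h8 : Tendsto (fun k : ℕ => ((k : ℝ) + 1)⁻¹) atTop (𝓝[≠] 0) := by
        refine tendsto_nhdsWithin_iff.mpr ⟨?_, Eventually.of_forall fun k => ?_⟩
        · simpa using tendsto_one_div_add_atTop_nhds_zero_nat (𝕜 := ℝ)
        · have h6 : (0 : ℝ) < (k : ℝ) + 1 := by positivity
          exact (inv_pos.mpr h6).ne'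
      refine (h7.comp h8).congr fun k => ?_
      have h5 : p + e k = (p.1, p.2 + Pi.single i ((((k : ℝ) + 1)⁻¹ : ℝ) : UnitAddCircle)) :=
        Prod.ext (add_zero _) rfl
      simp [h5]
  simp only [hzero] at hlim
  exact tendsto_nhds_unique hlim tendsto_const_nhds

/-! ### Mollification of Lipschitz functions -/

section Mollification

open scoped Convolution

variable {E : Type*} [NormedAddCommGroup E] [NormedSpace ℝ E] [FiniteDimensional ℝ E]
  [MeasurableSpace E] [BorelSpace E] (μ : Measure E) [μ.IsAddHaarMeasure]

/-- By Rademacher the integrand `φ(a) G(x - a)` is differentiable in `x` for almost every `a`, with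
a Lipschitz bound integrable in `a`. The derivative can thus be put on `G` rather than on `φ`, which
keeps the bound `K` uniform. -/
theorem hasFDerivAt_mollify (φ : ContDiffBump (0 : E)) {G : E → ℝ} {K : ℝ≥0}
    (hG : LipschitzWith K G) (x : E) :
    HasFDerivAt (φ.normed μ ⋆[ContinuousLinearMap.lsmul ℝ ℝ, μ] G)
      ((φ.normed μ ⋆[ContinuousLinearMap.lsmul ℝ ℝ, μ] (fderiv ℝ G)) x) x := by
  have hφi : Integrable (φ.normed μ) μ := φ.integrable_normed
  have hd : ∀ᵐ a ∂μ, DifferentiableAt ℝ G (x - a) :=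
    (quasiMeasurePreserving_sub_left μ x).ae hG.ae_differentiableAt
  have hm : Measurable fun a => fderiv ℝ G (x - a) :=
    (measurable_fderiv ℝ G).comp (measurable_const.sub measurable_id)
  refine (hasFDerivAt_integral_of_dominated_loc_of_lip (F := fun y a => φ.normed μ a • G (y - a))
    (F' := fun a => φ.normed μ a • fderiv ℝ G (x - a)) (bound := fun a => φ.normed μ a * K)
    (s := univ) univ_mem (Eventually.of_forall fun y => ?_) ?_ ?_ ?_ (hφi.mul_const _) ?_).2
  · exact (φ.continuous_normed.smul
      (hG.continuous.comp (continuous_const.sub continuous_id))).aestronglyMeasurable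
  · exact (φ.continuous_normed.smul
      (hG.continuous.comp (continuous_const.sub continuous_id))).integrable_of_hasCompactSupport
      (φ.hasCompactSupport_normed.smul_right)
  · exact φ.continuous_normed.aestronglyMeasurable.smul hm.aestronglyMeasurable
  · refine Eventually.of_forall fun a => LipschitzOnWith.of_dist_le_mul fun y _ z _ => ?_
    have h1 : (0 : ℝ) ≤ φ.normed μ a := φ.nonneg_normed a
    have h2 := hG.dist_le_mul (y - a) (z - a)
    rw [dist_sub_right] at h2
    have h3 : ((Real.nnabs (φ.normed μ a * K) : ℝ≥0) : ℝ) = φ.normed μ a * K := by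
      rw [Real.coe_nnabs]; exact abs_of_nonneg (mul_nonneg h1 K.2)
    rw [h3, Real.dist_eq, smul_eq_mul, smul_eq_mul, ← mul_sub, abs_mul, abs_of_nonneg h1, mul_assoc]
    exact mul_le_mul_of_nonneg_left h2 h1
  · filter_upwards [hd] with a ha
    have h1 : HasFDerivAt (fun y => G (y - a)) (fderiv ℝ G (x - a)) x := by
      rw [hasFDerivAt_comp_sub]; exact ha.hasFDerivAt
    exact h1.const_smul (φ.normed μ a)

theorem norm_mollify_le {F : Type*} [NormedAddCommGroup F] [NormedSpace ℝ F] [CompleteSpace F]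
    (φ : ContDiffBump (0 : E)) {g : E → F} {C : ℝ} (hg : ∀ x, ‖g x‖ ≤ C) (x : E) :
    ‖(φ.normed μ ⋆[ContinuousLinearMap.lsmul ℝ ℝ, μ] g) x‖ ≤ C := by
  calc _ ≤ ∫ a, φ.normed μ a * C ∂μ := by
        refine norm_integral_le_of_norm_le (φ.integrable_normed.mul_const C)
          (Eventually.of_forall fun a => ?_)
        rw [ContinuousLinearMap.lsmul_apply, norm_smul, Real.norm_of_nonneg (φ.nonneg_normed a)]
        exact mul_le_mul_of_nonneg_left (hg _) (φ.nonneg_normed a)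
    _ = C := by rw [integral_mul_const, φ.integral_normed, one_mul]

/-- Convolution with shrinking bumps. Gradients converge a.e. by Lebesgue differentiation applied to
the bounded function `fderiv ℝ G`. The penultimate clause says that periodicity is inherited, so
that the approximations descend to the torus. -/
theorem exists_smooth_approx {G : E → ℝ} {K : ℝ≥0} (hG : LipschitzWith K G) :
    ∃ S : ℕ → E → ℝ, (∀ k, ContDiff ℝ 1 (S k)) ∧ (∀ k x, ‖fderiv ℝ (S k) x‖ ≤ K) ∧
      (∀ x, Tendsto (fun k => S k x) atTop (𝓝 (G x))) ∧
      (∀ᵐ x ∂μ, Tendsto (fun k => fderiv ℝ (S k) x) atTop (𝓝 (fderiv ℝ G x))) ∧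
      (∀ k x y, (∀ z, G (x - z) = G (y - z)) → S k x = S k y) ∧
      (∀ C, (∀ x, |G x| ≤ C) → ∀ k x, |S k x| ≤ C) := by
  -- The outer radius stays a fixed multiple of the inner one, as a.e. convergence for a merely
  -- locally integrable function requires.
  let φ : ℕ → ContDiffBump (0 : E) := fun k =>
    ⟨1 / ((k : ℝ) + 1), 2 * (1 / ((k : ℝ) + 1)), by positivity, by
      have : (0 : ℝ) < 1 / ((k : ℝ) + 1) := by positivity
      linarith⟩
  have hφ : Tendsto (fun k => (φ k).rOut) atTop (𝓝 0) := by
    have := (tendsto_one_div_add_atTop_nhds_zero_nat (𝕜 := ℝ)).const_mul 2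
    rwa [mul_zero] at this
  have hfd : ∀ k x, fderiv ℝ ((φ k).normed μ ⋆[ContinuousLinearMap.lsmul ℝ ℝ, μ] G) x =
      ((φ k).normed μ ⋆[ContinuousLinearMap.lsmul ℝ ℝ, μ] (fderiv ℝ G)) x := fun k x =>
    (hasFDerivAt_mollify μ (φ k) hG x).fderiv
  have hb : ∀ x, ‖fderiv ℝ G x‖ ≤ K := fun x => norm_fderiv_le_of_lipschitz ℝ hG
  have hli : LocallyIntegrable (fderiv ℝ G) μ :=
    (locallyIntegrable_const (K : ℝ)).mono (measurable_fderiv ℝ G).aestronglyMeasurable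
      (Eventually.of_forall fun x => by simpa using hb x)
  refine ⟨fun k => (φ k).normed μ ⋆[ContinuousLinearMap.lsmul ℝ ℝ, μ] G, fun k => ?_,
    fun k x => ?_, fun x => ?_, ?_, fun k x y h => ?_, fun C hC k x => ?_⟩
  · exact (φ k).hasCompactSupport_normed.contDiff_convolution_left _ (φ k).contDiff_normed
      hG.continuous.locallyIntegrable
  · rw [hfd]; exact norm_mollify_le μ (φ k) hb x
  · exact ContDiffBump.convolution_tendsto_right_of_continuous hφ hG.continuous x
  · have := ContDiffBump.ae_convolution_tendsto_right_of_locallyIntegrable (K := 2) hφ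
      (Eventually.of_forall fun k => le_rfl) hli
    filter_upwards [this] with x hx
    exact hx.congr fun k => (hfd k x).symm
  · simp only [convolution, h]
  · exact norm_mollify_le μ (φ k) (g := G) hC x

end Mollification

/-! ### Continuously differentiable functions on the slab -/

theorem aestronglyMeasurable_comp_stripRep {T : ℝ} {F : ℝ × Vec n → ℝ}
    (hF : ContinuousOn F (Icc 0 T ×ˢ univ)) (ρ : Measure (SpaceTime n)) :
    AEStronglyMeasurable (fun p => F (stripRep p)) (ρ.restrict (slabSet n T)) := by
  classical
  have hL : MeasurableSet (Icc 0 T ×ˢ (univ : Set (Vec n))) :=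
    measurableSet_Icc.prod MeasurableSet.univ
  have h1 : Measurable ((Icc 0 T ×ˢ (univ : Set (Vec n))).piecewise F (fun _ => 0)) :=
    hF.measurable_piecewise continuousOn_const hL
  refine (h1.comp measurable_stripRep).aestronglyMeasurable.congr ?_
  filter_upwards [ae_restrict_mem (measurableSet_slabSet T)] with p hp
  exact piecewise_eq_of_mem _ _ _ (⟨hp.1, mem_univ _⟩ : stripRep p ∈ Icc 0 T ×ˢ univ)

/-- The derivative of the lift of `g`. -/
def liftDeriv (T : ℝ) (g : SpaceTime n → ℝ) (p : SpaceTime n) : ℝ × Vec n →L[ℝ] ℝ :=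
  fderivWithin ℝ (g ∘ cover) (Icc 0 T ×ˢ univ) (stripRep p)

section IsC1

variable {T : ℝ} {g : SpaceTime n → ℝ}

theorem IsC1.hasFDerivWithinAt (hg : IsC1 T g) {y : ℝ × Vec n} (hy : y.1 ∈ Icc 0 T) :
    HasFDerivWithinAt (g ∘ cover) (fderivWithin ℝ (g ∘ cover) (Icc 0 T ×ˢ univ) y)
      (Icc 0 T ×ˢ univ) y :=
  (ContDiffOn.differentiableOn hg one_ne_zero y ⟨hy, mem_univ _⟩).hasFDerivWithinAt

theorem IsC1.hasDerivAt_space (hg : IsC1 T g) {p : SpaceTime n} (hp : p ∈ slabSet n T)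
    (i : Fin n) :
    HasDerivAt (fun s : ℝ => g (p.1, p.2 + Pi.single i (s : UnitAddCircle)))
      (liftDeriv T g p (0, EuclideanSpace.single i 1)) 0 := by
  have := SavageHutter.hasDerivAt_space hp.1 (hg.hasFDerivWithinAt (y := stripRep p) hp.1) i
  rwa [cover_stripRep] at this

/-- The derivative at `r` is the derivative at `0` from the translated base point. Through
`liftDeriv` it is evaluated at the representative in the unit cube, so it stays bounded however far
the line runs. -/
theorem IsC1.hasDerivAt_space_line (hg : IsC1 T g) {t : ℝ} (ht : t ∈ Icc 0 T) (x : Torus n)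
    (i : Fin n) (r : ℝ) :
    HasDerivAt (fun s : ℝ => g (t, x + Pi.single i (s : UnitAddCircle)))
      (liftDeriv T g (t, x + Pi.single i (r : UnitAddCircle)) (0, EuclideanSpace.single i 1)) r := by
  have h1 := hg.hasDerivAt_space (p := (t, x + Pi.single i (r : UnitAddCircle))) ⟨ht, mem_univ _⟩ i
  rw [← sub_self r] at h1
  have h2 := h1.comp_sub_const r r
  refine (h2.congr_of_eventuallyEq (Eventually.of_forall fun q => ?_)).congr_deriv (by rw [sub_self])
  simp only [add_assoc, ← Pi.single_add, ← AddCircle.coe_add, add_sub_cancel]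

theorem IsC1.hasDerivAt_time (hg : IsC1 T g) {p : SpaceTime n} (hp : p.1 ∈ Ioo 0 T) :
    HasDerivAt (fun s : ℝ => g (s, p.2)) (liftDeriv T g p (1, 0)) p.1 := by
  have := SavageHutter.hasDerivAt_time hp
    (hg.hasFDerivWithinAt (y := stripRep p) (Ioo_subset_Icc_self hp))
  rwa [cover_stripRep] at this

theorem IsC1.dx_eq (hg : IsC1 T g) {p : SpaceTime n} (hp : p ∈ slabSet n T) (i : Fin n) :
    dx i g p = liftDeriv T g p (0, EuclideanSpace.single i 1) :=
  (hg.hasDerivAt_space hp i).deriv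

theorem IsC1.dt_eq (hg : IsC1 T g) {p : SpaceTime n} (hp : p.1 ∈ Ioo 0 T) :
    dt g p = liftDeriv T g p (1, 0) :=
  (hg.hasDerivAt_time hp).deriv

theorem uniqueDiffOn_strip (hT : 0 < T) : UniqueDiffOn ℝ (Icc 0 T ×ˢ (univ : Set (Vec n))) :=
  (uniqueDiffOn_Icc hT).prod uniqueDiffOn_univ

theorem IsC1.aestronglyMeasurable (hg : IsC1 T g) (ρ : Measure (SpaceTime n)) :
    AEStronglyMeasurable g (ρ.restrict (slabSet n T)) := by
  refine (aestronglyMeasurable_comp_stripRep (ContDiffOn.continuousOn hg) ρ).congr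
    (Eventually.of_forall fun p => ?_)
  exact congrArg g (cover_stripRep p)

theorem IsC1.aestronglyMeasurable_liftDeriv (hT : 0 < T) (hg : IsC1 T g) (v : ℝ × Vec n)
    (ρ : Measure (SpaceTime n)) :
    AEStronglyMeasurable (fun p => liftDeriv T g p v) (ρ.restrict (slabSet n T)) :=
  aestronglyMeasurable_comp_stripRep (F := fun y => fderivWithin ℝ (g ∘ cover) _ y v)
    ((ContDiffOn.continuousOn_fderivWithin hg (uniqueDiffOn_strip hT) le_rfl).clm_apply
      continuousOn_const) ρ

/-- The measure `ρ` is arbitrary because this is also used for the concentration measure `m`, which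
may be singular; a statement up to Lebesgue null sets would not suffice. -/
theorem IsC1.aestronglyMeasurable_dx (hT : 0 < T) (hg : IsC1 T g) (i : Fin n)
    (ρ : Measure (SpaceTime n)) :
    AEStronglyMeasurable (dx i g) (ρ.restrict (slabSet n T)) := by
  refine (hg.aestronglyMeasurable_liftDeriv hT (0, EuclideanSpace.single i 1) ρ).congr ?_
  filter_upwards [ae_restrict_mem (measurableSet_slabSet T)] with p hp using (hg.dx_eq hp i).symm

theorem IsC1.aestronglyMeasurable_dt (hT : 0 < T) (hg : IsC1 T g) :
    AEStronglyMeasurable (dt g) (slab n T) := by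
  have := hg.aestronglyMeasurable_liftDeriv hT (1, 0) (slab n T)
  rw [slab_restrict_self] at this
  refine this.congr ?_
  filter_upwards [ae_slab_mem_Ioo T] with p hp using (hg.dt_eq hp).symm

theorem norm_prod_single (i : Fin n) :
    ‖((0 : ℝ), EuclideanSpace.single i (1 : ℝ))‖ = 1 := by
  simp [Prod.norm_def]

theorem norm_one_prod_zero : ‖((1 : ℝ), (0 : Vec n))‖ = 1 := by
  simp [Prod.norm_def]

theorem abs_sub_le_of_hasDerivAt {f f' : ℝ → ℝ} {C : ℝ} (h : ∀ r, HasDerivAt f (f' r) r)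
    (hb : ∀ r, |f' r| ≤ C) (s t : ℝ) : |f s - f t| ≤ C * |s - t| :=
  convex_univ.norm_image_sub_le_of_norm_hasDerivWithin_le
    (fun r _ => (h r).hasDerivWithinAt) (fun r _ => hb r) (mem_univ t) (mem_univ s)

/-- Every point of the slab has a representative in the compact set `[0, T]` times a closed ball
containing the unit cube, where the continuous lift and its derivative are bounded. The mean value
inequality along lines gives the rest. -/
theorem IsC1.exists_slabLipschitz (hT : 0 < T) (hg : IsC1 T g) :
    ∃ K, 0 ≤ K ∧ SlabLipschitz T g K := by
  have hcomp : IsCompact (Icc 0 T ×ˢ Metric.closedBall (0 : Vec n) n) :=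
    isCompact_Icc.prod (isCompact_closedBall _ _)
  have hsub : Icc 0 T ×ˢ Metric.closedBall (0 : Vec n) n ⊆ Icc 0 T ×ˢ univ :=
    prod_mono subset_rfl (subset_univ _)
  obtain ⟨C₁, hC₁⟩ := hcomp.exists_bound_of_continuousOn
    ((ContDiffOn.continuousOn_fderivWithin hg (uniqueDiffOn_strip hT) le_rfl).mono hsub)
  obtain ⟨C₂, hC₂⟩ := hcomp.exists_bound_of_continuousOn ((ContDiffOn.continuousOn hg).mono hsub)
  have hmem : ∀ p ∈ slabSet n T, stripRep p ∈ Icc 0 T ×ˢ Metric.closedBall (0 : Vec n) n :=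
    fun p hp => ⟨hp.1, mem_closedBall_zero_iff.mpr (norm_cubeRep_le p.2)⟩
  have hD : ∀ p ∈ slabSet n T, ‖liftDeriv T g p‖ ≤ C₁ := fun p hp => hC₁ _ (hmem p hp)
  have hp0 : ((0 : ℝ), (0 : Torus n)) ∈ slabSet n T := ⟨⟨le_rfl, hT.le⟩, mem_univ _⟩
  have hC₁0 : 0 ≤ C₁ := (norm_nonneg _).trans (hD _ hp0)
  have hC₁K : C₁ ≤ max C₁ C₂ := le_max_left _ _
  have hDx : ∀ p ∈ slabSet n T, ∀ i, |liftDeriv T g p (0, EuclideanSpace.single i 1)| ≤ max C₁ C₂ :=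
    fun p hp i => by
      have := (liftDeriv T g p).le_of_opNorm_le (hD p hp) (0, EuclideanSpace.single i 1)
      rw [norm_prod_single, mul_one] at this
      exact this.trans hC₁K
  refine ⟨max C₁ C₂, hC₁0.trans hC₁K, ?_⟩
  constructor
  · have := hg.aestronglyMeasurable (slab n T)
    rwa [slab_restrict_self] at this
  · intro p hp
    have := hC₂ _ (hmem p hp)
    change ‖g (cover (stripRep p))‖ ≤ C₂ at this
    rw [cover_stripRep] at this
    exact this.trans (le_max_right _ _)
  · intro x s hs t ht
    -- One-sided derivatives are used at the end points, since `g` is unconstrained outside `[0,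
    -- T]`.
    have hdiff : ∀ r ∈ Icc 0 T, HasDerivWithinAt (fun r => g (r, x))
        (liftDeriv T g (r, x) (1, 0)) (Icc 0 T) r := by
      intro r hr
      have h1 := hg.hasFDerivWithinAt (y := stripRep (r, x)) hr
      have hc : HasDerivWithinAt (fun r : ℝ => (r, cubeRep x)) ((1 : ℝ), (0 : Vec n)) (Icc 0 T) r :=
        ((hasDerivAt_id _).prodMk (hasDerivAt_const _ _)).hasDerivWithinAt
      have h3 := HasFDerivWithinAt.comp_hasDerivWithinAt (f := fun r : ℝ => (r, cubeRep x)) r h1 hc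
        (fun r hr => ⟨hr, mem_univ _⟩)
      refine h3.congr (fun r _ => ?_) ?_
      · exact congrArg g (cover_stripRep (r, x)).symm
      · exact congrArg g (cover_stripRep (r, x)).symm
    have := (convex_Icc 0 T).norm_image_sub_le_of_norm_hasDerivWithin_le (C := max C₁ C₂)
      hdiff (fun r hr => ?_) ht hs
    · exact this
    · have := (liftDeriv T g (r, x)).le_of_opNorm_le (hD (r, x) ⟨hr, mem_univ _⟩) (1, 0)
      rw [norm_one_prod_zero, mul_one] at this
      exact this.trans hC₁K
  · intro t ht x i s
    have h0 : ∀ r : ℝ, |liftDeriv T g (t, x + Pi.single i (r : UnitAddCircle))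
        (0, EuclideanSpace.single i 1)| ≤ max C₁ C₂ := fun r => hDx _ ⟨ht, mem_univ _⟩ i
    have h1 := abs_sub_le_of_hasDerivAt (fun r => hg.hasDerivAt_space_line ht x i r) h0 s 0
    rw [AddCircle.coe_zero, Pi.single_zero, add_zero, sub_zero] at h1
    exact h1
  · filter_upwards [ae_slab_mem_Ioo T] with p hp using (hg.hasDerivAt_time hp).differentiableAt
  · filter_upwards [ae_slab_mem T] with p hp i using (hg.hasDerivAt_space hp i).differentiableAt
  · exact hg.aestronglyMeasurable_dt hT
  · intro i
    have := hg.aestronglyMeasurable_dx hT i (slab n T)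
    rwa [slab_restrict_self] at this

end IsC1

/-! ### Lipschitz functions and their smooth approximation -/

section Lipschitz

variable {T : ℝ} {H : SpaceTime n → ℝ} {K : ℝ≥0}

/-- The extension of a function on `[0, T] × 𝕋ⁿ` that is constant in time outside `[0, T]`,
lifted to `ℝ × ℝⁿ`. -/
def extLift (hT : 0 ≤ T) (H : SpaceTime n → ℝ) (y : ℝ × Vec n) : ℝ :=
  H (projIcc 0 T hT y.1, toTorus y.2)

theorem lipschitzWith_extLift (hT : 0 ≤ T) (hH : LipschitzOnWith K H (slabSet n T)) :
    LipschitzWith K (extLift hT H) := by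
  refine LipschitzWith.of_dist_le_mul fun y z => ?_
  refine (hH.dist_le_mul _ ⟨(projIcc 0 T hT y.1).2, mem_univ _⟩ _
    ⟨(projIcc 0 T hT z.1).2, mem_univ _⟩).trans ?_
  refine mul_le_mul_of_nonneg_left ?_ K.2
  rw [Prod.dist_eq, Prod.dist_eq]
  refine max_le_max ?_ ?_
  · exact abs_projIcc_sub_projIcc hT
  · simpa using lipschitzWith_toTorus.dist_le_mul y.2 z.2

theorem extLift_eq (hT : 0 ≤ T) {y : ℝ × Vec n} (hy : y.1 ∈ Icc 0 T) :
    extLift hT H y = H (cover y) := by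
  unfold extLift cover
  rw [projIcc_of_mem hT hy]

theorem extLift_stripRep_sub (hT : 0 ≤ T) (y z : ℝ × Vec n) :
    extLift hT H (stripRep (cover y) - z) = extLift hT H (y - z) := by
  have h : toTorus (cubeRep (toTorus y.2) - z.2) = toTorus (y.2 - z.2) := by
    rw [toTorus_sub, toTorus_cubeRep, toTorus_sub]
  unfold extLift
  simp only [stripRep, cover, Prod.fst_sub, Prod.snd_sub, h]

theorem exists_bound_of_lipschitz (hH : LipschitzOnWith K H (slabSet n T)) :
    ∃ C, ∀ p ∈ slabSet n T, |H p| ≤ C := by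
  have : IsCompact (slabSet n T) := isCompact_Icc.prod isCompact_univ
  exact this.exists_bound_of_continuousOn hH.continuousOn

/-- The extension is Lipschitz on the whole space, where Rademacher applies, and agrees with the
lift of `H` on the strip. -/
theorem hasFDerivWithinAt_of_extLift (hT : 0 ≤ T) {y : ℝ × Vec n} (hy : y.1 ∈ Icc 0 T)
    (h : DifferentiableAt ℝ (extLift hT H) y) :
    HasFDerivWithinAt (H ∘ cover) (fderiv ℝ (extLift hT H) y) (Icc 0 T ×ˢ univ) y :=
  h.hasFDerivAt.hasFDerivWithinAt.congr (fun _ hz => (extLift_eq hT hz.1).symm)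
    (extLift_eq hT hy).symm

instance : (volume : Measure (ℝ × Vec n)).IsAddHaarMeasure := by
  rw [Measure.volume_eq_prod]; infer_instance

theorem ae_differentiableAt_extLift (hT : 0 ≤ T) (hH : LipschitzOnWith K H (slabSet n T)) :
    ∀ᵐ p ∂slab n T, DifferentiableAt ℝ (extLift hT H) (stripRep p) :=
  ae_slab_stripRep (lipschitzWith_extLift hT hH).ae_differentiableAt

theorem ae_hasDerivAt_time (hT : 0 ≤ T) (hH : LipschitzOnWith K H (slabSet n T)) :
    ∀ᵐ p ∂slab n T, HasDerivAt (fun s : ℝ => H (s, p.2))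
      (fderiv ℝ (extLift hT H) (stripRep p) (1, 0)) p.1 := by
  filter_upwards [ae_differentiableAt_extLift hT hH, ae_slab_mem_Ioo T] with p hp hp'
  have := hasDerivAt_time (y := stripRep p) hp'
    (hasFDerivWithinAt_of_extLift hT (Ioo_subset_Icc_self hp') hp)
  rwa [cover_stripRep] at this

theorem ae_hasDerivAt_space (hT : 0 ≤ T) (hH : LipschitzOnWith K H (slabSet n T)) :
    ∀ᵐ p ∂slab n T, ∀ i, HasDerivAt
      (fun s : ℝ => H (p.1, p.2 + Pi.single i (s : UnitAddCircle)))
      (fderiv ℝ (extLift hT H) (stripRep p) (0, EuclideanSpace.single i 1)) 0 := by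
  filter_upwards [ae_differentiableAt_extLift hT hH, ae_slab_mem T] with p hp hp' i
  have := hasDerivAt_space (y := stripRep p) hp'.1 (hasFDerivWithinAt_of_extLift hT hp'.1 hp) i
  rwa [cover_stripRep] at this

theorem exists_slabLipschitz_of_lipschitz (hT : 0 ≤ T)
    (hH : LipschitzOnWith K H (slabSet n T)) : ∃ L, 0 ≤ L ∧ SlabLipschitz T H L := by
  obtain ⟨C, hC⟩ := exists_bound_of_lipschitz hH
  have hmeas : ∀ v, Measurable fun p : SpaceTime n => fderiv ℝ (extLift hT H) (stripRep p) v :=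
    fun v => (measurable_fderiv_apply_const ℝ (extLift hT H) v).comp measurable_stripRep
  refine ⟨max K C, K.2.trans (le_max_left _ _), ?_⟩
  constructor
  · have h1 : AEStronglyMeasurable H ((slab n T).restrict (slabSet n T)) := by
      have : Measurable fun p : SpaceTime n => extLift hT H (stripRep p) :=
        (lipschitzWith_extLift hT hH).continuous.measurable.comp measurable_stripRep
      refine this.aestronglyMeasurable.congr ?_
      filter_upwards [ae_restrict_mem (measurableSet_slabSet T)] with p hp
      rw [extLift_eq hT (y := stripRep p) hp.1, cover_stripRep]
    rwa [slab_restrict_self] at h1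
  · exact fun p hp => (hC p hp).trans (le_max_right _ _)
  · intro x s hs t ht
    have := hH.dist_le_mul (s, x) ⟨hs, mem_univ _⟩ (t, x) ⟨ht, mem_univ _⟩
    rw [Prod.dist_eq] at this
    simp only [dist_self, Real.dist_eq] at this
    rw [max_eq_left (abs_nonneg _)] at this
    exact this.trans (mul_le_mul_of_nonneg_right (le_max_left _ _) (abs_nonneg _))
  · intro t ht x i s
    have h1 := (lipschitzWith_extLift hT hH).dist_le_mul
      (t, cubeRep x + s • EuclideanSpace.single i (1 : ℝ)) (t, cubeRep x)
    rw [extLift_eq hT ht, extLift_eq hT ht, Prod.dist_eq] at h1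
    simp only [cover, toTorus_add, toTorus_smul_single, toTorus_cubeRep, dist_self,
      Real.dist_eq, dist_self_add_left, norm_smul, PiLp.norm_single, norm_one, mul_one,
      Real.norm_eq_abs] at h1
    rw [max_eq_right (abs_nonneg _)] at h1
    exact h1.trans (mul_le_mul_of_nonneg_right (le_max_left _ _) (abs_nonneg _))
  · filter_upwards [ae_hasDerivAt_time hT hH] with p hp using hp.differentiableAt
  · filter_upwards [ae_hasDerivAt_space hT hH] with p hp i using (hp i).differentiableAt
  · refine (hmeas (1, 0)).aestronglyMeasurable.congr ?_
    filter_upwards [ae_hasDerivAt_time hT hH] with p hp using hp.deriv.symm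
  · intro i
    refine (hmeas (0, EuclideanSpace.single i 1)).aestronglyMeasurable.congr ?_
    filter_upwards [ae_hasDerivAt_space hT hH] with p hp using (hp i).deriv.symm

/-- Mollification of the periodic extension. The uniform bounds and the a.e. convergence of
derivatives are what dominated convergence needs to pass from `C¹` test functions to the Lipschitz
function `H`. -/
theorem exists_C1_approx (hT : 0 ≤ T) (hH : LipschitzOnWith K H (slabSet n T)) :
    ∃ (S : ℕ → SpaceTime n → ℝ) (C : ℝ), (∀ k, IsC1 T (S k)) ∧
      (∀ k p, |S k p| ≤ C) ∧ (∀ k p, p.1 ∈ Ioo 0 T → |dt (S k) p| ≤ C) ∧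
      (∀ k, ∀ p ∈ slabSet n T, ∀ i, |dx i (S k) p| ≤ C) ∧
      (∀ p ∈ slabSet n T, Tendsto (fun k => S k p) atTop (𝓝 (H p))) ∧
      (∀ᵐ p ∂slab n T, Tendsto (fun k => dt (S k) p) atTop (𝓝 (dt H p))) ∧
      (∀ᵐ p ∂slab n T, ∀ i, Tendsto (fun k => dx i (S k) p) atTop (𝓝 (dx i H p))) := by
  obtain ⟨C, hC⟩ := exists_bound_of_lipschitz hH
  obtain ⟨S, hS1, hSd, hSlim, hSdlim, hSper, hSb⟩ :=
    exists_smooth_approx (volume : Measure (ℝ × Vec n)) (lipschitzWith_extLift hT hH)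
  have hcov : ∀ k, (fun p => S k (stripRep p)) ∘ cover = S k := fun k => by
    funext y
    -- Periodicity: replacing a point by its cube representative does not change the mollified
    -- value, so the lift of the descended function is `S k` itself.
    exact hSper k _ _ fun z => extLift_stripRep_sub hT y z
  have hfd : ∀ k y, HasFDerivWithinAt ((fun p => S k (stripRep p)) ∘ cover) (fderiv ℝ (S k) y)
      (Icc 0 T ×ˢ univ) y := fun k y => by
    rw [hcov]
    exact ((hS1 k).differentiable one_ne_zero y).hasFDerivAt.hasFDerivWithinAt
  have hdt : ∀ k p, p.1 ∈ Ioo 0 T →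
      dt (fun p => S k (stripRep p)) p = fderiv ℝ (S k) (stripRep p) (1, 0) := fun k p hp => by
    have := hasDerivAt_time (y := stripRep p) hp (hfd k _)
    rw [cover_stripRep] at this
    exact this.deriv
  have hdx : ∀ k, ∀ p ∈ slabSet n T, ∀ i, dx i (fun p => S k (stripRep p)) p =
      fderiv ℝ (S k) (stripRep p) (0, EuclideanSpace.single i 1) := fun k p hp i => by
    have := hasDerivAt_space (y := stripRep p) hp.1 (hfd k _) i
    rw [cover_stripRep] at this
    exact this.deriv
  refine ⟨fun k p => S k (stripRep p), max K C, fun k => ?_, fun k p => ?_, fun k p hp => ?_,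
    fun k p hp i => ?_, fun p hp => ?_, ?_, ?_⟩
  · have : ContDiffOn ℝ 1 ((fun p => S k (stripRep p)) ∘ cover) (Icc 0 T ×ˢ univ) := by
      rw [hcov]; exact (hS1 k).contDiffOn
    exact this
  · exact (hSb C (fun y => hC _ ⟨(projIcc 0 T hT y.1).2, mem_univ _⟩) k _).trans (le_max_right _ _)
  · rw [hdt k p hp]
    have := (fderiv ℝ (S k) (stripRep p)).le_of_opNorm_le (hSd k _) (1, 0)
    rw [norm_one_prod_zero, mul_one] at this
    exact this.trans (le_max_left _ _)
  · rw [hdx k p hp i]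
    have := (fderiv ℝ (S k) (stripRep p)).le_of_opNorm_le (hSd k _) (0, EuclideanSpace.single i 1)
    rw [norm_prod_single, mul_one] at this
    exact this.trans (le_max_left _ _)
  · have := hSlim (stripRep p)
    rwa [extLift_eq hT (y := stripRep p) hp.1, cover_stripRep] at this
  · filter_upwards [ae_slab_stripRep hSdlim, ae_hasDerivAt_time hT hH, ae_slab_mem_Ioo T]
      with p h1 h2 h3
    rw [dt, h2.deriv]
    refine Tendsto.congr (fun k => (hdt k p h3).symm) ?_
    exact ((ContinuousLinearMap.apply ℝ ℝ ((1 : ℝ), (0 : Vec n))).continuous.tendsto _).comp h1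
  · filter_upwards [ae_slab_stripRep hSdlim, ae_hasDerivAt_space hT hH, ae_slab_mem T]
      with p h1 h2 h3 i
    rw [dx, (h2 i).deriv]
    refine Tendsto.congr (fun k => (hdx k p h3 i).symm) ?_
    exact ((ContinuousLinearMap.apply ℝ ℝ
      ((0 : ℝ), EuclideanSpace.single i (1 : ℝ))).continuous.tendsto _).comp h1

end Lipschitz

/-! ### Integration against generalised Young measures -/

theorem measurable_frictionResolvent (d : ℝ) :
    Measurable fun x : Vec n × Vec n => frictionResolvent d x.1 x.2 := by
  unfold frictionResolvent
  refine Measurable.ite (measurableSet_le (by fun_prop) measurable_const) measurable_const ?_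
  fun_prop

theorem measurable_frictionResolvent_comp {α : Type*} [MeasurableSpace α] (d : ℝ)
    {u w : α → Vec n} (hu : Measurable u) (hw : Measurable w) :
    Measurable fun x => frictionResolvent d (u x) (w x) :=
  Measurable.comp (g := fun x : Vec n × Vec n => frictionResolvent d x.1 x.2)
    (f := fun x => (u x, w x)) (measurable_frictionResolvent d) (hu.prodMk hw)

theorem measurable_pushMap (d : ℝ) (v : Vec n) :
    Measurable fun q : Phase n => (q.1, frictionResolvent d v q.2) :=
  measurable_fst.prodMk (measurable_frictionResolvent_comp d measurable_const measurable_snd)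

/-- The pushed Young measure agrees almost everywhere with a kernel. -/
theorem exists_kernel_pushed {d : ℝ} {f : SpaceTime n → Vec n} {μ : Kernel (SpaceTime n) (Phase n)}
    {ρ : Measure (SpaceTime n)} (hf : AEStronglyMeasurable f ρ)
    (hμ : ∀ᵐ p ∂ρ, IsProbabilityMeasure (μ p)) :
    ∃ κ : Kernel (SpaceTime n) (Phase n), ∀ᵐ p ∂ρ, κ p = pushed d f μ p := by
  classical
  have hA : MeasurableSet {p | μ p univ = 1} :=
    (μ.measurable_coe MeasurableSet.univ) (measurableSet_singleton 1)
  -- The measures `μ p` are probabilities only for a.e. `p`. Setting the others to zero gives a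
  -- finite kernel, so that the product kernel is available; a measurable version of `f` is used for
  -- the same reason in the map.
  let μ' : Kernel (SpaceTime n) (Phase n) := Kernel.piecewise hA μ 0
  have hμ' : IsFiniteKernel μ' := by
    refine ⟨⟨1, ENNReal.one_lt_top, fun p => ?_⟩⟩
    simp only [μ', Kernel.piecewise_apply']
    split_ifs with h
    · exact le_of_eq h
    · simp
  have hF : Measurable fun x : SpaceTime n × Phase n =>
      (x.2.1, frictionResolvent d (hf.mk f x.1) x.2.2) := by
    refine (measurable_fst.comp measurable_snd).prodMk
      (measurable_frictionResolvent_comp d ?_ ?_)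
    · exact hf.stronglyMeasurable_mk.measurable.comp measurable_fst
    · exact measurable_snd.comp measurable_snd
  refine ⟨(Kernel.id ×ₖ μ').map
    (fun x => (x.2.1, frictionResolvent d (hf.mk f x.1) x.2.2)), ?_⟩
  filter_upwards [hf.ae_eq_mk, hμ] with p hp hp'
  have h1 : μ' p = μ p := by
    simp only [μ', Kernel.piecewise_apply]
    exact if_pos (by simp)
  rw [Kernel.map_apply _ hF, Kernel.prod_apply, Kernel.id_apply, Measure.dirac_prod, h1,
    Measure.map_map hF measurable_prodMk_left, pushed, hp]
  rfl

/-- Measurable functions of at most quadratic growth on the phase space. -/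
structure QuadGrowth (g : Phase n → ℝ) : Prop where
  meas : Measurable g
  bound : ∃ C, ∀ q, |g q| ≤ C * (1 + (q.1 ^ 2 + ‖q.2‖ ^ 2))

theorem abs_coord_le (v : Vec n) (i : Fin n) : |v i| ≤ ‖v‖ := PiLp.norm_apply_le v i

theorem sqrt_mul_le (l r : ℝ) : √l * r ≤ 1 + (l ^ 2 + r ^ 2) := by
  have h2 : √l ^ 2 ≤ 1 + l ^ 2 := by
    rcases le_total 0 l with h | h
    · rw [Real.sq_sqrt h]; nlinarith [sq_nonneg (l - 1)]
    -- Since `√l = 0` for negative `l`, the bound holds on the whole phase space and not only where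
    -- the height is nonnegative.
    · rw [Real.sqrt_eq_zero_of_nonpos h]; nlinarith [sq_nonneg l]
  nlinarith [sq_nonneg (√l - r), sq_nonneg r]

theorem quadGrowth_height : QuadGrowth (fun q : Phase n => q.1) where
  meas := measurable_fst
  bound := ⟨1, fun q => by
    have := sq_nonneg (|q.1| - 1)
    have := sq_abs q.1
    nlinarith [sq_nonneg ‖q.2‖]⟩

theorem quadGrowth_heightSq : QuadGrowth (fun q : Phase n => q.1 ^ 2) where
  meas := measurable_fst.pow_const 2
  bound := ⟨1, fun q => by
    rw [abs_of_nonneg (sq_nonneg _)]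
    nlinarith [sq_nonneg ‖q.2‖]⟩

theorem measurable_coord (i : Fin n) : Measurable fun q : Phase n => q.2 i := by fun_prop

theorem quadGrowth_momentum (i : Fin n) : QuadGrowth (fun q : Phase n => √q.1 * q.2 i) where
  meas := (Real.continuous_sqrt.measurable.comp measurable_fst).mul (measurable_coord i)
  bound := ⟨1, fun q => by
    rw [abs_mul, abs_of_nonneg (Real.sqrt_nonneg _), one_mul]
    exact (mul_le_mul_of_nonneg_left (abs_coord_le q.2 i) (Real.sqrt_nonneg _)).trans
      (sqrt_mul_le _ _)⟩

theorem quadGrowth_flux (i j : Fin n) : QuadGrowth (fun q : Phase n => q.2 i * q.2 j) where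
  meas := (measurable_coord i).mul (measurable_coord j)
  bound := ⟨1, fun q => by
    rw [abs_mul]
    have := mul_le_mul (abs_coord_le q.2 i) (abs_coord_le q.2 j) (abs_nonneg _) (norm_nonneg _)
    nlinarith [sq_nonneg q.1]⟩

theorem quadGrowth_energy (a : ℝ) :
    QuadGrowth (fun q : Phase n => ‖q.2‖ ^ 2 / 2 + a * q.1 ^ 2) where
  meas := by fun_prop
  bound := ⟨1 + |a|, fun q => by
    refine (abs_add_le _ _).trans ?_
    rw [abs_mul, abs_of_nonneg (sq_nonneg q.1), abs_of_nonneg (by positivity)]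
    nlinarith [sq_nonneg q.1, sq_nonneg ‖q.2‖, abs_nonneg a,
      mul_nonneg (abs_nonneg a) (sq_nonneg ‖q.2‖)]⟩

theorem QuadGrowth.integrable {g : Phase n → ℝ} (hg : QuadGrowth g) {ν : Measure (Phase n)}
    [IsFiniteMeasure ν] (hν : ∫⁻ q, ENNReal.ofReal (q.1 ^ 2 + ‖q.2‖ ^ 2) ∂ν < ⊤) :
    Integrable g ν := by
  obtain ⟨C, hC⟩ := hg.bound
  have h1 : Integrable (fun q : Phase n => q.1 ^ 2 + ‖q.2‖ ^ 2) ν := by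
    refine ⟨by fun_prop, ?_⟩
    rw [hasFiniteIntegral_iff_ofReal (Eventually.of_forall fun q => by positivity)]
    exact hν
  exact (((integrable_const (1 : ℝ)).add h1).const_mul C).mono' hg.meas.aestronglyMeasurable
    (Eventually.of_forall hC)

section Pushed

variable {T d : ℝ} {f : SpaceTime n → Vec n} {μ : Kernel (SpaceTime n) (Phase n)}

theorem isProbabilityMeasure_pushed {p : SpaceTime n} (h : IsProbabilityMeasure (μ p)) :
    IsProbabilityMeasure (pushed d f μ p) :=
  Measure.isProbabilityMeasure_map (measurable_pushMap d (f p)).aemeasurable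

theorem ae_moment_lt_top (hf : AEStronglyMeasurable f (slab n T))
    (hμ : ∀ᵐ p ∂slab n T, IsProbabilityMeasure (μ p))
    (hM : ∫⁻ p, ∫⁻ q, ENNReal.ofReal (q.1 ^ 2 + ‖q.2‖ ^ 2) ∂pushed d f μ p ∂slab n T < ⊤) :
    ∀ᵐ p ∂slab n T, ∫⁻ q, ENNReal.ofReal (q.1 ^ 2 + ‖q.2‖ ^ 2) ∂pushed d f μ p < ⊤ := by
  obtain ⟨κ, hκ⟩ := exists_kernel_pushed (d := d) hf hμ
  have hm : Measurable fun q : Phase n => ENNReal.ofReal (q.1 ^ 2 + ‖q.2‖ ^ 2) := by fun_prop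
  refine ae_lt_top' ((hm.lintegral_kernel (κ := κ)).aemeasurable.congr ?_) hM.ne
  filter_upwards [hκ] with p hp
  rw [hp]

theorem QuadGrowth.integrable_pushed (hf : AEStronglyMeasurable f (slab n T))
    (hμ : ∀ᵐ p ∂slab n T, IsProbabilityMeasure (μ p))
    (hM : ∫⁻ p, ∫⁻ q, ENNReal.ofReal (q.1 ^ 2 + ‖q.2‖ ^ 2) ∂pushed d f μ p ∂slab n T < ⊤)
    {g : Phase n → ℝ} (hg : QuadGrowth g) :
    Integrable (fun p => ∫ q, g q ∂pushed d f μ p) (slab n T) := by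
  obtain ⟨κ, hκ⟩ := exists_kernel_pushed (d := d) hf hμ
  obtain ⟨C, hC⟩ := hg.bound
  have hm : Measurable fun q : Phase n => ENNReal.ofReal (q.1 ^ 2 + ‖q.2‖ ^ 2) := by fun_prop
  have hMm : AEMeasurable (fun p => ∫⁻ q, ENNReal.ofReal (q.1 ^ 2 + ‖q.2‖ ^ 2) ∂pushed d f μ p)
      (slab n T) := by
    refine (hm.lintegral_kernel (κ := κ)).aemeasurable.congr ?_
    filter_upwards [hκ] with p hp
    rw [hp]
  have hi := (((integrable_const (1 : ℝ)).add
    (integrable_toReal_of_lintegral_ne_top hMm hM.ne)).const_mul C)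
  refine hi.mono' ?_ ?_
  · refine (hg.meas.stronglyMeasurable.integral_kernel (κ := κ)).aestronglyMeasurable.congr ?_
    filter_upwards [hκ] with p hp
    rw [hp]
  · filter_upwards [hμ, ae_moment_lt_top hf hμ hM] with p hp hp'
    have := isProbabilityMeasure_pushed (d := d) (f := f) hp
    have h1 : Integrable (fun q : Phase n => q.1 ^ 2 + ‖q.2‖ ^ 2) (pushed d f μ p) := by
      refine ⟨by fun_prop, ?_⟩
      rw [hasFiniteIntegral_iff_ofReal (Eventually.of_forall fun q => by positivity)]
      exact hp'
    refine (norm_integral_le_of_norm_le (((integrable_const (1 : ℝ)).add h1).const_mul C)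
      (Eventually.of_forall hC)).trans_eq ?_
    rw [integral_const_mul]
    simp only [Pi.add_apply]
    rw [integral_add (integrable_const _) h1,
      integral_eq_lintegral_of_nonneg_ae (f := fun q : Phase n => q.1 ^ 2 + ‖q.2‖ ^ 2)
        (Eventually.of_forall fun q => by positivity) h1.aestronglyMeasurable]
    simp

end Pushed

section Concentration

variable {T : ℝ} {μ μinf : Kernel (SpaceTime n) (Phase n)} {m : Measure (SpaceTime n)}

/-- With `x = β₁²` and `y = |β'|²` the sphere is `x² + y² = 1`, so `x + y ≤ √2`; the cruder constant
`2` suffices. -/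
theorem halfSphere_le {β : Phase n} (h : β ∈ halfSphere n) : β.1 ^ 2 + ‖β.2‖ ^ 2 ≤ 2 := by
  obtain ⟨h1, h2⟩ := h
  rw [abs_of_nonneg h2] at h1
  nlinarith [sq_nonneg (β.1 ^ 2 - 1), sq_nonneg (‖β.2‖ ^ 2 - 1), sq_nonneg (β.1 ^ 2 - ‖β.2‖ ^ 2)]

theorem IsGeneralizedYoungMeasure.moment_inf (hy : IsGeneralizedYoungMeasure T μ m μinf) :
    ∀ᵐ p ∂m, ∫⁻ q, ENNReal.ofReal (q.1 ^ 2 + ‖q.2‖ ^ 2) ∂μinf p < ⊤ := by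
  filter_upwards [hy.prob_inf, hy.sphere] with p hp hs
  have : ∫⁻ q, ENNReal.ofReal (q.1 ^ 2 + ‖q.2‖ ^ 2) ∂μinf p ≤ ∫⁻ _, ENNReal.ofReal 2 ∂μinf p := by
    refine lintegral_mono_ae ?_
    filter_upwards [hs] with β hβ using ENNReal.ofReal_le_ofReal (halfSphere_le hβ)
  refine this.trans_lt ?_
  simp

theorem QuadGrowth.integrable_inf (hy : IsGeneralizedYoungMeasure T μ m μinf)
    {g : Phase n → ℝ} (hg : QuadGrowth g) : Integrable (fun p => ∫ q, g q ∂μinf p) m := by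
  obtain ⟨C, hC⟩ := hg.bound
  have : IsFiniteMeasure m := ⟨hy.finite⟩
  have hC0 : 0 ≤ C := by
    have := (abs_nonneg _).trans (hC 0)
    simpa using this
  refine Integrable.of_bound
    (hg.meas.stronglyMeasurable.integral_kernel (κ := μinf)).aestronglyMeasurable (C * 3) ?_
  filter_upwards [hy.prob_inf, hy.sphere] with p hp hs
  have h1 : ∀ᵐ β ∂μinf p, ‖g β‖ ≤ C * 3 := by
    filter_upwards [hs] with β hβ
    refine (hC β).trans (mul_le_mul_of_nonneg_left ?_ hC0)
    linarith [halfSphere_le hβ]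
  simpa using norm_integral_le_of_norm_le_const h1

end Concentration

/-! ### Monotonicity of the friction -/

theorem inner_eq_sum (x y : Vec n) : inner ℝ x y = ∑ i, x i * y i := by
  simp [PiLp.inner_apply, mul_comm]

theorem norm_sq_eq_sum (x : Vec n) : ‖x‖ ^ 2 = ∑ i, x i * x i := by
  rw [← real_inner_self_eq_norm_sq, inner_eq_sum]

theorem norm_le_one_of_mem_B {u b : Vec n} (h : b ∈ B u) : ‖b‖ ≤ 1 := by
  obtain ⟨h1, h2⟩ := (mem_B_iff u b).mp h
  by_cases hu : u = 0
  · exact h2 hu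
  · rw [h1 hu, norm_smul, norm_inv, norm_norm, inv_mul_cancel₀ (norm_ne_zero_iff.mpr hu)]

theorem inner_eq_norm_of_mem_B {u b : Vec n} (h : b ∈ B u) : inner ℝ b u = ‖u‖ := by
  obtain ⟨h1, -⟩ := (mem_B_iff u b).mp h
  by_cases hu : u = 0
  · simp [hu]
  · have hp : ‖u‖ ≠ 0 := norm_ne_zero_iff.mpr hu
    rw [h1 hu, real_inner_smul_left, real_inner_self_eq_norm_sq]
    field_simp

theorem inner_le_norm_of_mem_B {u b : Vec n} (h : b ∈ B u) (w : Vec n) : inner ℝ b w ≤ ‖w‖ :=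
  (real_inner_le_norm b w).trans
    (mul_le_of_le_one_left (norm_nonneg _) (norm_le_one_of_mem_B h))

/-- Monotonicity of the subdifferential, adapted to the variables `√h u`: an element of `B u` also
lies in `B (s • u)` for `s ≥ 0`, because the norm is positively homogeneous. It makes the friction
dissipative for the relative energy. -/
theorem inner_sub_nonneg_of_mem_B {u v b b' : Vec n} (hb : b ∈ B v) (hb' : b' ∈ B u) {s : ℝ}
    (hs : 0 ≤ s) : 0 ≤ inner ℝ (b - b') (v - s • u) := by
  have h1 := inner_eq_norm_of_mem_B hb
  have h2 := inner_eq_norm_of_mem_B hb'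
  have h3 := mul_le_mul_of_nonneg_left (inner_le_norm_of_mem_B hb u) hs
  have h4 := inner_le_norm_of_mem_B hb' v
  simp only [inner_sub_left, inner_sub_right, inner_smul_right]
  rw [h1, h2]
  linarith

/-- The resolvent relation `w = d b - f + v` with `v = R(w)` rearranges to `v - w = f - d b`: the
regularised force is an actual selection of the friction law at `R(w)`. -/
theorem exists_force_eq {d : ℝ} (hd : 0 < d) (f w : Vec n) :
    ∃ b ∈ B (frictionResolvent d f w), force d f w = f - d • b := by
  obtain ⟨b, hb, h⟩ := (eq_frictionResolvent_iff hd f (frictionResolvent d f w) w).mp rfl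
  refine ⟨b, hb, ?_⟩
  unfold force
  nth_rw 2 [h]
  abel

theorem norm_force_le {d : ℝ} (hd : 0 < d) (f w : Vec n) : ‖force d f w‖ ≤ ‖f‖ + d := by
  obtain ⟨b, hb, h⟩ := exists_force_eq hd f w
  rw [h]
  refine (norm_sub_le _ _).trans ?_
  rw [norm_smul, Real.norm_of_nonneg hd.le]
  have := mul_le_of_le_one_right hd.le (norm_le_one_of_mem_B hb)
  linarith

/-! ### The pointwise relative energy identity -/

/-- The quadratic form of a matrix is controlled by the bound on its entries. -/
theorem abs_quadratic_form_le {D : Fin n → Fin n → ℝ} {D₀ : ℝ} (hD : ∀ i j, |D i j| ≤ D₀)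
    (w : Vec n) : |∑ i, ∑ j, D i j * (w i * w j)| ≤ (n : ℝ) ^ 2 * D₀ * ‖w‖ ^ 2 := by
  have h1 : ∀ i j, |D i j * (w i * w j)| ≤ D₀ * ‖w‖ ^ 2 := fun i j => by
    rw [abs_mul, abs_mul, sq]
    have := abs_coord_le w i
    have := abs_coord_le w j
    have := (abs_nonneg _).trans (hD i j)
    have := hD i j
    gcongr
  calc |∑ i, ∑ j, D i j * (w i * w j)| ≤ ∑ i, ∑ j, |D i j * (w i * w j)| :=
        (Finset.abs_sum_le_sum_abs _ _).trans
          (Finset.sum_le_sum fun i _ => Finset.abs_sum_le_sum_abs _ _)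
    _ ≤ ∑ i : Fin n, ∑ j : Fin n, D₀ * ‖w‖ ^ 2 :=
        Finset.sum_le_sum fun i _ => Finset.sum_le_sum fun j _ => h1 i j
    _ = (n : ℝ) ^ 2 * D₀ * ‖w‖ ^ 2 := by simp; ring

theorem abs_trace_le {D : Fin n → Fin n → ℝ} {D₀ : ℝ} (hD : ∀ i j, |D i j| ≤ D₀) :
    |∑ i, D i i| ≤ n * D₀ := by
  calc |∑ i, D i i| ≤ ∑ i, |D i i| := Finset.abs_sum_le_sum_abs _ _
    _ ≤ ∑ i : Fin n, D₀ := Finset.sum_le_sum fun i _ => hD i i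
    _ = n * D₀ := by simp

theorem card_mul_le {D : Fin n → Fin n → ℝ} {D₀ : ℝ} (hD : ∀ i j, |D i j| ≤ D₀) :
    (n : ℝ) * D₀ ≤ 2 * n ^ 2 * D₀ := by
  rcases Nat.eq_zero_or_pos n with h0 | h0
  · subst h0; simp
  · have hD0 : 0 ≤ D₀ := (abs_nonneg _).trans (hD ⟨0, h0⟩ ⟨0, h0⟩)
    have : (1 : ℝ) ≤ n := by exact_mod_cast h0
    exact mul_le_mul_of_nonneg_right (by nlinarith) hD0

/-- Here `D i j` stands for `∂ⱼUᵢ`, `Ut` and `Hx` for `∂ₜU` and `∇H`, and `s` for `√λ₁`; heights are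
written as `s²` to keep the identity polynomial. The velocity equation eliminates the external force
`φ` and the mass equation eliminates `∂ₜH`. The last bracket on the right is `div(h² U)`, and
everything else is friction or quadratic in `v - s U` and `s² - h`. -/
theorem relative_production_eq {a d h Ht s : ℝ} {U Ut Hx v F b b' φ : Vec n}
    {D : Fin n → Fin n → ℝ}
    (hmass : Ht + ∑ i, Hx i * U i + h * ∑ i, D i i = 0)
    (hmom : ∀ i, Ut i + ∑ j, D i j * U j + 2 * a * Hx i = -d * b' i + φ i)
    (hF : F = φ - d • b) :
    s * inner ℝ F v - ∑ i, Ut i * (s * v i) - ∑ i, ∑ j, D i j * (v i * v j)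
      - a * (∑ i, D i i) * (s ^ 2) ^ 2 - ∑ i, U i * (s ^ 2 * F i)
      + (∑ i, U i * Ut i - 2 * a * Ht) * s ^ 2
      + ∑ j, (∑ i, U i * D i j - 2 * a * Hx j) * (s * v j) + 2 * a * h * Ht
    = -d * (s * inner ℝ (b - b') (v - s • U))
      - ∑ i, ∑ j, D i j * ((v - s • U) i * (v - s • U) j)
      - a * (∑ i, D i i) * (s ^ 2 - h) ^ 2
      - a * (2 * h * ∑ i, Hx i * U i + h ^ 2 * ∑ i, D i i) := by
  have hFi : ∀ i, F i = Ut i + ∑ j, D i j * U j + 2 * a * Hx i + d * b' i - d * b i := fun i => by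
    have h1 : F i = φ i - d * b i := by rw [hF]; simp
    rw [h1]
    linarith [hmom i]
  have e1 : ∑ i, ∑ j, D i j * (v i * v j) = ∑ i, v i * ∑ j, D i j * v j :=
    Finset.sum_congr rfl fun i _ => by
      rw [Finset.mul_sum]; exact Finset.sum_congr rfl fun j _ => by ring
  have e2 : ∑ j, (∑ i, U i * D i j - 2 * a * Hx j) * (s * v j)
      = ∑ i, (s * (U i * ∑ j, D i j * v j) - 2 * a * Hx i * (s * v i)) := by
    simp only [sub_mul, Finset.sum_sub_distrib]
    congr 1
    simp only [Finset.sum_mul, Finset.mul_sum]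
    rw [Finset.sum_comm]
    exact Finset.sum_congr rfl fun i _ => Finset.sum_congr rfl fun j _ => by ring
  have e3 : ∑ i, ∑ j, D i j * ((v - s • U) i * (v - s • U) j)
      = ∑ i, (v i - s * U i) * (∑ j, D i j * v j - s * ∑ j, D i j * U j) :=
    Finset.sum_congr rfl fun i _ => by
      rw [Finset.mul_sum, ← Finset.sum_sub_distrib, Finset.mul_sum]
      exact Finset.sum_congr rfl fun j _ => by simp; ring
  have e4 : inner ℝ (b - b') (v - s • U) = ∑ i, (b i - b' i) * (v i - s * U i) := by
    rw [inner_eq_sum]; simp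
  rw [e1, e2, e3, e4, inner_eq_sum]
  -- The inner sums are made opaque, so that the identity can be checked one index `i` at a time.
  obtain ⟨P, hP⟩ : ∃ P : Fin n → ℝ, ∀ i, ∑ j, D i j * v j = P i := ⟨_, fun _ => rfl⟩
  obtain ⟨A, hA⟩ : ∃ A : Fin n → ℝ, ∀ i, ∑ j, D i j * U j = A i := ⟨_, fun _ => rfl⟩
  simp only [hA] at hFi
  simp only [hP, hA]
  have key : s * ∑ i, F i * v i - ∑ i, Ut i * (s * v i) - ∑ i, v i * P i
      - ∑ i, U i * (s ^ 2 * F i) + (∑ i, U i * Ut i) * s ^ 2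
      + ∑ i, (s * (U i * P i) - 2 * a * Hx i * (s * v i))
      = -d * (s * ∑ i, (b i - b' i) * (v i - s * U i))
        - ∑ i, (v i - s * U i) * (P i - s * A i) - 2 * a * s ^ 2 * ∑ i, Hx i * U i := by
    simp only [Finset.mul_sum, Finset.sum_mul, ← Finset.sum_sub_distrib,
      ← Finset.sum_add_distrib]
    refine Finset.sum_congr rfl fun i _ => ?_
    rw [hFi i]
    ring
  have hHt : Ht = -(∑ i, Hx i * U i) - h * ∑ i, D i i := by linarith
  rw [hHt]
  linear_combination key

/-- The friction term is dropped by monotonicity. The matrix form costs `n² D₀ |w|²`, which is `2 n²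
D₀` times the kinetic half, and the trace costs `n D₀ ≤ 2 n² D₀`; hence the common factor `2 n² D₀`.
-/
theorem relative_production_le {a d h Ht s D₀ : ℝ} {U Ut Hx v F b b' φ : Vec n}
    {D : Fin n → Fin n → ℝ} (ha : 0 ≤ a) (hd : 0 ≤ d) (hs : 0 ≤ s)
    (hmass : Ht + ∑ i, Hx i * U i + h * ∑ i, D i i = 0)
    (hmom : ∀ i, Ut i + ∑ j, D i j * U j + 2 * a * Hx i = -d * b' i + φ i)
    (hF : F = φ - d • b) (hb : b ∈ B v) (hb' : b' ∈ B U) (hD : ∀ i j, |D i j| ≤ D₀) :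
    s * inner ℝ F v - ∑ i, Ut i * (s * v i) - ∑ i, ∑ j, D i j * (v i * v j)
      - a * (∑ i, D i i) * (s ^ 2) ^ 2 - ∑ i, U i * (s ^ 2 * F i)
      + (∑ i, U i * Ut i - 2 * a * Ht) * s ^ 2
      + ∑ j, (∑ i, U i * D i j - 2 * a * Hx j) * (s * v j) + 2 * a * h * Ht
    ≤ 2 * n ^ 2 * D₀ * (‖v - s • U‖ ^ 2 / 2 + a * (s ^ 2 - h) ^ 2)
      - a * (2 * h * ∑ i, Hx i * U i + h ^ 2 * ∑ i, D i i) := by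
  rw [relative_production_eq hmass hmom hF]
  have h1 := mul_nonneg hd (mul_nonneg hs (inner_sub_nonneg_of_mem_B hb hb' hs))
  have h2 := (abs_le.mp (abs_quadratic_form_le hD (v - s • U))).1
  have h3 := (abs_le.mp (abs_trace_le hD)).1
  have h4 := card_mul_le hD
  have h5 : -(a * (∑ i, D i i) * (s ^ 2 - h) ^ 2)
      ≤ 2 * n ^ 2 * D₀ * (a * (s ^ 2 - h) ^ 2) := by
    have : 0 ≤ a * (s ^ 2 - h) ^ 2 := by positivity
    nlinarith
  nlinarith

/-- In the production only the momentum flux and the pressure have concentration parts. Both are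
quadratic, so the energy density controls them without subtracting `U` or `H`. -/
theorem concentration_le {a D₀ : ℝ} (ha : 0 ≤ a) {D : Fin n → Fin n → ℝ}
    (hD : ∀ i j, |D i j| ≤ D₀) (q : Phase n) :
    -(∑ i, ∑ j, D i j * (q.2 i * q.2 j) + a * (∑ i, D i i) * q.1 ^ 2)
      ≤ 2 * n ^ 2 * D₀ * (‖q.2‖ ^ 2 / 2 + a * q.1 ^ 2) := by
  have h2 := (abs_le.mp (abs_quadratic_form_le hD q.2)).1
  have h3 := (abs_le.mp (abs_trace_le hD)).1
  have h4 := card_mul_le hD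
  have : 0 ≤ a * q.1 ^ 2 := by positivity
  nlinarith

/-! ### Averages -/

/-- `g` is integrable with integral `c`. -/
structure HasIntegral {α : Type*} [MeasurableSpace α] (μ : Measure α) (g : α → ℝ) (c : ℝ) :
    Prop where
  int : Integrable g μ
  eq : ∫ x, g x ∂μ = c

namespace HasIntegral

variable {α ι : Type*} [MeasurableSpace α] {μ : Measure α} {g k : α → ℝ} {c e : ℝ}

theorem add (hg : HasIntegral μ g c) (hk : HasIntegral μ k e) :
    HasIntegral μ (fun x => g x + k x) (c + e) :=
  ⟨hg.int.add hk.int, by rw [integral_add hg.int hk.int, hg.eq, hk.eq]⟩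

theorem sub (hg : HasIntegral μ g c) (hk : HasIntegral μ k e) :
    HasIntegral μ (fun x => g x - k x) (c - e) :=
  ⟨hg.int.sub hk.int, by rw [integral_sub hg.int hk.int, hg.eq, hk.eq]⟩

theorem neg (hg : HasIntegral μ g c) : HasIntegral μ (fun x => -g x) (-c) :=
  ⟨hg.int.neg, by rw [integral_neg, hg.eq]⟩

theorem const_mul (r : ℝ) (hg : HasIntegral μ g c) :
    HasIntegral μ (fun x => r * g x) (r * c) :=
  ⟨hg.int.const_mul r, by rw [integral_const_mul, hg.eq]⟩

theorem const [IsProbabilityMeasure μ] (r : ℝ) : HasIntegral μ (fun _ => r) r :=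
  ⟨integrable_const r, by simp⟩

theorem sum [Fintype ι] {g : ι → α → ℝ} {c : ι → ℝ} (h : ∀ i, HasIntegral μ (g i) (c i)) :
    HasIntegral μ (fun x => ∑ i, g i x) (∑ i, c i) :=
  ⟨integrable_finsetSum _ fun i _ => (h i).int, by
    rw [integral_finsetSum _ fun i _ => (h i).int]
    exact Finset.sum_congr rfl fun i _ => (h i).eq⟩

theorem mono (hg : HasIntegral μ g c) (hk : HasIntegral μ k e) (h : ∀ᵐ x ∂μ, g x ≤ k x) :
    c ≤ e := by
  rw [← hg.eq, ← hk.eq]; exact integral_mono_ae hg.int hk.int h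

theorem of_integrable (h : Integrable g μ) : HasIntegral μ g (∫ x, g x ∂μ) := ⟨h, rfl⟩

theorem map {β : Type*} [MeasurableSpace β] {Φ : α → β} {g : β → ℝ} (hΦ : Measurable Φ)
    (hg : HasIntegral (μ.map Φ) g c) : HasIntegral μ (fun x => g (Φ x)) c :=
  ⟨hg.int.comp_measurable hΦ, by
    rw [← hg.eq, integral_map hΦ.aemeasurable hg.int.aestronglyMeasurable]⟩

end HasIntegral

/-- The relative energy `⟨|λ' - √λ₁ U|² / 2 + a (λ₁ - h)², ν⟩`, expanded. -/
def relEnergy (a h : ℝ) (U : Vec n) (ν : Measure (Phase n)) : ℝ :=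
  avgEnergy a ν - ∑ i, U i * avgMomentum ν i + (‖U‖ ^ 2 / 2 - 2 * a * h) * avgHeight ν + a * h ^ 2

theorem hasIntegral_relEnergy {a h : ℝ} {U : Vec n} {ν : Measure (Phase n)}
    [IsProbabilityMeasure ν] (hν : ∫⁻ q, ENNReal.ofReal (q.1 ^ 2 + ‖q.2‖ ^ 2) ∂ν < ⊤)
    (hpos : ∀ᵐ q ∂ν, 0 ≤ q.1) :
    HasIntegral ν (fun q => ‖q.2 - √q.1 • U‖ ^ 2 / 2 + a * (q.1 - h) ^ 2) (relEnergy a h U ν) := by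
  have h1 : HasIntegral ν _ (relEnergy a h U ν) :=
    (((HasIntegral.of_integrable ((quadGrowth_energy a).integrable hν)).sub
      (HasIntegral.sum fun i => (HasIntegral.of_integrable
        ((quadGrowth_momentum i).integrable hν)).const_mul (U i))).add
      ((HasIntegral.of_integrable (quadGrowth_height.integrable hν)).const_mul
        (‖U‖ ^ 2 / 2 - 2 * a * h))).add (HasIntegral.const (a * h ^ 2))
  have h2 : ∀ᵐ q ∂ν, ‖q.2‖ ^ 2 / 2 + a * q.1 ^ 2 - ∑ i, U i * (√q.1 * q.2 i)
      + (‖U‖ ^ 2 / 2 - 2 * a * h) * q.1 + a * h ^ 2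
      = ‖q.2 - √q.1 • U‖ ^ 2 / 2 + a * (q.1 - h) ^ 2 := by
    -- Expanding the square needs `(√λ₁)² = λ₁`, which is where the support of the measure in
    -- nonnegative heights enters.
    filter_upwards [hpos] with q hq
    rw [norm_sub_sq_real, inner_smul_right, norm_smul, Real.norm_of_nonneg (Real.sqrt_nonneg _),
      mul_pow, Real.sq_sqrt hq, inner_eq_sum]
    have : ∑ i, U i * (√q.1 * q.2 i) = √q.1 * ∑ i, q.2 i * U i := by
      rw [Finset.mul_sum]; exact Finset.sum_congr rfl fun i _ => by ring
    rw [this]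
    ring
  exact ⟨h1.int.congr h2, by rw [← h1.eq]; exact (integral_congr_ae h2).symm⟩

/-! ### Averages of the pointwise production inequalities -/

section Pointwise

variable {d : ℝ} {f : SpaceTime n → Vec n} {μ : Kernel (SpaceTime n) (Phase n)} {p : SpaceTime n}

theorem measurable_force (d : ℝ) (v : Vec n) : Measurable fun q : Phase n => force d v q.2 :=
  (measurable_frictionResolvent_comp d measurable_const measurable_snd).sub measurable_snd

theorem hasIntegral_avgForce (hd : 0 < d) (hp : IsProbabilityMeasure (μ p))
    (hM : ∫⁻ q, ENNReal.ofReal (q.1 ^ 2 + ‖q.2‖ ^ 2) ∂pushed d f μ p < ⊤) (i : Fin n) :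
    HasIntegral (μ p) (fun q => q.1 * force d (f p) q.2 i) (avgForce d (f p) (μ p) i) := by
  have := isProbabilityMeasure_pushed (d := d) (f := f) hp
  have h1 : Integrable (fun q : Phase n => q.1) (μ p) :=
    ((HasIntegral.of_integrable (quadGrowth_height.integrable hM)).map
      (measurable_pushMap d (f p))).int
  refine HasIntegral.of_integrable ((h1.norm.mul_const (‖f p‖ + d)).mono' ?_ ?_)
  · exact (measurable_fst.mul ((EuclideanSpace.proj i).continuous.measurable.comp
      (measurable_force d (f p)))).aestronglyMeasurable
  · refine Eventually.of_forall fun q => ?_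
    rw [norm_mul]
    exact mul_le_mul_of_nonneg_left
      ((abs_coord_le _ i).trans (norm_force_le hd _ _)) (norm_nonneg _)

theorem hasIntegral_avgPower (hd : 0 < d) (hp : IsProbabilityMeasure (μ p))
    (hM : ∫⁻ q, ENNReal.ofReal (q.1 ^ 2 + ‖q.2‖ ^ 2) ∂pushed d f μ p < ⊤) :
    HasIntegral (μ p)
      (fun q => √q.1 * inner ℝ (force d (f p) q.2) (frictionResolvent d (f p) q.2))
      (avgPower d (f p) (μ p)) := by
  have := isProbabilityMeasure_pushed (d := d) (f := f) hp
  have h1 : QuadGrowth (fun q : Phase n => (‖f p‖ + d) * (1 + (q.1 ^ 2 + ‖q.2‖ ^ 2))) :=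
    ⟨by fun_prop, ‖f p‖ + d, fun q => le_of_eq (abs_of_nonneg (by positivity))⟩
  have h2 := ((HasIntegral.of_integrable (h1.integrable hM)).map (measurable_pushMap d (f p))).int
  refine HasIntegral.of_integrable (h2.mono' ?_ ?_)
  · exact ((Real.continuous_sqrt.measurable.comp measurable_fst).mul
      ((measurable_force d (f p)).inner (measurable_frictionResolvent_comp d measurable_const
        measurable_snd))).aestronglyMeasurable
  · refine Eventually.of_forall fun q => ?_
    rw [norm_mul, Real.norm_of_nonneg (Real.sqrt_nonneg _)]
    have h3 := (norm_inner_le_norm (𝕜 := ℝ) (force d (f p) q.2)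
      (frictionResolvent d (f p) q.2)).trans
      (mul_le_mul_of_nonneg_right (norm_force_le hd (f p) q.2) (norm_nonneg _))
    have h4 := sqrt_mul_le q.1 ‖frictionResolvent d (f p) q.2‖
    calc √q.1 * _ ≤ √q.1 * ((‖f p‖ + d) * ‖frictionResolvent d (f p) q.2‖) :=
          mul_le_mul_of_nonneg_left h3 (Real.sqrt_nonneg _)
      _ = (‖f p‖ + d) * (√q.1 * ‖frictionResolvent d (f p) q.2‖) := by ring
      _ ≤ _ := mul_le_mul_of_nonneg_left h4 (by positivity)

/-- The pointwise inequality is integrated against `μ p` and not against its image, because the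
force depends on `λ'` itself and not only on `R(λ')`. Moments of the image are pulled back along the
pushing map. -/
theorem avg_production_le (hd : 0 < d) (hp : IsProbabilityMeasure (μ p))
    (hM : ∫⁻ q, ENNReal.ofReal (q.1 ^ 2 + ‖q.2‖ ^ 2) ∂pushed d f μ p < ⊤)
    (hpos : ∀ᵐ q ∂μ p, 0 ≤ q.1)
    {a h Ht D₀ : ℝ} {U Ut Hx b' : Vec n} {D : Fin n → Fin n → ℝ} (ha : 0 ≤ a)
    (hmass : Ht + ∑ i, Hx i * U i + h * ∑ i, D i i = 0)
    (hmom : ∀ i, Ut i + ∑ j, D i j * U j + 2 * a * Hx i = -d * b' i + f p i)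
    (hb' : b' ∈ B U) (hD : ∀ i j, |D i j| ≤ D₀) :
    avgPower d (f p) (μ p) - ∑ i, Ut i * avgMomentum (pushed d f μ p) i
      - ∑ i, ∑ j, D i j * avgFlux (pushed d f μ p) i j
      - a * (∑ i, D i i) * avgHeightSq (pushed d f μ p) - ∑ i, U i * avgForce d (f p) (μ p) i
      + (∑ i, U i * Ut i - 2 * a * Ht) * avgHeight (pushed d f μ p)
      + ∑ j, (∑ i, U i * D i j - 2 * a * Hx j) * avgMomentum (pushed d f μ p) j + 2 * a * h * Ht
    ≤ 2 * n ^ 2 * D₀ * relEnergy a h U (pushed d f μ p)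
      - a * (2 * h * ∑ i, Hx i * U i + h ^ 2 * ∑ i, D i i) := by
  have := isProbabilityMeasure_pushed (d := d) (f := f) hp
  have hΦ := measurable_pushMap d (f p)
  have hposν : ∀ᵐ q ∂pushed d f μ p, 0 ≤ q.1 :=
    (ae_map_iff hΦ.aemeasurable (measurableSet_le measurable_const measurable_fst)).mpr hpos
  have hq : ∀ {g : Phase n → ℝ}, QuadGrowth g →
      HasIntegral (μ p) (fun q => g (q.1, frictionResolvent d (f p) q.2))
        (∫ q, g q ∂pushed d f μ p) := fun hg =>
    (HasIntegral.of_integrable (hg.integrable hM)).map hΦ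
  have hL : HasIntegral (μ p) _ (avgPower d (f p) (μ p)
      - ∑ i, Ut i * avgMomentum (pushed d f μ p) i
      - ∑ i, ∑ j, D i j * avgFlux (pushed d f μ p) i j
      - a * (∑ i, D i i) * avgHeightSq (pushed d f μ p) - ∑ i, U i * avgForce d (f p) (μ p) i
      + (∑ i, U i * Ut i - 2 * a * Ht) * avgHeight (pushed d f μ p)
      + ∑ j, (∑ i, U i * D i j - 2 * a * Hx j) * avgMomentum (pushed d f μ p) j
      + 2 * a * h * Ht) :=
    (((((((hasIntegral_avgPower hd hp hM).sub
      (HasIntegral.sum fun i => (hq (quadGrowth_momentum i)).const_mul (Ut i))).sub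
      (HasIntegral.sum fun i => HasIntegral.sum fun j =>
        (hq (quadGrowth_flux i j)).const_mul (D i j))).sub
      ((hq quadGrowth_heightSq).const_mul (a * ∑ i, D i i))).sub
      (HasIntegral.sum fun i => (hasIntegral_avgForce hd hp hM i).const_mul (U i))).add
      ((hq quadGrowth_height).const_mul (∑ i, U i * Ut i - 2 * a * Ht))).add
      (HasIntegral.sum fun j =>
        (hq (quadGrowth_momentum j)).const_mul (∑ i, U i * D i j - 2 * a * Hx j))).add
      (HasIntegral.const (2 * a * h * Ht))
  have hR := (((hasIntegral_relEnergy (a := a) (h := h) (U := U) hM hposν).map hΦ).const_mul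
    (2 * n ^ 2 * D₀)).sub
      (HasIntegral.const (a * (2 * h * ∑ i, Hx i * U i + h ^ 2 * ∑ i, D i i)))
  refine hL.mono hR ?_
  filter_upwards [hpos] with q hq
  obtain ⟨b, hb, hF⟩ := exists_force_eq hd (f p) q.2
  have key := relative_production_le ha hd.le (Real.sqrt_nonneg q.1) hmass hmom hF hb hb' hD
  -- The algebraic lemma has `s²` in place of the height; with `s = √λ₁` and `λ₁ ≥ 0` the two agree.
  rw [Real.sq_sqrt hq] at key
  exact key

theorem avg_concentration_le {a D₀ : ℝ} (ha : 0 ≤ a) {D : Fin n → Fin n → ℝ}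
    (hD : ∀ i j, |D i j| ≤ D₀) {ν : Measure (Phase n)} [IsFiniteMeasure ν]
    (hν : ∫⁻ q, ENNReal.ofReal (q.1 ^ 2 + ‖q.2‖ ^ 2) ∂ν < ⊤) :
    -(∑ i, ∑ j, D i j * avgFlux ν i j + a * (∑ i, D i i) * avgHeightSq ν)
      ≤ 2 * n ^ 2 * D₀ * avgEnergy a ν := by
  have hL : HasIntegral ν _ (-(∑ i, ∑ j, D i j * avgFlux ν i j
      + a * (∑ i, D i i) * avgHeightSq ν)) :=
    ((HasIntegral.sum fun i => HasIntegral.sum fun j => (HasIntegral.of_integrable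
      ((quadGrowth_flux i j).integrable hν)).const_mul (D i j)).add
      ((HasIntegral.of_integrable (quadGrowth_heightSq.integrable hν)).const_mul
        (a * ∑ i, D i i))).neg
  have hR := (HasIntegral.of_integrable ((quadGrowth_energy a).integrable hν)).const_mul
    (2 * n ^ 2 * D₀)
  exact hL.mono hR (Eventually.of_forall fun q => concentration_le ha hD q)

end Pointwise

/-! ### A Grönwall lemma for measures on a time interval -/

/-- A smooth cutoff function for the interval `(0, T)`. -/
def cutoff (T : ℝ) (k : ℕ) (t : ℝ) : ℝ :=
  Real.smoothTransition (((k : ℝ) + 1) * t - 1) * Real.smoothTransition (((k : ℝ) + 1) * (T - t) - 1)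

theorem cutoff_nonneg (T : ℝ) (k : ℕ) (t : ℝ) : 0 ≤ cutoff T k t :=
  mul_nonneg (Real.smoothTransition.nonneg _) (Real.smoothTransition.nonneg _)

theorem cutoff_le_one (T : ℝ) (k : ℕ) (t : ℝ) : cutoff T k t ≤ 1 :=
  mul_le_one₀ (Real.smoothTransition.le_one _) (Real.smoothTransition.nonneg _)
    (Real.smoothTransition.le_one _)

theorem contDiff_cutoff (T : ℝ) (k : ℕ) : ContDiff ℝ (⊤ : ℕ∞) (cutoff T k) :=
  (Real.smoothTransition.contDiff.comp (by fun_prop)).mul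
    (Real.smoothTransition.contDiff.comp (by fun_prop))

theorem tsupport_cutoff_subset (T : ℝ) (k : ℕ) :
    tsupport (cutoff T k) ⊆ Icc (1 / ((k : ℝ) + 1)) (T - 1 / ((k : ℝ) + 1)) := by
  refine closure_minimal (fun t ht => ?_) isClosed_Icc
  have hk : (0 : ℝ) < (k : ℝ) + 1 := by positivity
  have h1 := left_ne_zero_of_mul ht
  have h2 := right_ne_zero_of_mul ht
  have h3 : 0 < ((k : ℝ) + 1) * t - 1 := by
    by_contra h
    exact h1 (Real.smoothTransition.zero_of_nonpos (not_lt.mp h))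
  have h4 : 0 < ((k : ℝ) + 1) * (T - t) - 1 := by
    by_contra h
    exact h2 (Real.smoothTransition.zero_of_nonpos (not_lt.mp h))
  constructor
  · rw [div_le_iff₀ hk]; linarith
  · rw [le_sub_comm, div_le_iff₀ hk]; linarith

theorem tendsto_cutoff {T t : ℝ} (ht : t ∈ Ioo 0 T) :
    Tendsto (fun k => cutoff T k t) atTop (𝓝 1) := by
  have h : ∀ r : ℝ, 0 < r → ∀ᶠ k : ℕ in atTop, 1 ≤ ((k : ℝ) + 1) * r - 1 := fun r hr => by
    filter_upwards [eventually_ge_atTop ⌈2 / r⌉₊] with k hk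
    have h1 : 2 / r ≤ k := (Nat.le_ceil _).trans (by exact_mod_cast hk)
    rw [div_le_iff₀ hr] at h1
    nlinarith
  refine tendsto_const_nhds.congr' ?_
  filter_upwards [h t ht.1, h (T - t) (sub_pos.mpr ht.2)] with k h1 h2
  rw [cutoff, Real.smoothTransition.one_of_one_le h1, Real.smoothTransition.one_of_one_le h2,
    one_mul]

theorem setIntegral_exp_neg_le {s T r : ℝ} (hr : 0 < r) (hs : s ≤ T) :
    ∫ t in Icc s T, Real.exp (-r * t) ≤ r⁻¹ * Real.exp (-r * s) := by
  rw [integral_Icc_eq_integral_Ioc, ← intervalIntegral.integral_of_le hs]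
  have h := intervalIntegral.integral_eq_sub_of_hasDerivAt (a := s) (b := T)
    (f := fun t => -r⁻¹ * Real.exp (-r * t)) (f' := fun t => Real.exp (-r * t))
    (fun t _ => by
      have h1 : HasDerivAt (fun t => Real.exp (-r * t)) (Real.exp (-r * t) * (-r * 1)) t :=
        ((hasDerivAt_id t).const_mul (-r)).exp
      refine (h1.const_mul (-r⁻¹)).congr_deriv ?_
      field_simp)
    (Continuous.intervalIntegrable (by fun_prop) _ _)
  rw [h]
  have : 0 ≤ r⁻¹ * Real.exp (-r * T) := by positivity
  linarith

theorem measurable_measureReal_Icc (θ : Measure ℝ) [IsFiniteMeasure θ] :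
    Measurable fun t => θ.real (Icc 0 t) := by
  have : Monotone fun t => θ.real (Icc 0 t) := fun s t hst =>
    measureReal_mono (Icc_subset_Icc_right hst)
  exact this.measurable

/-- A finite measure `θ` on `(0, T)` with `θ ≤ C θ([0, t]) dt` vanishes. -/
theorem measure_eq_zero_of_gronwall {θ : Measure ℝ} [IsFiniteMeasure θ] {T C : ℝ} (hC : 0 < C)
    (hθ : θ (Ioo 0 T)ᶜ = 0)
    (h : ∀ χ : ℝ → ℝ, ContDiff ℝ (⊤ : ℕ∞) χ → HasCompactSupport χ → tsupport χ ⊆ Ioo 0 T →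
      (∀ t, 0 ≤ χ t) → ∫ t, χ t ∂θ ≤ C * ∫ t in Icc 0 T, χ t * θ.real (Icc 0 t)) :
    θ = 0 := by
  have hmem : ∀ᵐ t ∂θ, t ∈ Ioo 0 T := hθ
  have hmem' : ∀ᵐ t ∂(volume : Measure ℝ).restrict (Icc 0 T), t ∈ Ioo 0 T := by
    rw [← Measure.restrict_congr_set (Ioo_ae_eq_Icc (μ := (volume : Measure ℝ)))]
    exact ae_restrict_mem measurableSet_Ioo
  -- The weight `exp (-r t)` gains a factor `C / r = 1/2`, so the weighted mass of `θ` is at most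
  -- half of itself.
  let r : ℝ := 2 * C
  have hr : 0 < r := by positivity
  have hexp1 : ∀ t ∈ Ioo 0 T, Real.exp (-r * t) ≤ 1 := fun t ht => by
    rw [Real.exp_le_one_iff]; nlinarith [ht.1]
  have hexpi : Integrable (fun t => Real.exp (-r * t)) θ := by
    refine Integrable.of_bound (by fun_prop) 1 ?_
    filter_upwards [hmem] with t ht
    rw [Real.norm_of_nonneg (Real.exp_nonneg _)]
    exact hexp1 t ht
  have hcut : ∀ k t, |cutoff T k t * Real.exp (-r * t)| ≤ Real.exp (-r * t) := fun k t => by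
    rw [abs_of_nonneg (mul_nonneg (cutoff_nonneg _ _ _) (Real.exp_nonneg _))]
    exact mul_le_of_le_one_left (Real.exp_nonneg _) (cutoff_le_one _ _ _)
  have hcutc : ∀ k, Continuous (cutoff T k) := fun k => (contDiff_cutoff T k).continuous
  -- The exponential weight is not compactly supported in `(0, T)`; the cutoff makes it admissible
  -- and is removed by dominated convergence. No mass is lost, since `θ` does not charge the end
  -- points.
  have hineq : ∀ k, ∫ t, cutoff T k t * Real.exp (-r * t) ∂θ ≤
      C * ∫ t in Icc 0 T, cutoff T k t * Real.exp (-r * t) * θ.real (Icc 0 t) := fun k => by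
    have hsub : tsupport (fun t => cutoff T k t * Real.exp (-r * t)) ⊆ tsupport (cutoff T k) :=
      closure_mono (Function.support_mul_subset_left _ _)
    have hk : (0 : ℝ) < 1 / ((k : ℝ) + 1) := by positivity
    refine h _ ((contDiff_cutoff T k).mul (by fun_prop)) ?_ ?_
      (fun t => mul_nonneg (cutoff_nonneg _ _ _) (Real.exp_nonneg _))
    · exact isCompact_Icc.of_isClosed_subset (isClosed_tsupport _)
        (hsub.trans (tsupport_cutoff_subset T k))
    · exact (hsub.trans (tsupport_cutoff_subset T k)).trans
        (Icc_subset_Ioo hk (by linarith))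
  have hlim1 : Tendsto (fun k => ∫ t, cutoff T k t * Real.exp (-r * t) ∂θ) atTop
      (𝓝 (∫ t, Real.exp (-r * t) ∂θ)) := by
    refine tendsto_integral_of_dominated_convergence _
      (fun k => ((hcutc k).mul (by fun_prop)).aestronglyMeasurable) hexpi
      (fun k => Eventually.of_forall (hcut k)) ?_
    filter_upwards [hmem] with t ht
    simpa using (tendsto_cutoff ht).mul_const (Real.exp (-r * t))
  have hlim2 : Tendsto
      (fun k => ∫ t in Icc 0 T, cutoff T k t * Real.exp (-r * t) * θ.real (Icc 0 t)) atTop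
      (𝓝 (∫ t in Icc 0 T, Real.exp (-r * t) * θ.real (Icc 0 t))) := by
    refine tendsto_integral_of_dominated_convergence (fun _ => θ.real univ)
      (fun k => ((((hcutc k).mul (by fun_prop)).measurable).mul
        (measurable_measureReal_Icc θ)).aestronglyMeasurable) (integrable_const _)
      (fun k => ?_) ?_
    · filter_upwards [hmem'] with t ht
      rw [norm_mul, Real.norm_of_nonneg (measureReal_nonneg)]
      calc _ ≤ 1 * θ.real univ := mul_le_mul ((hcut k t).trans (hexp1 t ht))
            (measureReal_mono (subset_univ _)) measureReal_nonneg zero_le_one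
        _ = _ := one_mul _
    · filter_upwards [hmem'] with t ht
      simpa using ((tendsto_cutoff ht).mul_const (Real.exp (-r * t))).mul_const (θ.real (Icc 0 t))
  have hmain := le_of_tendsto_of_tendsto' hlim1 (hlim2.const_mul C) hineq
  have hset : MeasurableSet {x : ℝ × ℝ | x.2 ∈ Icc 0 x.1} :=
    (measurableSet_le measurable_const measurable_snd).inter
      (measurableSet_le measurable_snd measurable_fst)
  have hF : Integrable (fun x : ℝ × ℝ => {x : ℝ × ℝ | x.2 ∈ Icc 0 x.1}.indicator
      (fun x => Real.exp (-r * x.1)) x) (((volume : Measure ℝ).restrict (Icc 0 T)).prod θ) := by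
    refine Integrable.of_bound
      ((Measurable.indicator (by fun_prop) hset).aestronglyMeasurable) 1 ?_
    filter_upwards [Measure.quasiMeasurePreserving_fst.ae hmem'] with x hx
    refine (norm_indicator_le_norm_self _ _).trans ?_
    rw [Real.norm_of_nonneg (Real.exp_nonneg _)]
    exact hexp1 _ hx
  -- Fubini on the triangle `0 ≤ s ≤ t ≤ T` turns the right-hand side into an integral against `θ`
  -- of `∫ₛᵀ exp (-r t) dt`, which is at most `exp (-r s) / r`.
  have hswap := integral_integral_swap (f := fun t s => {x : ℝ × ℝ | x.2 ∈ Icc 0 x.1}.indicator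
      (fun x => Real.exp (-r * x.1)) (t, s)) hF
  have hl : ∀ t, ∫ s, {x : ℝ × ℝ | x.2 ∈ Icc 0 x.1}.indicator
      (fun x => Real.exp (-r * x.1)) (t, s) ∂θ = Real.exp (-r * t) * θ.real (Icc 0 t) := fun t => by
    have : (fun s => {x : ℝ × ℝ | x.2 ∈ Icc 0 x.1}.indicator
        (fun x => Real.exp (-r * x.1)) (t, s)) = (Icc 0 t).indicator fun _ => Real.exp (-r * t) := by
      funext s
      simp only [indicator, mem_ofPred_eq]
    rw [this, integral_indicator measurableSet_Icc, setIntegral_const, smul_eq_mul, mul_comm]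
  have hrr : ∀ s ∈ Ioo 0 T, ∫ t in Icc 0 T, {x : ℝ × ℝ | x.2 ∈ Icc 0 x.1}.indicator
      (fun x => Real.exp (-r * x.1)) (t, s) ≤ r⁻¹ * Real.exp (-r * s) := fun s hs => by
    have h1 : (fun t => {x : ℝ × ℝ | x.2 ∈ Icc 0 x.1}.indicator
        (fun x => Real.exp (-r * x.1)) (t, s)) = (Ici s).indicator fun t => Real.exp (-r * t) := by
      funext t
      have : (s ∈ Icc 0 t) ↔ t ∈ Ici s := ⟨fun h => h.2, fun h => ⟨hs.1.le, h⟩⟩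
      simp only [indicator, mem_ofPred_eq, this]
    have h2 : Icc 0 T ∩ Ici s = Icc s T := by
      ext t
      simp only [mem_inter_iff, mem_Icc, mem_Ici]
      have := hs.1
      grind
    rw [h1, setIntegral_indicator measurableSet_Ici, h2]
    exact setIntegral_exp_neg_le hr hs.2.le
  have hfin : ∫ t, Real.exp (-r * t) ∂θ ≤ C * (r⁻¹ * ∫ t, Real.exp (-r * t) ∂θ) := by
    refine hmain.trans (mul_le_mul_of_nonneg_left ?_ hC.le)
    simp only [hl] at hswap
    rw [hswap, ← integral_const_mul]
    refine integral_mono_ae hF.integral_prod_right (hexpi.const_mul _) ?_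
    filter_upwards [hmem] with s hs using hrr s hs
  have hzero : ∫ t, Real.exp (-r * t) ∂θ = 0 := by
    refine le_antisymm ?_ (integral_nonneg fun t => Real.exp_nonneg _)
    have : C * (r⁻¹ * ∫ t, Real.exp (-r * t) ∂θ) = (∫ t, Real.exp (-r * t) ∂θ) / 2 := by
      simp only [r]; field_simp
    linarith
  rw [integral_eq_zero_iff_of_nonneg (fun t => Real.exp_nonneg _) hexpi] at hzero
  have : ∀ᵐ _ ∂θ, False := by
    filter_upwards [hzero] with t ht using (Real.exp_pos _).ne' ht
  rwa [eventually_false_iff_eq_bot, ae_eq_bot] at this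

/-! ### A strong solution and an admissible measure-valued solution -/

/-- A strong solution `(H, U)` and an admissible measure-valued solution `(μ, m, μ^∞)` with the
same data. -/
structure WeakStrongPair (a d T c : ℝ) (f : SpaceTime n → Vec n)
    (h₀ : Torus n → ℝ) (u₀ : Torus n → Vec n) (H : SpaceTime n → ℝ) (U : SpaceTime n → Vec n)
    (μ : Kernel (SpaceTime n) (Phase n)) (m : Measure (SpaceTime n))
    (μinf : Kernel (SpaceTime n) (Phase n)) : Prop where
  ha : 0 < a
  hd : 0 < d
  hT : 0 < T
  hc : 0 < c
  hf : AEStronglyMeasurable f (slab n T)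
  hh₀ : MemLp h₀ 2
  hu₀ : Integrable (fun x => h₀ x * ‖u₀ x‖ ^ 2)
  hH : ∃ K : ℝ≥0, LipschitzOnWith K H (slabSet n T)
  hU : IsC1 T U
  hHc : ∀ t ∈ Icc 0 T, ∀ x, c ≤ H (t, x)
  hsol : IsStrongSolution a d T f h₀ u₀ H U
  hmv : IsMeasureValuedSolution a d T f h₀ u₀ μ m μinf
  hadm : IsAdmissible a d T f h₀ u₀ μ m μinf

theorem integrable_bdd_mul {α : Type*} [MeasurableSpace α] {ρ : Measure α} {g k : α → ℝ} {K : ℝ}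
    (hg : AEStronglyMeasurable g ρ) (hb : ∀ᵐ p ∂ρ, |g p| ≤ K) (hk : Integrable k ρ) :
    Integrable (fun p => g p * k p) ρ := by
  refine (hk.norm.const_mul K).mono' (hg.mul hk.aestronglyMeasurable) ?_
  filter_upwards [hb] with p hp
  rw [norm_mul]
  exact mul_le_mul_of_nonneg_right hp (norm_nonneg _)

theorem SlabLipschitz.mono {T K L : ℝ} {g : SpaceTime n → ℝ} (hg : SlabLipschitz T g K)
    (h : K ≤ L) : SlabLipschitz T g L :=
  { hg with
    bound := fun p hp => (hg.bound p hp).trans h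
    lip_time := fun x s hs t ht => (hg.lip_time x s hs t ht).trans
      (mul_le_mul_of_nonneg_right h (abs_nonneg _))
    lip_space := fun t ht x i s => (hg.lip_space t ht x i s).trans
      (mul_le_mul_of_nonneg_right h (abs_nonneg _)) }

theorem IsC1.coord {T : ℝ} {U : SpaceTime n → Vec n} (hU : IsC1 T U) (i : Fin n) :
    IsC1 T (fun p => U p i) :=
  (EuclideanSpace.proj (𝕜 := ℝ) i).contDiff.comp_contDiffOn hU

namespace WeakStrongPair

variable {a d T c : ℝ} {f : SpaceTime n → Vec n}
  {h₀ : Torus n → ℝ} {u₀ : Torus n → Vec n} {H : SpaceTime n → ℝ} {U : SpaceTime n → Vec n}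
  {μ : Kernel (SpaceTime n) (Phase n)} {m : Measure (SpaceTime n)}
  {μinf : Kernel (SpaceTime n) (Phase n)}
  (W : WeakStrongPair a d T c f h₀ u₀ H U μ m μinf)

include W

theorem ae_prob : ∀ᵐ p ∂slab n T, IsProbabilityMeasure (μ p) := W.hmv.young.prob

theorem ae_moment :
    ∀ᵐ p ∂slab n T, ∫⁻ q, ENNReal.ofReal (q.1 ^ 2 + ‖q.2‖ ^ 2) ∂pushed d f μ p < ⊤ :=
  ae_moment_lt_top W.hf W.ae_prob W.hmv.moments

theorem integrable_avg {g : Phase n → ℝ} (hg : QuadGrowth g) :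
    Integrable (fun p => ∫ q, g q ∂pushed d f μ p) (slab n T) :=
  hg.integrable_pushed W.hf W.ae_prob W.hmv.moments

theorem integrable_avgHeight : Integrable (fun p => avgHeight (pushed d f μ p)) (slab n T) :=
  W.integrable_avg quadGrowth_height

theorem integrable_avgHeightSq : Integrable (fun p => avgHeightSq (pushed d f μ p)) (slab n T) :=
  W.integrable_avg quadGrowth_heightSq

theorem integrable_avgMomentum (i : Fin n) :
    Integrable (fun p => avgMomentum (pushed d f μ p) i) (slab n T) :=
  W.integrable_avg (quadGrowth_momentum i)

theorem integrable_avgFlux (i j : Fin n) :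
    Integrable (fun p => avgFlux (pushed d f μ p) i j) (slab n T) :=
  W.integrable_avg (quadGrowth_flux i j)

theorem integrable_avgEnergy : Integrable (fun p => avgEnergy a (pushed d f μ p)) (slab n T) :=
  W.integrable_avg (quadGrowth_energy a)

theorem exists_lip_height : ∃ L, 0 ≤ L ∧ SlabLipschitz T H L := by
  obtain ⟨K, hK⟩ := W.hH
  exact exists_slabLipschitz_of_lipschitz W.hT.le hK

theorem exists_lip_velocity : ∃ L, 0 ≤ L ∧ ∀ i, SlabLipschitz T (fun p => U p i) L := by
  choose K hK0 hK using fun i => (W.hU.coord i).exists_slabLipschitz W.hT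
  exact ⟨∑ i, K i, Finset.sum_nonneg fun i _ => hK0 i, fun i =>
    (hK i).mono (Finset.single_le_sum (fun j _ => hK0 j) (Finset.mem_univ i))⟩

/-- The mass equation may be tested with the Lipschitz function `H`. -/
theorem mass_height : ∀ᵐ τ ∂(volume : Measure ℝ).restrict (Icc 0 T),
    (∫ p, (dt H p * avgHeight (pushed d f μ p)
        + ∑ i, dx i H p * avgMomentum (pushed d f μ p) i) ∂slab n τ)
      + (∫ x, (H (0, x) * h₀ x - H (τ, x) * avgHeight (pushed d f μ (τ, x)))) = 0 := by
  obtain ⟨K, hK⟩ := W.hH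
  obtain ⟨S, C, hS1, hSb, hSdt, hSdx, hSlim, hSdtlim, hSdxlim⟩ := exists_C1_approx W.hT.le hK
  -- The exceptional set of times depends on the test function; countably many approximations share
  -- one null set.
  have hall : ∀ᵐ τ ∂(volume : Measure ℝ).restrict (Icc 0 T), ∀ k,
      (∫ p, (dt (S k) p * avgHeight (pushed d f μ p)
          + ∑ i, dx i (S k) p * avgMomentum (pushed d f μ p) i) ∂slab n τ)
        + (∫ x, (S k (0, x) * h₀ x - S k (τ, x) * avgHeight (pushed d f μ (τ, x)))) = 0 :=
    ae_all_iff.mpr fun k => W.hmv.mass (S k) (hS1 k)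
  have hSm : ∀ k, AEStronglyMeasurable (S k) (slab n T) := fun k => by
    have := (hS1 k).aestronglyMeasurable (slab n T)
    rwa [slab_restrict_self] at this
  have hSi : ∀ k, Integrable (fun p => S k p * avgHeight (pushed d f μ p)) (slab n T) := fun k =>
    integrable_bdd_mul (hSm k) (Eventually.of_forall (hSb k)) W.integrable_avgHeight
  -- The slice `t = 0` is null in the slab, so measurability there comes from continuity of the
  -- lift.
  have hS0m : ∀ k, AEStronglyMeasurable (fun x => S k (0, x)) volume := fun k => by
    have h1 : ContinuousOn (S k ∘ cover) (Icc 0 T ×ˢ univ) := ContDiffOn.continuousOn (hS1 k)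
    have h2 : Continuous fun y : Vec n => (S k ∘ cover) (0, y) :=
      h1.comp_continuous (by fun_prop) fun y => ⟨⟨le_rfl, W.hT.le⟩, mem_univ _⟩
    refine (h2.measurable.comp measurable_cubeRep).aestronglyMeasurable.congr
      (Eventually.of_forall fun x => ?_)
    exact congrArg (S k) (cover_stripRep (0, x))
  have hslice : ∀ᵐ τ ∂(volume : Measure ℝ).restrict (Icc 0 T), ∀ k,
      Integrable fun x => S k (τ, x) * avgHeight (pushed d f μ (τ, x)) :=
    ae_all_iff.mpr fun k => (hSi k).prod_right_ae
  filter_upwards [hall, hslice, W.integrable_avgHeight.prod_right_ae,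
    ae_restrict_mem measurableSet_Icc] with τ hτ hτi hτh hτm
  have hle := slab_le (n := n) hτm.2
  have hae : ∀ {P : SpaceTime n → Prop}, (∀ᵐ p ∂slab n T, P p) → ∀ᵐ p ∂slab n τ, P p :=
    fun h => ae_mono hle h
  have l1 : Tendsto (fun k => ∫ p, (dt (S k) p * avgHeight (pushed d f μ p)
      + ∑ i, dx i (S k) p * avgMomentum (pushed d f μ p) i) ∂slab n τ) atTop
      (𝓝 (∫ p, (dt H p * avgHeight (pushed d f μ p)
        + ∑ i, dx i H p * avgMomentum (pushed d f μ p) i) ∂slab n τ)) := by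
    refine tendsto_integral_of_dominated_convergence
      (fun p => C * |avgHeight (pushed d f μ p)|
        + ∑ i, C * |avgMomentum (pushed d f μ p) i|) (fun k => ?_) ?_ (fun k => ?_) ?_
    · refine AEStronglyMeasurable.add ?_ ?_
      · exact (((hS1 k).aestronglyMeasurable_dt W.hT).mul
          W.integrable_avgHeight.aestronglyMeasurable).mono_measure hle
      · refine Finset.aestronglyMeasurable_fun_sum _ fun i _ => ?_
        have := (hS1 k).aestronglyMeasurable_dx W.hT i (slab n T)
        rw [slab_restrict_self] at this
        exact (this.mul (W.integrable_avgMomentum i).aestronglyMeasurable).mono_measure hle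
    · exact ((W.integrable_avgHeight.abs.const_mul C).add (integrable_finsetSum _ fun i _ =>
        (W.integrable_avgMomentum i).abs.const_mul C)).mono_measure hle
    · filter_upwards [hae (ae_slab_mem_Ioo T), hae (ae_slab_mem T)] with p hp hp'
      refine (norm_add_le _ _).trans (add_le_add ?_ ((norm_sum_le _ _).trans
        (Finset.sum_le_sum fun i _ => ?_)))
      · rw [norm_mul]
        exact mul_le_mul_of_nonneg_right (hSdt k p hp) (norm_nonneg _)
      · rw [norm_mul]
        exact mul_le_mul_of_nonneg_right (hSdx k p hp' i) (norm_nonneg _)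
    · filter_upwards [hae hSdtlim, hae hSdxlim] with p h1 h2
      exact (h1.mul_const _).add (tendsto_finsetSum _ fun i _ => (h2 i).mul_const _)
  have l2 : Tendsto
      (fun k => ∫ x, (S k (0, x) * h₀ x - S k (τ, x) * avgHeight (pushed d f μ (τ, x)))) atTop
      (𝓝 (∫ x, (H (0, x) * h₀ x - H (τ, x) * avgHeight (pushed d f μ (τ, x))))) := by
    refine tendsto_integral_of_dominated_convergence
      (fun x => C * |h₀ x| + C * |avgHeight (pushed d f μ (τ, x))|) (fun k => ?_) ?_ (fun k => ?_) ?_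
    · exact ((hS0m k).mul W.hmv.initial_height.aestronglyMeasurable).sub
        (hτi k).aestronglyMeasurable
    · exact (W.hmv.initial_height.abs.const_mul C).add (hτh.abs.const_mul C)
    · refine Eventually.of_forall fun x => (norm_sub_le _ _).trans (add_le_add ?_ ?_)
      · rw [norm_mul]
        exact mul_le_mul_of_nonneg_right (hSb k _) (norm_nonneg _)
      · rw [norm_mul]
        exact mul_le_mul_of_nonneg_right (hSb k _) (norm_nonneg _)
    · refine Eventually.of_forall fun x => Tendsto.sub ?_ ?_
      · exact (hSlim (0, x) ⟨⟨le_rfl, W.hT.le⟩, mem_univ _⟩).mul_const _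
      · exact (hSlim (τ, x) ⟨hτm, mem_univ _⟩).mul_const _
  have := l1.add l2
  simp only [hτ] at this
  exact tendsto_nhds_unique this tendsto_const_nhds

/-- The strong equations in non-conservative form. -/
theorem ae_strong : ∀ᵐ p ∂slab n T, ∃ b ∈ B (U p),
    dt H p + ∑ i, dx i H p * U p i + H p * ∑ i, dx i (fun q => U q i) p = 0 ∧
    ∀ i, dt (fun q => U q i) p + ∑ j, dx j (fun q => U q i) p * U p j + 2 * a * dx i H p
      = -d * b i + f p i := by
  obtain ⟨L, -, hL⟩ := W.exists_lip_height
  obtain ⟨M, -, hM⟩ := W.exists_lip_velocity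
  filter_upwards [W.hsol.mass, W.hsol.momentum, hL.diff_time, hL.diff_space,
    ae_all_iff.mpr fun i => (hM i).diff_time, ae_all_iff.mpr fun i => (hM i).diff_space,
    ae_slab_mem T] with p h1 h2 ht hx ut ux hp
  obtain ⟨b, hb, h2⟩ := h2
  have hpos : 0 < H p := W.hc.trans_le (W.hHc p.1 hp.1 p.2)
  have hmass : dt H p + ∑ i, dx i H p * U p i + H p * ∑ i, dx i (fun q => U q i) p = 0 := by
    rw [← h1, Finset.mul_sum, add_assoc, ← Finset.sum_add_distrib]
    congr 1
    exact Finset.sum_congr rfl fun i _ =>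
      (dx_mul (k := fun q => U q i) (hx i) (ux i i)).symm
  refine ⟨b, hb, hmass, fun i => ?_⟩
  have h3 := h2 i
  have e1 : dt (fun q => H q * U q i) p = dt H p * U p i + H p * dt (fun q => U q i) p :=
    dt_mul ht (ut i)
  have e2 : ∀ j, dx j (fun q => H q * U q i * U q j) p
      = U p i * (dx j H p * U p j) + H p * (dx j (fun q => U q i) p * U p j)
        + H p * U p i * dx j (fun q => U q j) p := fun j => by
    have h4 := dx_mul (g := fun q => H q * U q i) (k := fun q => U q j) (p := p) (i := j)
      ((hx j).mul (ux i j)) (ux j j)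
    rw [h4, dx_mul (g := H) (k := fun q => U q i) (hx j) (ux i j)]
    ring
  have e3 : dx i (fun q => a * H q ^ 2) p = 2 * a * H p * dx i H p := by
    have h5 := ((hx i).hasDerivAt.fun_pow 2).const_mul a
    have h6 := h5.deriv
    simp only [AddCircle.coe_zero, Pi.single_zero, add_zero] at h6
    unfold dx
    rw [h6]
    norm_num
    ring
  rw [e1, e3, Finset.sum_congr rfl fun j _ => e2 j, Finset.sum_add_distrib, Finset.sum_add_distrib,
    ← Finset.mul_sum, ← Finset.mul_sum, ← Finset.mul_sum] at h3
  -- The momentum equation minus `Uᵢ` times the mass equation is `H` times the velocity equation;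
  -- positivity of `H` allows the division.
  refine mul_left_cancel₀ hpos.ne' ?_
  linear_combination h3 - U p i * hmass

end WeakStrongPair

/-- The density of `⟨relative energy - energy, ν⟩`. -/
def crossEnergy (a : ℝ) (H : SpaceTime n → ℝ) (U : SpaceTime n → Vec n)
    (ν : SpaceTime n → Measure (Phase n)) (p : SpaceTime n) : ℝ :=
  -∑ i, U p i * avgMomentum (ν p) i + (‖U p‖ ^ 2 / 2) * avgHeight (ν p)
    - 2 * a * (H p * avgHeight (ν p)) + a * (H p * H p)

/-- The production term of `crossEnergy` without its concentration part. -/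
def crossProduction (a d : ℝ) (f : SpaceTime n → Vec n) (H : SpaceTime n → ℝ)
    (U : SpaceTime n → Vec n) (μ : Kernel (SpaceTime n) (Phase n)) (p : SpaceTime n) : ℝ :=
  -((∑ i, dt (fun q => U q i) p * avgMomentum (pushed d f μ p) i)
      + (∑ i, ∑ j, dx j (fun q => U q i) p * avgFlux (pushed d f μ p) i j)
      + a * (∑ i, dx i (fun q => U q i) p) * avgHeightSq (pushed d f μ p)
      + ∑ i, U p i * avgForce d (f p) (μ p) i)
    + ((∑ i, U p i * dt (fun q => U q i) p) * avgHeight (pushed d f μ p)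
      + ∑ j, (∑ i, U p i * dx j (fun q => U q i) p) * avgMomentum (pushed d f μ p) j)
    - 2 * a * (dt H p * avgHeight (pushed d f μ p)
      + ∑ i, dx i H p * avgMomentum (pushed d f μ p) i)
    + a * (2 * H p * dt H p)

/-- The density of the concentration part of the production of `crossEnergy`. -/
def crossConcentration (a : ℝ) (U : SpaceTime n → Vec n)
    (μinf : Kernel (SpaceTime n) (Phase n)) (p : SpaceTime n) : ℝ :=
  (∑ i, ∑ j, dx j (fun q => U q i) p * avgFlux (μinf p) i j)
    + a * (∑ i, dx i (fun q => U q i) p) * avgHeightSq (μinf p)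

/-- Half of the squared length of a vector field. -/
def halfSq (U : SpaceTime n → Vec n) (p : SpaceTime n) : ℝ := 1 / 2 * ∑ i, U p i * U p i

theorem halfSq_eq (U : SpaceTime n → Vec n) (p : SpaceTime n) : halfSq U p = ‖U p‖ ^ 2 / 2 := by
  rw [halfSq, norm_sq_eq_sum]; ring

theorem IsC1.halfSq {T : ℝ} {U : SpaceTime n → Vec n} (hU : IsC1 T U) : IsC1 T (halfSq U) :=
  ContDiffOn.mul contDiffOn_const
    (ContDiffOn.sum fun i _ => ContDiffOn.mul (hU.coord i) (hU.coord i))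

theorem dt_halfSq {T : ℝ} {U : SpaceTime n → Vec n} (hU : IsC1 T U) {p : SpaceTime n}
    (hp : p.1 ∈ Ioo 0 T) : dt (halfSq U) p = ∑ i, U p i * dt (fun q => U q i) p := by
  have h : HasDerivAt (fun s : ℝ => halfSq U (s, p.2)) _ p.1 :=
    (HasDerivAt.fun_sum (u := Finset.univ) fun i _ => ((hU.coord i).hasDerivAt_time hp).fun_mul
      ((hU.coord i).hasDerivAt_time hp)).const_mul (1 / 2)
  rw [dt, h.deriv, Finset.mul_sum]
  refine Finset.sum_congr rfl fun i _ => ?_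
  rw [(hU.coord i).dt_eq hp]
  ring

theorem dx_halfSq {T : ℝ} {U : SpaceTime n → Vec n} (hU : IsC1 T U) {p : SpaceTime n}
    (hp : p ∈ slabSet n T) (j : Fin n) :
    dx j (halfSq U) p = ∑ i, U p i * dx j (fun q => U q i) p := by
  have h : HasDerivAt
      (fun s : ℝ => halfSq U (p.1, p.2 + Pi.single j (s : UnitAddCircle))) _ 0 :=
    (HasDerivAt.fun_sum (u := Finset.univ) fun i _ => ((hU.coord i).hasDerivAt_space hp j).fun_mul
      ((hU.coord i).hasDerivAt_space hp j)).const_mul (1 / 2)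
  rw [dx, h.deriv, Finset.mul_sum]
  refine Finset.sum_congr rfl fun i _ => ?_
  rw [(hU.coord i).dx_eq hp]
  simp only [AddCircle.coe_zero, Pi.single_zero, add_zero]
  ring

theorem relEnergy_eq (a : ℝ) (H : SpaceTime n → ℝ) (U : SpaceTime n → Vec n)
    (ν : SpaceTime n → Measure (Phase n)) (p : SpaceTime n) :
    relEnergy a (H p) (U p) (ν p) = avgEnergy a (ν p) + crossEnergy a H U ν p := by
  unfold relEnergy crossEnergy
  ring

/-! ### Balance law for the cross terms of the relative energy -/

namespace WeakStrongPair

variable {a d T c : ℝ} {f : SpaceTime n → Vec n}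
  {h₀ : Torus n → ℝ} {u₀ : Torus n → Vec n} {H : SpaceTime n → ℝ} {U : SpaceTime n → Vec n}
  {μ : Kernel (SpaceTime n) (Phase n)} {m : Measure (SpaceTime n)}
  {μinf : Kernel (SpaceTime n) (Phase n)}
  (W : WeakStrongPair a d T c f h₀ u₀ H U μ m μinf)

include W

theorem integrable_momentum_term :
    Integrable (fun p => ∑ i, U p i * avgMomentum (pushed d f μ p) i) (slab n T) := by
  obtain ⟨M, -, hM⟩ := W.exists_lip_velocity
  refine integrable_finsetSum _ fun i _ => integrable_bdd_mul (hM i).meas (K := M) ?_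
    (W.integrable_avgMomentum i)
  filter_upwards [ae_slab_mem T] with p hp using (hM i).bound p hp

theorem integrable_kinetic_term :
    Integrable (fun p => (‖U p‖ ^ 2 / 2) * avgHeight (pushed d f μ p)) (slab n T) := by
  obtain ⟨K, -, hK⟩ := W.hU.halfSq.exists_slabLipschitz W.hT
  have : Integrable (fun p => halfSq U p * avgHeight (pushed d f μ p)) (slab n T) := by
    refine integrable_bdd_mul hK.meas (K := K) ?_ W.integrable_avgHeight
    filter_upwards [ae_slab_mem T] with p hp using hK.bound p hp
  simpa only [halfSq_eq] using this

theorem integrable_height_term :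
    Integrable (fun p => H p * avgHeight (pushed d f μ p)) (slab n T) := by
  obtain ⟨L, -, hL⟩ := W.exists_lip_height
  refine integrable_bdd_mul hL.meas (K := L) ?_ W.integrable_avgHeight
  filter_upwards [ae_slab_mem T] with p hp using hL.bound p hp

theorem integrable_heightSq_term : Integrable (fun p => H p * H p) (slab n T) := by
  obtain ⟨L, -, hL⟩ := W.exists_lip_height
  refine integrable_bdd_mul hL.meas (K := L) ?_ (Integrable.of_bound hL.meas L ?_)
  · filter_upwards [ae_slab_mem T] with p hp using hL.bound p hp
  · filter_upwards [ae_slab_mem T] with p hp using hL.bound p hp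

theorem integrable_crossEnergy :
    Integrable (crossEnergy a H U (pushed d f μ)) (slab n T) :=
  ((W.integrable_momentum_term.neg.add W.integrable_kinetic_term).sub
    (W.integrable_height_term.const_mul _)).add (W.integrable_heightSq_term.const_mul _)

theorem integrable_momentum_production : Integrable (fun p =>
    (∑ i, dt (fun q => U q i) p * avgMomentum (pushed d f μ p) i)
      + (∑ i, ∑ j, dx j (fun q => U q i) p * avgFlux (pushed d f μ p) i j)
      + a * (∑ i, dx i (fun q => U q i) p) * avgHeightSq (pushed d f μ p)
      + ∑ i, U p i * avgForce d (f p) (μ p) i) (slab n T) := by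
  obtain ⟨M, hM0, hM⟩ := W.exists_lip_velocity
  refine ((Integrable.add ?_ ?_).add ?_).add ?_
  · refine integrable_finsetSum _ fun i _ => integrable_bdd_mul (hM i).meas_dt (K := M) ?_
      (W.integrable_avgMomentum i)
    filter_upwards [ae_slab_mem_Ioo T] with p hp using (hM i).abs_dt_le hM0 hp
  · refine integrable_finsetSum _ fun i _ => integrable_finsetSum _ fun j _ =>
      integrable_bdd_mul ((hM i).meas_dx j) (K := M) ?_ (W.integrable_avgFlux i j)
    filter_upwards [ae_slab_mem T] with p hp using (hM i).abs_dx_le hM0 hp j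
  · have h1 : Integrable (fun p => ∑ i, dx i (fun q => U q i) p * avgHeightSq (pushed d f μ p))
        (slab n T) := by
      refine integrable_finsetSum _ fun i _ =>
        integrable_bdd_mul ((hM i).meas_dx i) (K := M) ?_ W.integrable_avgHeightSq
      filter_upwards [ae_slab_mem T] with p hp using (hM i).abs_dx_le hM0 hp i
    refine (h1.const_mul a).congr (Eventually.of_forall fun p => ?_)
    simp only [← Finset.sum_mul, mul_assoc]
  · refine integrable_finsetSum _ fun i _ => integrable_bdd_mul (hM i).meas (K := M) ?_
      (W.hmv.force_integrable i)
    filter_upwards [ae_slab_mem T] with p hp using (hM i).bound p hp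

theorem integrable_mass_production {g : SpaceTime n → ℝ} {K : ℝ} (hK : 0 ≤ K)
    (hg : SlabLipschitz T g K) : Integrable (fun p => dt g p * avgHeight (pushed d f μ p)
      + ∑ i, dx i g p * avgMomentum (pushed d f μ p) i) (slab n T) := by
  refine Integrable.add ?_ ?_
  · refine integrable_bdd_mul hg.meas_dt (K := K) ?_ W.integrable_avgHeight
    filter_upwards [ae_slab_mem_Ioo T] with p hp using hg.abs_dt_le hK hp
  · refine integrable_finsetSum _ fun i _ => integrable_bdd_mul (hg.meas_dx i) (K := K) ?_
      (W.integrable_avgMomentum i)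
    filter_upwards [ae_slab_mem T] with p hp using hg.abs_dx_le hK hp i

/-- By the chain rule the production is a combination of the integrands obtained from the test
functions `U`, `|U|²/2` and `H` and from the time derivative of `H²`. The explicit form suits the
algebra, this one the weak equations. -/
theorem crossProduction_ae_eq : crossProduction a d f H U μ =ᵐ[slab n T] fun p =>
    -((∑ i, dt (fun q => U q i) p * avgMomentum (pushed d f μ p) i)
      + (∑ i, ∑ j, dx j (fun q => U q i) p * avgFlux (pushed d f μ p) i j)
      + a * (∑ i, dx i (fun q => U q i) p) * avgHeightSq (pushed d f μ p)
      + ∑ i, U p i * avgForce d (f p) (μ p) i)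
    + (dt (halfSq U) p * avgHeight (pushed d f μ p)
      + ∑ j, dx j (halfSq U) p * avgMomentum (pushed d f μ p) j)
    - 2 * a * (dt H p * avgHeight (pushed d f μ p)
      + ∑ i, dx i H p * avgMomentum (pushed d f μ p) i)
    + a * dt (fun q => H q * H q) p := by
  obtain ⟨L, -, hL⟩ := W.exists_lip_height
  filter_upwards [ae_slab_mem_Ioo T, ae_slab_mem T, hL.diff_time] with p hp hp' ht
  simp only [crossProduction, dt_halfSq W.hU hp, dt_mul ht ht, dx_halfSq W.hU hp']
  ring

theorem integrable_crossProduction : Integrable (crossProduction a d f H U μ) (slab n T) := by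
  obtain ⟨L, hL0, hL⟩ := W.exists_lip_height
  obtain ⟨K, hK0, hK⟩ := W.hU.halfSq.exists_slabLipschitz W.hT
  refine Integrable.congr ?_ W.crossProduction_ae_eq.symm
  exact ((W.integrable_momentum_production.neg.add (W.integrable_mass_production hK0 hK)).sub
    ((W.integrable_mass_production hL0 hL).const_mul _)).add
    (((hL.mul hL hL0 hL0).integrable_dt (by positivity)).const_mul _)

theorem initial_height_sq : Integrable fun x => h₀ x ^ 2 := W.hh₀.integrable_sq

/-- The balance of `crossEnergy`. -/
theorem cross_balance : ∀ᵐ τ ∂(volume : Measure ℝ).restrict (Icc 0 T),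
    initialEnergy a h₀ u₀ + ∫ x, crossEnergy a H U (pushed d f μ) (τ, x)
      = (∫ p, crossProduction a d f H U μ p ∂slab n τ)
        - ∫ p in Icc 0 τ ×ˢ univ, crossConcentration a U μinf p ∂m := by
  obtain ⟨L, hL0, hL⟩ := W.exists_lip_height
  obtain ⟨K, hK0, hK⟩ := W.hU.halfSq.exists_slabLipschitz W.hT
  have hi1 : ∀ᵐ x, (∑ i, U (0, x) i * (h₀ x * u₀ x i)) = h₀ x * ‖u₀ x‖ ^ 2 := by
    filter_upwards [W.hsol.initial_velocity] with x hx
    rw [hx, norm_sq_eq_sum, Finset.mul_sum]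
    exact Finset.sum_congr rfl fun i _ => by ring
  have hi2 : ∀ᵐ x, halfSq U (0, x) * h₀ x = h₀ x * ‖u₀ x‖ ^ 2 / 2 := by
    filter_upwards [W.hsol.initial_velocity] with x hx
    rw [halfSq_eq, hx]; ring
  have hi3 : ∀ᵐ x, H (0, x) = h₀ x := W.hsol.initial_height
  filter_upwards [W.hmv.momentum U W.hU, W.hmv.mass _ W.hU.halfSq, W.mass_height,
    W.integrable_momentum_term.prod_right_ae, W.integrable_kinetic_term.prod_right_ae,
    W.integrable_height_term.prod_right_ae, W.integrable_heightSq_term.prod_right_ae,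
    ae_restrict_mem measurableSet_Icc] with τ e1 e2 e3 i1 i2 i3 i4 hτ
  have hle := slab_le (n := n) hτ.2
  have e4 := (hL.mul hL hL0 hL0).integral_dt (by positivity) hτ
  have r1 : ∫ x, ∑ i, (U (0, x) i * (h₀ x * u₀ x i)
        - U (τ, x) i * avgMomentum (pushed d f μ (τ, x)) i)
      = (∫ x, h₀ x * ‖u₀ x‖ ^ 2)
        - ∫ x, ∑ i, U (τ, x) i * avgMomentum (pushed d f μ (τ, x)) i := by
    rw [← integral_sub W.hu₀ i1]
    refine integral_congr_ae ?_
    filter_upwards [hi1] with x hx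
    rw [Finset.sum_sub_distrib, hx]
  have r2 : ∫ x, (halfSq U (0, x) * h₀ x - halfSq U (τ, x) * avgHeight (pushed d f μ (τ, x)))
      = (∫ x, h₀ x * ‖u₀ x‖ ^ 2) / 2
        - ∫ x, ‖U (τ, x)‖ ^ 2 / 2 * avgHeight (pushed d f μ (τ, x)) := by
    rw [← integral_div, ← integral_sub (W.hu₀.div_const 2) i2]
    refine integral_congr_ae ?_
    filter_upwards [hi2] with x hx
    rw [hx, halfSq_eq]
  have r3 : ∫ x, (H (0, x) * h₀ x - H (τ, x) * avgHeight (pushed d f μ (τ, x)))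
      = (∫ x, h₀ x ^ 2) - ∫ x, H (τ, x) * avgHeight (pushed d f μ (τ, x)) := by
    rw [← integral_sub W.initial_height_sq i3]
    refine integral_congr_ae ?_
    filter_upwards [hi3] with x hx
    rw [hx]; ring
  have r4 : ∫ x, (H (τ, x) * H (τ, x) - H (0, x) * H (0, x))
      = (∫ x, H (τ, x) * H (τ, x)) - ∫ x, h₀ x ^ 2 := by
    rw [← integral_sub i4 W.initial_height_sq]
    refine integral_congr_ae ?_
    filter_upwards [hi3] with x hx
    rw [hx]; ring
  have r5 : initialEnergy a h₀ u₀ = (∫ x, h₀ x * ‖u₀ x‖ ^ 2) / 2 + a * ∫ x, h₀ x ^ 2 := by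
    rw [initialEnergy, integral_add (W.hu₀.div_const 2) (W.initial_height_sq.const_mul a),
      integral_div, integral_const_mul]
  have r6 : ∫ x, crossEnergy a H U (pushed d f μ) (τ, x)
      = -(∫ x, ∑ i, U (τ, x) i * avgMomentum (pushed d f μ (τ, x)) i)
        + (∫ x, ‖U (τ, x)‖ ^ 2 / 2 * avgHeight (pushed d f μ (τ, x)))
        - 2 * a * (∫ x, H (τ, x) * avgHeight (pushed d f μ (τ, x)))
        + a * ∫ x, H (τ, x) * H (τ, x) :=
    (((HasIntegral.of_integrable i1).neg.add (HasIntegral.of_integrable i2)).sub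
      ((HasIntegral.of_integrable i3).const_mul (2 * a))).add
      ((HasIntegral.of_integrable i4).const_mul a) |>.eq
  have r7 := (integral_congr_ae (ae_mono hle W.crossProduction_ae_eq)).trans
    ((((HasIntegral.of_integrable (W.integrable_momentum_production.mono_measure hle)).neg.add
      (HasIntegral.of_integrable ((W.integrable_mass_production hK0 hK).mono_measure hle))).sub
      ((HasIntegral.of_integrable ((W.integrable_mass_production hL0 hL).mono_measure hle)).const_mul
        (2 * a))).add ((HasIntegral.of_integrable
        (((hL.mul hL hL0 hL0).integrable_dt (by positivity)).mono_measure hle)).const_mul a)).eq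
  rw [r1] at e1
  rw [r2] at e2
  rw [r3] at e3
  rw [r4] at e4
  rw [r5, r6, r7]
  have e1' := e1
  change _ + (∫ p in Icc 0 τ ×ˢ univ, crossConcentration a U μinf p ∂m) + _ = 0 at e1'
  -- The coefficients are the opposites of those of the four terms of `crossEnergy`. At time `0`
  -- these terms add up to minus the initial energy, which is why the latter stands on the left.
  linear_combination e1' - e2 + 2 * a * e3 - a * e4

end WeakStrongPair

/-! ### Time marginals -/

/-- The time marginal of the measure with density `e` with respect to `ρ`. -/
def timeMarginal (ρ : Measure (SpaceTime n)) (e : SpaceTime n → ℝ) : Measure ℝ :=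
  (ρ.withDensity fun p => ENNReal.ofReal (e p)).map Prod.fst

section TimeMarginal

variable {ρ : Measure (SpaceTime n)} {e : SpaceTime n → ℝ}

theorem isFiniteMeasure_timeMarginal (he : Integrable e ρ) :
    IsFiniteMeasure (timeMarginal ρ e) := by
  have : IsFiniteMeasure (ρ.withDensity fun p => ENNReal.ofReal (e p)) :=
    isFiniteMeasure_withDensity_ofReal he.2
  unfold timeMarginal
  infer_instance

theorem integral_timeMarginal (he : Integrable e ρ) (h0 : ∀ᵐ p ∂ρ, 0 ≤ e p) {χ : ℝ → ℝ}
    (hχ : Continuous χ) : ∫ t, χ t ∂timeMarginal ρ e = ∫ p, χ p.1 * e p ∂ρ := by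
  rw [timeMarginal, integral_map measurable_fst.aemeasurable hχ.aestronglyMeasurable,
    integral_withDensity_eq_integral_toReal_smul₀ he.aestronglyMeasurable.aemeasurable.ennreal_ofReal
      (Eventually.of_forall fun _ => ENNReal.ofReal_lt_top)]
  refine integral_congr_ae ?_
  filter_upwards [h0] with p hp
  rw [ENNReal.toReal_ofReal hp, smul_eq_mul, mul_comm]

theorem timeMarginal_real_Icc (he : Integrable e ρ) (h0 : ∀ᵐ p ∂ρ, 0 ≤ e p) (t : ℝ) :
    (timeMarginal ρ e).real (Icc 0 t) = ∫ p in slabSet n t, e p ∂ρ := by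
  have hpre : (Prod.fst : SpaceTime n → ℝ) ⁻¹' Icc 0 t = slabSet n t := by
    ext p; simp
  rw [timeMarginal, measureReal_def, Measure.map_apply measurable_fst measurableSet_Icc, hpre,
    withDensity_apply _ (measurableSet_slabSet t),
    integral_eq_lintegral_of_nonneg_ae (ae_restrict_of_ae h0) he.aestronglyMeasurable.restrict]

/-- Test functions supported in `(0, T)` cannot detect mass at the end points, so its absence has to
be supplied to the Grönwall lemma separately. -/
theorem timeMarginal_compl_eq_zero {T : ℝ} (h : ∀ᵐ p ∂ρ, p.1 ∈ Ioo 0 T) :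
    timeMarginal ρ e (Ioo 0 T)ᶜ = 0 := by
  rw [timeMarginal, Measure.map_apply measurable_fst measurableSet_Ioo.compl]
  exact withDensity_absolutelyContinuous _ _ h

theorem ae_eq_zero_of_timeMarginal (he : Integrable e ρ) (h0 : ∀ᵐ p ∂ρ, 0 ≤ e p)
    (h : timeMarginal ρ e = 0) : ∀ᵐ p ∂ρ, e p = 0 := by
  rw [timeMarginal, Measure.map_eq_zero_iff measurable_fst.aemeasurable,
    withDensity_eq_zero_iff he.aestronglyMeasurable.aemeasurable.ennreal_ofReal] at h
  filter_upwards [h, h0] with p hp hp'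
  exact le_antisymm (ENNReal.ofReal_eq_zero.mp hp) hp'

end TimeMarginal

/-! ### The relative energy inequality and its consequences -/

namespace WeakStrongPair

variable {a d T c : ℝ} {f : SpaceTime n → Vec n}
  {h₀ : Torus n → ℝ} {u₀ : Torus n → Vec n} {H : SpaceTime n → ℝ} {U : SpaceTime n → Vec n}
  {μ : Kernel (SpaceTime n) (Phase n)} {m : Measure (SpaceTime n)}
  {μinf : Kernel (SpaceTime n) (Phase n)}
  (W : WeakStrongPair a d T c f h₀ u₀ H U μ m μinf)

include W

theorem ae_pushed : ∀ᵐ p ∂slab n T, IsProbabilityMeasure (pushed d f μ p) ∧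
    HasIntegral (pushed d f μ p)
      (fun q => ‖q.2 - √q.1 • U p‖ ^ 2 / 2 + a * (q.1 - H p) ^ 2)
      (relEnergy a (H p) (U p) (pushed d f μ p)) := by
  filter_upwards [W.ae_prob, W.ae_moment, W.hmv.young.nonneg] with p hp hM hpos
  have := isProbabilityMeasure_pushed (d := d) (f := f) hp
  refine ⟨this, hasIntegral_relEnergy hM ?_⟩
  exact (ae_map_iff (measurable_pushMap d (f p)).aemeasurable
    (measurableSet_le measurable_const measurable_fst)).mpr hpos

theorem relEnergy_nonneg :
    ∀ᵐ p ∂slab n T, 0 ≤ relEnergy a (H p) (U p) (pushed d f μ p) := by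
  have ha := W.ha
  filter_upwards [W.ae_pushed] with p hp
  rw [← hp.2.eq]
  exact integral_nonneg fun q => by positivity

theorem integrable_relEnergy :
    Integrable (fun p => relEnergy a (H p) (U p) (pushed d f μ p)) (slab n T) := by
  simp only [relEnergy_eq]
  exact W.integrable_avgEnergy.add W.integrable_crossEnergy

theorem integrable_energy_inf : Integrable (fun p => avgEnergy a (μinf p)) m :=
  (quadGrowth_energy a).integrable_inf W.hmv.young

theorem energy_inf_nonneg (p : SpaceTime n) : 0 ≤ avgEnergy a (μinf p) :=
  integral_nonneg fun q => by have := W.ha; positivity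

theorem ae_mem_slabSet : ∀ᵐ p ∂m, p ∈ slabSet n T := W.hmv.young.support

theorem ae_mem_Ioo : ∀ᵐ p ∂m, p.1 ∈ Ioo 0 T := by
  have h : ∀ᵐ p ∂m, p ∉ ({0, T} : Set ℝ) ×ˢ (univ : Set (Torus n)) :=
    measure_eq_zero_iff_ae_notMem.mp W.hadm.end_points
  filter_upwards [W.ae_mem_slabSet, h] with p hp hp'
  have h1 : p.1 ≠ 0 ∧ p.1 ≠ T := by
    simpa using hp'
  exact ⟨lt_of_le_of_ne hp.1.1 h1.1.symm, lt_of_le_of_ne hp.1.2 h1.2⟩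

theorem integrable_crossConcentration : Integrable (crossConcentration a U μinf) m := by
  obtain ⟨M, hM0, hM⟩ := W.exists_lip_velocity
  have hm : m.restrict (slabSet n T) = m := Measure.restrict_eq_self_of_ae_mem W.ae_mem_slabSet
  have hmeas : ∀ i j, AEStronglyMeasurable (dx j (fun q => U q i)) m := fun i j => by
    have := (W.hU.coord i).aestronglyMeasurable_dx W.hT j m
    rwa [hm] at this
  have hb : ∀ i j, ∀ᵐ p ∂m, |dx j (fun q => U q i) p| ≤ M := fun i j => by
    filter_upwards [W.ae_mem_slabSet] with p hp using (hM i).abs_dx_le hM0 hp j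
  refine Integrable.add ?_ ?_
  · exact integrable_finsetSum _ fun i _ => integrable_finsetSum _ fun j _ =>
      integrable_bdd_mul (hmeas i j) (hb i j) ((quadGrowth_flux i j).integrable_inf W.hmv.young)
  · have h1 : Integrable (fun p => ∑ i, dx i (fun q => U q i) p * avgHeightSq (μinf p)) m :=
      integrable_finsetSum _ fun i _ =>
        integrable_bdd_mul (hmeas i i) (hb i i) (quadGrowth_heightSq.integrable_inf W.hmv.young)
    refine (h1.const_mul a).congr (Eventually.of_forall fun p => ?_)
    simp only [← Finset.sum_mul, mul_assoc]

theorem ae_production_le {M : ℝ} (hM0 : 0 ≤ M)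
    (hM : ∀ i, SlabLipschitz T (fun p => U p i) M) : ∀ᵐ p ∂slab n T,
    avgPower d (f p) (μ p) + crossProduction a d f H U μ p
      ≤ 2 * n ^ 2 * M * relEnergy a (H p) (U p) (pushed d f μ p)
        - a * ∑ i, dx i (fun q => H q * H q * U q i) p := by
  obtain ⟨L, hL0, hL⟩ := W.exists_lip_height
  filter_upwards [W.ae_strong, W.ae_prob, W.ae_moment, W.hmv.young.nonneg, ae_slab_mem T,
    hL.diff_space, ae_all_iff.mpr fun i => (hM i).diff_space]
    with p ⟨b, hb, hmass, hmom⟩ hp hmo hpos hpm hx ux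
  -- The averaged inequality at `p` with the derivatives of the strong solution inserted; the bound
  -- `M` on the components of `U` also bounds all `∂ⱼUᵢ`. The left-hand side is the power plus
  -- `crossProduction`, and the leftover is `div(H² U)`.
  have key := avg_production_le (U := U p) (Ut := WithLp.toLp 2 fun i => dt (fun q => U q i) p)
    (Hx := WithLp.toLp 2 fun i => dx i H p) (D := fun i j => dx j (fun q => U q i) p)
    W.hd hp hmo hpos W.ha.le hmass hmom hb (fun i j => (hM i).abs_dx_le hM0 hpm j)
  have e1 : ∀ i, dx i (fun q => H q * H q * U q i) p
      = 2 * H p * (dx i H p * U p i) + H p ^ 2 * dx i (fun q => U q i) p := fun i => by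
    have h1 := dx_mul (g := fun q => H q * H q) (k := fun q => U q i) (p := p) (i := i)
      ((hx i).mul (hx i)) (ux i i)
    rw [h1, dx_mul (g := H) (k := H) (hx i) (hx i)]
    ring
  simp only [e1, Finset.sum_add_distrib, ← Finset.mul_sum]
  refine le_trans (le_of_eq ?_) key
  simp only [crossProduction, sub_mul, Finset.sum_sub_distrib, mul_assoc, ← Finset.mul_sum]
  ring

/-- Integrating over the slab removes the divergence of the Lipschitz field `H² U` by periodicity,
leaving only the relative energy. -/
theorem integral_production_le {M : ℝ} (hM0 : 0 ≤ M)
    (hM : ∀ i, SlabLipschitz T (fun p => U p i) M) {τ : ℝ} (hτ : τ ∈ Icc 0 T) :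
    (∫ p, avgPower d (f p) (μ p) ∂slab n τ) + ∫ p, crossProduction a d f H U μ p ∂slab n τ
      ≤ 2 * n ^ 2 * M * ∫ p, relEnergy a (H p) (U p) (pushed d f μ p) ∂slab n τ := by
  obtain ⟨L, hL0, hL⟩ := W.exists_lip_height
  have hle := slab_le (n := n) hτ.2
  have hlip : ∀ i, SlabLipschitz T (fun q => H q * H q * U q i) (2 * (2 * L * L) * M) := fun i =>
    (hL.mul hL hL0 hL0).mul (hM i) (by positivity) hM0
  have hdiv : HasIntegral (slab n τ) (fun p => ∑ i, dx i (fun q => H q * H q * U q i) p)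
      (∑ i : Fin n, 0) := HasIntegral.sum fun i =>
    ⟨((hlip i).integrable_dx (by positivity) i).mono_measure hle,
      (hlip i).integral_dx hτ i⟩
  have h1 := ((HasIntegral.of_integrable (W.hadm.power_integrable.mono_measure hle)).add
    (HasIntegral.of_integrable (W.integrable_crossProduction.mono_measure hle)))
  have h2 := ((HasIntegral.of_integrable (W.integrable_relEnergy.mono_measure hle)).const_mul
    (2 * n ^ 2 * M)).sub (hdiv.const_mul a)
  have := h1.mono h2 (ae_mono hle (W.ae_production_le hM0 hM))
  simpa using this

theorem integral_concentration_le {M : ℝ} (hM0 : 0 ≤ M)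
    (hM : ∀ i, SlabLipschitz T (fun p => U p i) M) (τ : ℝ) :
    -(∫ p in slabSet n τ, crossConcentration a U μinf p ∂m)
      ≤ 2 * n ^ 2 * M * ∫ p in slabSet n τ, avgEnergy a (μinf p) ∂m := by
  refine (HasIntegral.of_integrable W.integrable_crossConcentration.restrict).neg.mono
    ((HasIntegral.of_integrable W.integrable_energy_inf.restrict).const_mul (2 * n ^ 2 * M))
    (ae_restrict_of_ae ?_)
  filter_upwards [W.ae_mem_slabSet, W.hmv.young.prob_inf, W.hmv.young.moment_inf] with p hp hpr hmo
  exact avg_concentration_le (D := fun i j => dx j (fun q => U q i) p) W.ha.le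
    (fun i j => (hM i).abs_dx_le hM0 hp j) hmo

/-- The integral over `[0, t]` is a primitive of an integrable function of time. Continuity makes
the right-hand side of the energy inequality integrable in `t`. -/
theorem continuousOn_power :
    ContinuousOn (fun t => ∫ p, avgPower d (f p) (μ p) ∂slab n t) (Icc 0 T) := by
  have h1 : IntegrableOn (fun t => ∫ x, avgPower d (f (t, x)) (μ (t, x))) (Icc 0 T) :=
    W.hadm.power_integrable.integral_prod_left
  refine (intervalIntegral.continuousOn_primitive_Icc h1).congr fun t ht => ?_
  exact integral_prod _ (W.hadm.power_integrable.mono_measure (slab_le ht.2))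

/-- The relative energy, together with its concentration part, vanishes. -/
theorem timeMarginal_eq_zero :
    timeMarginal (slab n T) (fun p => relEnergy a (H p) (U p) (pushed d f μ p))
      + timeMarginal m (fun p => avgEnergy a (μinf p)) = 0 := by
  obtain ⟨M, hM0, hM⟩ := W.exists_lip_velocity
  have hi1 := W.integrable_relEnergy
  have hi2 := W.integrable_energy_inf
  have hn1 := W.relEnergy_nonneg
  have hn2 : ∀ᵐ p ∂m, 0 ≤ avgEnergy a (μinf p) := Eventually.of_forall W.energy_inf_nonneg
  have hf1 := isFiniteMeasure_timeMarginal hi1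
  have hf2 := isFiniteMeasure_timeMarginal hi2
  set θ := timeMarginal (slab n T) (fun p => relEnergy a (H p) (U p) (pushed d f μ p))
      + timeMarginal m (fun p => avgEnergy a (μinf p)) with hθ
  have hC : 0 ≤ 2 * (n : ℝ) ^ 2 * M := by positivity
  -- The summand `1` makes the constant strictly positive, as `M` may be zero.
  refine measure_eq_zero_of_gronwall (T := T) (C := 2 * n ^ 2 * M + 1) (by positivity) ?_ ?_
  · rw [hθ, Measure.add_apply, timeMarginal_compl_eq_zero (ae_slab_mem_Ioo T),
      timeMarginal_compl_eq_zero W.ae_mem_Ioo, add_zero]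
  intro χ hχ hχc hχs hχ0
  have hχm : Continuous χ := hχ.continuous
  obtain ⟨R, hR⟩ := hχc.exists_bound_of_continuous hχm
  -- The energy stays a space-time integral, the form in which admissibility bounds it. The cross
  -- terms are integrated in space first, since their balance holds for a.e. time.
  have hE : ∫ t, χ t ∂θ = (∫ p, χ p.1 * avgEnergy a (pushed d f μ p) ∂slab n T)
      + (∫ t in Icc 0 T, χ t * ∫ x, crossEnergy a H U (pushed d f μ) (t, x))
      + ∫ p, χ p.1 * avgEnergy a (μinf p) ∂m := by
    have hχi1 : Integrable (fun p => χ p.1 * avgEnergy a (pushed d f μ p)) (slab n T) :=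
      integrable_bdd_mul (hχm.measurable.comp measurable_fst).aestronglyMeasurable
        (Eventually.of_forall fun p => hR p.1) W.integrable_avgEnergy
    have hχi2 : Integrable (fun p => χ p.1 * crossEnergy a H U (pushed d f μ) p) (slab n T) :=
      integrable_bdd_mul (hχm.measurable.comp measurable_fst).aestronglyMeasurable
        (Eventually.of_forall fun p => hR p.1) W.integrable_crossEnergy
    rw [hθ, integral_add_measure (hχm.integrable_of_hasCompactSupport hχc)
      (hχm.integrable_of_hasCompactSupport hχc), integral_timeMarginal hi1 hn1 hχm,
      integral_timeMarginal hi2 hn2 hχm]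
    congr 1
    simp only [relEnergy_eq, mul_add]
    rw [integral_add hχi1 hχi2]
    congr 1
    refine (integral_prod _ hχi2).trans ?_
    simp only [integral_const_mul]
  have hF : ∀ t ∈ Icc 0 T, θ.real (Icc 0 t)
      = (∫ p, relEnergy a (H p) (U p) (pushed d f μ p) ∂slab n t)
        + ∫ p in slabSet n t, avgEnergy a (μinf p) ∂m := fun t ht => by
    rw [hθ, measureReal_add_apply, timeMarginal_real_Icc hi1 hn1, timeMarginal_real_Icc hi2 hn2,
      ← slab_eq_restrict ht.2]
  have hcross : Integrable (fun t => χ t * ∫ x, crossEnergy a H U (pushed d f μ) (t, x))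
      ((volume : Measure ℝ).restrict (Icc 0 T)) :=
    integrable_bdd_mul hχm.aestronglyMeasurable (Eventually.of_forall hR)
      W.integrable_crossEnergy.integral_prod_left
  have hpow : Integrable (fun t => χ t * (initialEnergy a h₀ u₀
      + ∫ p, avgPower d (f p) (μ p) ∂slab n t)) ((volume : Measure ℝ).restrict (Icc 0 T)) :=
    (hχm.continuousOn.mul (continuousOn_const.add W.continuousOn_power)).integrableOn_Icc
  have hG : Integrable (fun t => (2 * n ^ 2 * M + 1) * (χ t * θ.real (Icc 0 t)))
      ((volume : Measure ℝ).restrict (Icc 0 T)) := by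
    refine (integrable_bdd_mul hχm.aestronglyMeasurable (Eventually.of_forall hR)
      (Integrable.of_bound (measurable_measureReal_Icc θ).aestronglyMeasurable (θ.real univ)
        (Eventually.of_forall fun t => ?_))).const_mul _
    rw [Real.norm_of_nonneg measureReal_nonneg]
    exact measureReal_mono (subset_univ _)
  have hadm := W.hadm.energy χ hχ hχc hχs hχ0
  have hfinal : (∫ t in Icc 0 T, χ t * (initialEnergy a h₀ u₀
      + ∫ p, avgPower d (f p) (μ p) ∂slab n t))
      + (∫ t in Icc 0 T, χ t * ∫ x, crossEnergy a H U (pushed d f μ) (t, x))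
      ≤ (2 * n ^ 2 * M + 1) * ∫ t in Icc 0 T, χ t * θ.real (Icc 0 t) := by
    rw [← integral_add hpow hcross, ← integral_const_mul]
    refine integral_mono_ae (hpow.add hcross) hG ?_
    filter_upwards [W.cross_balance, ae_restrict_mem measurableSet_Icc] with t hbal ht
    have h1 := W.integral_production_le hM0 hM ht
    have h2 := W.integral_concentration_le hM0 hM t
    have h3 := hF t ht
    have h4 : (0 : ℝ) ≤ θ.real (Icc 0 t) := measureReal_nonneg
    -- The balance replaces the initial energy plus the cross terms by their production, which
    -- together with the power is controlled by the relative energy up to time `t`, concentration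
    -- included.
    have h5 : initialEnergy a h₀ u₀ + (∫ p, avgPower d (f p) (μ p) ∂slab n t)
        + ∫ x, crossEnergy a H U (pushed d f μ) (t, x)
        ≤ (2 * n ^ 2 * M + 1) * θ.real (Icc 0 t) := by
      have h6 : 2 * n ^ 2 * M * θ.real (Icc 0 t)
          = 2 * n ^ 2 * M * (∫ p, relEnergy a (H p) (U p) (pushed d f μ p) ∂slab n t)
            + 2 * n ^ 2 * M * ∫ p in slabSet n t, avgEnergy a (μinf p) ∂m := by
        rw [h3, mul_add]
      linarith
    have h7 := mul_le_mul_of_nonneg_left h5 (hχ0 t)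
    rw [← mul_add]
    linarith
  rw [hE]
  linarith

theorem timeMarginal_relEnergy :
    timeMarginal (slab n T) (fun p => relEnergy a (H p) (U p) (pushed d f μ p)) = 0 :=
  Measure.nonpos_iff_eq_zero'.mp
    ((Measure.le_add_right le_rfl).trans_eq W.timeMarginal_eq_zero)

theorem timeMarginal_energy_inf : timeMarginal m (fun p => avgEnergy a (μinf p)) = 0 :=
  Measure.nonpos_iff_eq_zero'.mp
    ((Measure.le_add_left le_rfl).trans_eq W.timeMarginal_eq_zero)

theorem pushed_eq_dirac :
    ∀ᵐ p ∂slab n T, pushed d f μ p = Measure.dirac (H p, √(H p) • U p) := by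
  have ha := W.ha
  filter_upwards [ae_eq_zero_of_timeMarginal W.integrable_relEnergy W.relEnergy_nonneg
      W.timeMarginal_relEnergy,
    W.ae_pushed] with p h0 ⟨hpr, hint⟩
  have h1 := hint.eq.trans h0
  rw [integral_eq_zero_iff_of_nonneg (fun q => by positivity) hint.int] at h1
  -- A vanishing average of a nonnegative integrand forces both squares to vanish, so the identity
  -- is a.e. constant and the probability measure is a point mass.
  have h2 : (id : Phase n → Phase n) =ᵐ[pushed d f μ p] fun _ => (H p, √(H p) • U p) := by
    filter_upwards [h1] with q hq
    have hq' : ‖q.2 - √q.1 • U p‖ ^ 2 / 2 + a * (q.1 - H p) ^ 2 = 0 := hq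
    have k1 : 0 ≤ ‖q.2 - √q.1 • U p‖ ^ 2 / 2 := by positivity
    have k2 : 0 ≤ a * (q.1 - H p) ^ 2 := by positivity
    have k3 : q.1 = H p := by
      have : a * (q.1 - H p) ^ 2 = 0 := by linarith
      have := (mul_eq_zero.mp this).resolve_left ha.ne'
      exact sub_eq_zero.mp (pow_eq_zero_iff two_ne_zero |>.mp this)
    have k4 : q.2 = √q.1 • U p := by
      have : ‖q.2 - √q.1 • U p‖ ^ 2 = 0 := by linarith
      exact sub_eq_zero.mp (norm_eq_zero.mp (pow_eq_zero_iff two_ne_zero |>.mp this))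
    exact Prod.ext k3 (by rw [id, k4, k3])
  calc pushed d f μ p = (pushed d f μ p).map id := Measure.map_id.symm
    _ = (pushed d f μ p).map fun _ => (H p, √(H p) • U p) := Measure.map_congr h2
    _ = Measure.dirac (H p, √(H p) • U p) := by rw [Measure.map_const, measure_univ, one_smul]

/-- Zero energy forces `β = 0` almost surely, which contradicts `|β₁|⁴ + |β'|⁴ = 1`. As `μinf p` is
a probability measure for `m`-a.e. `p`, no such `p` can carry mass. -/
theorem concentration_eq_zero : m = 0 := by
  have ha := W.ha
  have : ∀ᵐ _ ∂m, False := by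
    filter_upwards [ae_eq_zero_of_timeMarginal W.integrable_energy_inf
      (Eventually.of_forall W.energy_inf_nonneg) W.timeMarginal_energy_inf, W.hmv.young.prob_inf, W.hmv.young.sphere,
      W.hmv.young.moment_inf] with p h0 hp hs hmo
    have h1 : ∫ q, (‖q.2‖ ^ 2 / 2 + a * q.1 ^ 2) ∂μinf p = 0 := h0
    rw [integral_eq_zero_iff_of_nonneg (fun q => by positivity)
      ((quadGrowth_energy a).integrable hmo)] at h1
    have h2 : ∀ᵐ _ ∂μinf p, False := by
      filter_upwards [h1, hs] with q hq hq'
      have hq0 : ‖q.2‖ ^ 2 / 2 + a * q.1 ^ 2 = 0 := hq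
      have k1 : 0 ≤ ‖q.2‖ ^ 2 / 2 := by positivity
      have k2 : 0 ≤ a * q.1 ^ 2 := by positivity
      have k3 : q.1 = 0 := by
        have : a * q.1 ^ 2 = 0 := by linarith
        exact pow_eq_zero_iff two_ne_zero |>.mp ((mul_eq_zero.mp this).resolve_left ha.ne')
      have k4 : ‖q.2‖ = 0 := by
        have : ‖q.2‖ ^ 2 = 0 := by linarith
        exact pow_eq_zero_iff two_ne_zero |>.mp this
      have := hq'.1
      rw [k3, k4] at this
      norm_num at this
    rw [eventually_false_iff_eq_bot, ae_eq_bot] at h2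
    exact IsProbabilityMeasure.ne_zero _ h2
  rwa [eventually_false_iff_eq_bot, ae_eq_bot] at this

end WeakStrongPair

end SavageHutter

end

theorem theorem5p2 (n : ℕ) (hn : n = 1 ∨ n = 2)
    (a d T c : ℝ) (ha : 0 < a) (hd : 0 < d) (hT : 0 < T) (hc : 0 < c)
    (f : SpaceTime n → Vec n) (hf : IsLinftyL2 T f)
    (h₀ : Torus n → ℝ) (u₀ : Torus n → Vec n)
    (hh₀c : ∀ᵐ x, c ≤ h₀ x) (hh₀ : MemLp h₀ 2)
    (hu₀ : Integrable (fun x => h₀ x * ‖u₀ x‖ ^ 2))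
    (H : SpaceTime n → ℝ) (U : SpaceTime n → Vec n)
    (hH : ∃ K : ℝ≥0, LipschitzOnWith K H (Icc 0 T ×ˢ univ))
    (hU : IsC1 T U)
    (hHc : ∀ t ∈ Icc 0 T, ∀ x, c ≤ H (t, x))
    (hsol : IsStrongSolution a d T f h₀ u₀ H U)
    (μ : Kernel (SpaceTime n) (Phase n)) (m : Measure (SpaceTime n))
    (μinf : Kernel (SpaceTime n) (Phase n))
    (hmv : IsMeasureValuedSolution a d T f h₀ u₀ μ m μinf)
    (hadm : IsAdmissible a d T f h₀ u₀ μ m μinf) :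
    (∀ᵐ p ∂slab n T, pushed d f μ p = Measure.dirac (H p, √(H p) • U p)) ∧ m = 0 := by
  have W : WeakStrongPair a d T c f h₀ u₀ H U μ m μinf :=
    ⟨ha, hd, hT, hc, hf.1, hh₀, hu₀, hH, hU, hHc, hsol, hmv, hadm⟩
  exact ⟨W.pushed_eq_dirac, W.concentration_eq_zero⟩
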